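/- **Setting.** Let $n\ge 2$, let $N$ be a smooth Riemannian manifold of dimension $n+1$ (not assumed complete) and let $g\in C^{1,1}(N)$, $g>0$. Let $W:\mathbb R\to[0,\infty)$ be a $C^2$ double-well potential: its zeros are exactly $\pm1$, $W''(\pm1)>0$, and it grows quadratically outside $[-2,2]$. Put $\sigma=\int_{-1}^1\sqrt{W(s)/2}\,ds$ and $\Phi(s)=\int_0^s\sqrt{W(a)/2}\,da$. For a function $u$ on $N$ let $V^{u}=\int_{\mathbb R}|\{\Phi(u)=t\}|\,dt$, where $|M|$ denotes the multiplicity one varifold of a hypersurface $M$. A *limit $(g,0)$-varifold* on $N$ is a limit, in the sense of varifolds, $V_N=\lim_j V^{u_j}$, where $\varepsilon_j\to0^+$, $g_j\in C^{1,1}(N)$, $g_j\to g$ locally in $C^{1,1}$, and $u_j$ is a critical point of $\int_N \varepsilon_j\frac{|\nabla u|^2}{2}+\frac{W(u)}{\varepsilon_j}-\sigma g_j u$. An integral $n$-varifold $V$ has *quasi-embedded PMC$(g,0)$ structure* near $Y\in\operatorname{spt}\|V\|$ if near $Y$ one of the following holds (all disks are $C^2$ embedded and contain $Y$; mean curvature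 is taken in the Riemannian metric): (i) $V=|D|$, where $D$ has scalar mean curvature $g$ for a continuous choice of unit normal; (ii) $V=m|D'|$ with $m\geq 2$ even and $D'$ minimal; (iii) $\Theta(\|V\|,Y)=2$ and $V=|D_1|+|D_2|$, with $D_1\ne D_2$ meeting only tangentially, each on one side of the other, each with mean curvature vector of length $g$ pointing away from the other; (iv) $\Theta(\|V\|,Y)=m$ and $V=|D|+(m-1)|D'|$ with $m\ge3$ odd, $D\neq D'$ meeting only tangentially, each on one side of the other, $D'$ minimal, and $D$ with mean curvature vector of length $g$ pointing away from $D'$; (v) $\Theta(\|V\|,Y)=m$ and $V=|D_1|+|D_2|+(m-2)|D'|$ with $m\ge4$ even, $D_1,D_2$ as in (iii), and $D'$ minimal, different from $D_1$ and $D_2$, lying between them and meeting them only tangentially. **Statement.** Let $y\in N$, let $B=B^n_1\subset\mathbb R^n$ be the open unit ball, and let $\mathcal O=B\times\mathbb R\subset\mathbb R^{n+1}\cong T_yN$. Let $\exp_y$ be a diffeomorphism of $B_R^{n+1}(0)$ onto its image, let $\psi(X)=\exp_y(z+\rho X)$ with $z\in\mathbb R^{n+1}$, $\rho>0$, and let $U=\{X\in\mathcal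 O: z+\rho X\in B_R^{n+1}(0)\}$, equipped with the metric and the function $g\circ\psi$ pulled back by $\psi$. Let $V$ be a varifold on $\mathcal O$ which in $U$ is the pull-back by $\psi$ of $\sigma^{-1}V_N$ for a limit $(g,0)$-varifold $V_N$. Suppose that, for some $q\in\mathbb N$, $$V=\sum_{j=1}^q|\operatorname{graph}(u_j)|,\qquad u_1\le u_2\le\dots\le u_q \text{ on } B,$$ where $u_j\in C^{1,\alpha}(B)$ for some $\alpha\in(0,1)$ and $\operatorname{graph}(u_j)\subset U$. Suppose that there is a point of $\operatorname{spt}\|V\|\cap\mathcal O$ at which $\|V\|$ has density $q$, and that $V$ has quasi-embedded PMC$(g,0)$ structure near every $X\in\operatorname{spt}\|V\|\cap\mathcal O$ with $\Theta(\|V\|,X)\le q-1$. Then there are $\widetilde q\in\{1,2,3\}$, $\widetilde q\le q$, and functions $\widetilde u_1\le\dots\le\widetilde u_{\widetilde q}$ in $C^{1,\alpha}(B)$ such that $$\operatorname{spt}\|V\|\cap\mathcal O=\bigcup_{j=1}^{\widetilde q}\operatorname{graph}(\widetilde u_j),$$ and there is a nonempty open set $\Omega\subset B$ such that $\widetilde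 u_1<\dots<\widetilde u_{\widetilde q}$ on $\Omega$ and $\operatorname{spt}\|V\|\cap(\Omega\times\mathbb R)$ is an embedded $C^1$ hypersurface. Here $C^{1,\alpha}(B)$ means $C^1$ with gradient $\alpha$-Hölder on compact subsets of $B$; if the gradients of all the $u_j$ are $\alpha$-Hölder on all of $B$, then so are those of all the $\widetilde u_j$. -/

import Mathlib

open MeasureTheory Set Filter Topology
open scoped ContDiff Manifold ENNReal

noncomputable section

/-! ### The ambient Euclidean space -/

/-- `ℝⁿ` with its Euclidean structure. -/
abbrev Rn (n : ℕ) : Type := EuclideanSpace ℝ (Fin n)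

/-- `ℝⁿ⁺¹` with its Euclidean structure. -/
abbrev Rn1 (n : ℕ) : Type := EuclideanSpace ℝ (Fin (n + 1))

/-- The point `(x, t)` of `ℝⁿ × ℝ = ℝⁿ⁺¹`. -/
def pt {n : ℕ} (x : Rn n) (t : ℝ) : Rn1 n :=
  WithLp.toLp 2 (Fin.snoc (α := fun _ => ℝ) (fun i => x i) t)

/-- The open unit ball `B` of `ℝⁿ`. -/
def unitBall (n : ℕ) : Set (Rn n) := Metric.ball 0 1

/-- The open cylinder `Ω × ℝ` in `ℝⁿ⁺¹`. -/
def cylinderOver {n : ℕ} (Ω : Set (Rn n)) : Set (Rn1 n) :=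
  {X | ∃ x ∈ Ω, ∃ t, X = pt x t}

/-- The graph `{(x, f x) : x ∈ Ω}`. -/
def graphOver {n : ℕ} (Ω : Set (Rn n)) (f : Rn n → ℝ) : Set (Rn1 n) := (fun x => pt x (f x)) '' Ω

/-- The gradient of `f` is `α`-Hölder on `S`. -/
def HolderGradOn {n : ℕ} (α : ℝ) (S : Set (Rn n)) (f : Rn n → ℝ) : Prop :=
  ∃ L : ℝ, ∀ x ∈ S, ∀ y ∈ S, ‖fderiv ℝ f x - fderiv ℝ f y‖ ≤ L * ‖x - y‖ ^ α

/-- `f ∈ C^{1,α}(Ω)` for an open set `Ω`: `f` is `C¹` on `Ω` and its gradient is `α`-Hölder on the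
compact subsets of `Ω`. -/
def IsC1Alpha {n : ℕ} (α : ℝ) (Ω : Set (Rn n)) (f : Rn n → ℝ) : Prop :=
  ContDiffOn ℝ 1 f Ω ∧ ∀ K ⊆ Ω, IsCompact K → HolderGradOn α K f

/-! ### Varifolds of dimension `n` in open subsets of `ℝⁿ⁺¹` -/

/-- The orthogonal projection of `ℝⁿ⁺¹` onto the orthogonal complement of `ν`. A hyperplane (an
element of the Grassmannian) is identified with the orthogonal projection onto it. -/
def normalProj {n : ℕ} (ν : Rn1 n) : Rn1 n →L[ℝ] Rn1 n := (ℝ ∙ ν)ᗮ.starProjection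

/-- An `n`-varifold on `O ⊆ ℝⁿ⁺¹`: a Radon measure on `O × G(n+1, n)`. -/
structure Varifold (n : ℕ) (O : Set (Rn1 n)) where
  measure : Measure (Rn1 n × (Rn1 n →L[ℝ] Rn1 n))
  carrier : ∀ᵐ P ∂measure, P.1 ∈ O ∧ ∃ ν : Rn1 n, ‖ν‖ = 1 ∧ P.2 = normalProj ν
  locallyFinite : ∀ K ⊆ O, IsCompact K → measure (K ×ˢ univ) < ⊤

/-- The weight measure `‖V‖`. -/
def Varifold.weight {n : ℕ} {O : Set (Rn1 n)} (V : Varifold n O) : Measure (Rn1 n) :=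
  V.measure.map Prod.fst

/-- The support of `‖V‖` in `O`. -/
def Varifold.spt {n : ℕ} {O : Set (Rn1 n)} (V : Varifold n O) : Set (Rn1 n) :=
  V.weight.support ∩ O

/-- The density `Θ(‖V‖, X) = lim_{r → 0} ‖V‖(B_r(X)) / (ω_n rⁿ)` exists and equals `θ`. -/
def Varifold.HasDensity {n : ℕ} {O : Set (Rn1 n)} (V : Varifold n O) (X : Rn1 n) (θ : ℝ≥0∞) :
    Prop :=
  Tendsto (fun r : ℝ => V.weight (Metric.ball X r) / volume (Metric.ball (0 : Rn n) r))
    (𝓝[>] 0) (𝓝 θ)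

/-- The hypersurface `x ↦ Y + T (x, f x)`: the graph of `f` in the Euclidean frame with origin `Y`
and with axes turned by the linear isometry `T`. -/
def sheet {n : ℕ} (Y : Rn1 n) (T : Rn1 n ≃ₗᵢ[ℝ] Rn1 n) (f : Rn n → ℝ) (x : Rn n) : Rn1 n :=
  Y + T (pt x (f x))

/-- A Euclidean normal vector of the sheet: `T (-∇f, 1)`. -/
def sheetNormal {n : ℕ} (T : Rn1 n ≃ₗᵢ[ℝ] Rn1 n) (f : Rn n → ℝ) (x : Rn n) : Rn1 n :=
  T (pt (-(gradient f x)) 1)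

/-- The multiplicity one varifold of the sheet over `Ω`, written with its area element:
`φ ↦ ∫_Ω φ(X(x), T_{X(x)}) √(1 + |∇f|²) dx`. -/
def sheetVarifold {n : ℕ} (Ω : Set (Rn n)) (Y : Rn1 n) (T : Rn1 n ≃ₗᵢ[ℝ] Rn1 n) (f : Rn n → ℝ) :
    Measure (Rn1 n × (Rn1 n →L[ℝ] Rn1 n)) :=
  ((volume.restrict Ω).withDensity
      (fun x => ENNReal.ofReal (Real.sqrt (1 + ‖gradient f x‖ ^ 2)))).map
    (fun x => (sheet Y T f x, normalProj (sheetNormal T f x)))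

/-- The multiplicity one varifold `|graph f|` of the graph of `f` over `Ω`. -/
def graphVarifold {n : ℕ} (Ω : Set (Rn n)) (f : Rn n → ℝ) :
    Measure (Rn1 n × (Rn1 n →L[ℝ] Rn1 n)) :=
  sheetVarifold Ω 0 (LinearIsometryEquiv.refl ℝ (Rn1 n)) f

/-- The open box `{Y + T (x, t) : |x| < r, |t| < s}`, a neighbourhood of `Y`. -/
def box {n : ℕ} (Y : Rn1 n) (T : Rn1 n ≃ₗᵢ[ℝ] Rn1 n) (r s : ℝ) : Set (Rn1 n) :=
  {X | ∃ x t, ‖x‖ < r ∧ |t| < s ∧ X = Y + T (pt x t)}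

/-- An embedded disk of class `C^k` through `Y`, relatively closed in the box: the graph, in the
frame `(Y, T)`, of a `C^k` function on the ball of radius `r` that vanishes at `0`. -/
def IsDisk {n : ℕ} (k : ℕ∞) (r s : ℝ) (f : Rn n → ℝ) : Prop :=
  ContDiffOn ℝ k f (Metric.ball 0 r) ∧ f 0 = 0 ∧ ∀ x ∈ Metric.ball (0 : Rn n) r, |f x| < s

/-- `S` is an embedded `C¹` hypersurface: near each of its points it is an embedded `C¹` disk. -/
def IsEmbeddedHypersurface {n : ℕ} (S : Set (Rn1 n)) : Prop :=
  ∀ Y ∈ S, ∃ (T : Rn1 n ≃ₗᵢ[ℝ] Rn1 n) (r s : ℝ) (f : Rn n → ℝ), 0 < r ∧ 0 < s ∧ IsDisk 1 r s f ∧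
    S ∩ box Y T r s = sheet Y T f '' Metric.ball 0 r

/-! ### Riemannian geometry in local parametrizations -/

/-- A Riemannian metric in coordinates. -/
abbrev CoordMetric (F : Type*) [NormedAddCommGroup F] [NormedSpace ℝ F] : Type _ :=
  F → F →L[ℝ] F →L[ℝ] ℝ

/-- The Christoffel symbol of the first kind: `h(Γ(v, w), a)` at `x`, where `Γ` is the
Levi-Civita connection of `h`. -/
def christoffel {F : Type*} [NormedAddCommGroup F] [NormedSpace ℝ F] (h : CoordMetric F)
    (x v w a : F) : ℝ :=
  (fderiv ℝ h x v w a + fderiv ℝ h x w v a - fderiv ℝ h x a v w) / 2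

/-- The first fundamental form, in the metric `h`, of a parametrized hypersurface. -/
def firstFundForm {n : ℕ} (h : CoordMetric (Rn1 n)) (S : Rn n → Rn1 n) (x : Rn n) :
    Matrix (Fin n) (Fin n) ℝ :=
  Matrix.of fun i j =>
    h (S x) (fderiv ℝ S x (EuclideanSpace.single i 1)) (fderiv ℝ S x (EuclideanSpace.single j 1))

/-- The second fundamental form `h(∇_{∂_i} ∂_j S, ν)` of a parametrized hypersurface with respect
to the unit normal `ν`. -/
def secondFundForm {n : ℕ} (h : CoordMetric (Rn1 n)) (S : Rn n → Rn1 n) (x : Rn n) (ν : Rn1 n) :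
    Matrix (Fin n) (Fin n) ℝ :=
  Matrix.of fun i j =>
    h (S x) (fderiv ℝ (fderiv ℝ S) x (EuclideanSpace.single i 1) (EuclideanSpace.single j 1)) ν +
      christoffel h (S x) (fderiv ℝ S x (EuclideanSpace.single i 1))
        (fderiv ℝ S x (EuclideanSpace.single j 1)) ν

/-- The scalar mean curvature with respect to `ν`: the trace of the second fundamental form; the
mean curvature vector is this number times `ν`. -/
def meanCurvature {n : ℕ} (h : CoordMetric (Rn1 n)) (S : Rn n → Rn1 n) (x : Rn n) (ν : Rn1 n) :
    ℝ :=
  ((firstFundForm h S x)⁻¹ * secondFundForm h S x ν).trace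

/-- `ν` is the unit normal, in the metric `h`, of the sheet at the point over `x`, on the side of
the direction `T (0, 1)`. -/
def IsUpwardUnitNormal {n : ℕ} (h : CoordMetric (Rn1 n)) (Y : Rn1 n) (T : Rn1 n ≃ₗᵢ[ℝ] Rn1 n)
    (f : Rn n → ℝ) (x : Rn n) (ν : Rn1 n) : Prop :=
  (∀ a, h (sheet Y T f x) (fderiv ℝ (sheet Y T f) x a) ν = 0) ∧
    h (sheet Y T f x) ν ν = 1 ∧ 0 < h (sheet Y T f x) (T (pt 0 1)) ν

/-- The sheet over the ball of radius `r` has, in the metric `h` and with respect to its upward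
unit normal, scalar mean curvature equal to `κ` everywhere. -/
def HasMeanCurvature {n : ℕ} (h : CoordMetric (Rn1 n)) (Y : Rn1 n) (T : Rn1 n ≃ₗᵢ[ℝ] Rn1 n)
    (r : ℝ) (f : Rn n → ℝ) (κ : Rn1 n → ℝ) : Prop :=
  ∀ x ∈ Metric.ball (0 : Rn n) r, ∃ ν, IsUpwardUnitNormal h Y T f x ν ∧
    meanCurvature h (sheet Y T f) x ν = κ (sheet Y T f x)

/-- `V` has quasi-embedded `PMC(g, 0)` structure near `Y`, for the metric `h` and the function `g`
on the open set `U`. The disks are written as graphs in one Euclidean frame `(Y, T)`, over a ball.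
Since `T` may be changed by the reflection `(x, t) ↦ (x, -t)`, the choice of the unit normal in
(i) is contained in the choice of `T`, and in (iv) the disk with mean curvature `g` may be taken to
be the upper one. A mean curvature vector of length `g` of the upper (lower) disk that points away
from the other disk is a scalar mean curvature `g` (respectively `-g`) with respect to the upward
unit normal. -/
def HasQuasiEmbeddedPMC {n : ℕ} {O : Set (Rn1 n)} (h : CoordMetric (Rn1 n)) (g : Rn1 n → ℝ)
    (U : Set (Rn1 n)) (V : Varifold n O) (Y : Rn1 n) : Prop :=
  ∃ (T : Rn1 n ≃ₗᵢ[ℝ] Rn1 n) (r s : ℝ), 0 < r ∧ 0 < s ∧ box Y T r s ⊆ U ∧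
    let B : Set (Rn n) := Metric.ball 0 r
    let VY := V.measure.restrict (box Y T r s ×ˢ univ)
    let D (f : Rn n → ℝ) := sheetVarifold B Y T f
    let H (f : Rn n → ℝ) (κ : Rn1 n → ℝ) : Prop := HasMeanCurvature h Y T r f κ
    -- (i) one disk of mean curvature `g`
    (∃ f, IsDisk 2 r s f ∧ VY = D f ∧ H f g) ∨
    -- (ii) one minimal disk of even multiplicity
    (∃ (f : Rn n → ℝ) (m : ℕ), 0 < m ∧ Even m ∧ IsDisk 2 r s f ∧ VY = m • D f ∧ H f 0) ∨
    -- (iii) two touching disks of mean curvature `g`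
    (V.HasDensity Y 2 ∧ ∃ f₁ f₂, IsDisk 2 r s f₁ ∧ IsDisk 2 r s f₂ ∧
      (∀ x ∈ B, f₁ x ≤ f₂ x) ∧ (∃ x ∈ B, f₁ x ≠ f₂ x) ∧
      VY = D f₁ + D f₂ ∧ H f₁ (fun X => -g X) ∧ H f₂ g) ∨
    -- (iv) a disk of mean curvature `g` touching a minimal disk
    (∃ (f' f : Rn n → ℝ) (m : ℕ), Odd m ∧ 3 ≤ m ∧ V.HasDensity Y m ∧
      IsDisk 2 r s f' ∧ IsDisk 2 r s f ∧
      (∀ x ∈ B, f' x ≤ f x) ∧ (∃ x ∈ B, f' x ≠ f x) ∧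
      VY = D f + (m - 1) • D f' ∧ H f' 0 ∧ H f g) ∨
    -- (v) two disks of mean curvature `g` and a minimal disk between them
    (∃ (f₁ f' f₂ : Rn n → ℝ) (m : ℕ), Even m ∧ 4 ≤ m ∧ V.HasDensity Y m ∧
      IsDisk 2 r s f₁ ∧ IsDisk 2 r s f' ∧ IsDisk 2 r s f₂ ∧
      (∀ x ∈ B, f₁ x ≤ f' x ∧ f' x ≤ f₂ x) ∧
      (∃ x ∈ B, f₁ x ≠ f' x) ∧ (∃ x ∈ B, f' x ≠ f₂ x) ∧
      VY = D f₁ + D f₂ + (m - 2) • D f' ∧ H f₁ (fun X => -g X) ∧ H f' 0 ∧ H f₂ g)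

/-! ### Riemannian manifolds of dimension `n + 1` -/

section Manifold

variable {n : ℕ} {N : Type*} [TopologicalSpace N] [ChartedSpace (Rn (n + 1)) N]
  [IsManifold (𝓡 (n + 1)) ∞ N]

/-- Smooth Riemannian metrics on `N`. -/
abbrev SmoothMetric (n : ℕ) (N : Type*) [TopologicalSpace N] [ChartedSpace (Rn (n + 1)) N]
    [IsManifold (𝓡 (n + 1)) ∞ N] : Type _ :=
  Bundle.ContMDiffRiemannianMetric (𝓡 (n + 1)) ∞ (Rn (n + 1))
    (fun x : N => TangentSpace (𝓡 (n + 1)) x)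

/-- The pull-back of the metric `G` by a map `p : F → N`. -/
def pullbackMetric {F : Type*} [NormedAddCommGroup F] [NormedSpace ℝ F]
    (G : SmoothMetric n N) (p : F → N) : CoordMetric F :=
  fun x =>
    let A : F →L[ℝ] Rn (n + 1) := mfderiv 𝓘(ℝ, F) (𝓡 (n + 1)) p x
    let b : Rn (n + 1) →L[ℝ] Rn (n + 1) →L[ℝ] ℝ := G.inner (p x)
    b.bilinearComp A A

/-- On the ball of radius `R`, which is mapped diffeomorphically onto its image, `p` is the
exponential map at `y`, where `T_y N` is identified with `ℝⁿ⁺¹` by a linear isometry: `p 0 = y`, the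
pulled back metric is Euclidean at `0`, and the rays `t ↦ t x` are geodesics of the pulled back
metric (that is, `Γ_x(x, x) = 0` for all `x`). -/
structure IsExponentialMap (G : SmoothMetric n N) (y : N) (R : ℝ) (p : Rn1 n → N) : Prop where
  map_zero : p 0 = y
  smooth : ContMDiffOn 𝓘(ℝ, Rn1 n) (𝓡 (n + 1)) ∞ p (Metric.ball 0 R)
  injOn : InjOn p (Metric.ball 0 R)
  immersion : ∀ x ∈ Metric.ball (0 : Rn1 n) R,
    Function.Injective (mfderiv 𝓘(ℝ, Rn1 n) (𝓡 (n + 1)) p x)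
  isometry_zero : ∀ v w : Rn1 n, pullbackMetric G p 0 v w = inner ℝ v w
  geodesic : ∀ x ∈ Metric.ball (0 : Rn1 n) R, ∀ a : Rn1 n,
    christoffel (pullbackMetric G p) x x x a = 0

/-- `f ∈ C^{1,1}(N)`: in every chart `f` is `C¹` and its gradient is Lipschitz on compact sets. -/
def IsC11 (n : ℕ) {N : Type*} [TopologicalSpace N] [ChartedSpace (Rn (n + 1)) N] (f : N → ℝ) :
    Prop :=
  ∀ e ∈ atlas (Rn (n + 1)) N, ContDiffOn ℝ 1 (f ∘ e.symm) e.target ∧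
    ∀ K ⊆ e.target, IsCompact K → ∃ L : ℝ, ∀ x ∈ K, ∀ y ∈ K,
      ‖fderiv ℝ (f ∘ e.symm) x - fderiv ℝ (f ∘ e.symm) y‖ ≤ L * ‖x - y‖

/-- `f_j → f` locally in `C^{1,1}`. -/
def TendstoC11 (n : ℕ) {N : Type*} [TopologicalSpace N] [ChartedSpace (Rn (n + 1)) N]
    (f : ℕ → N → ℝ) (f₀ : N → ℝ) : Prop :=
  ∀ e ∈ atlas (Rn (n + 1)) N, ∀ K ⊆ e.target, IsCompact K → ∀ δ > 0, ∀ᶠ j in atTop,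
    let d : Rn (n + 1) → ℝ := fun x => f j (e.symm x) - f₀ (e.symm x)
    ∀ x ∈ K, |d x| ≤ δ ∧ ‖fderiv ℝ d x‖ ≤ δ ∧
      ∀ y ∈ K, ‖fderiv ℝ d x - fderiv ℝ d y‖ ≤ δ * ‖x - y‖

/-! ### Allen-Cahn critical points and limit `(g, 0)`-varifolds -/

/-- A double well potential of class `C²`, whose minima are `±1`, with value `0`, and
nondegenerate, with quadratic growth outside `[-2, 2]`. -/
structure IsDoubleWell (W : ℝ → ℝ) : Prop where
  contDiff : ContDiff ℝ 2 W
  nonneg : ∀ s, 0 ≤ W s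
  eq_zero_iff : ∀ s, W s = 0 ↔ s = 1 ∨ s = -1
  nondegenerate : 0 < deriv (deriv W) 1 ∧ 0 < deriv (deriv W) (-1)
  growth : ∃ c C : ℝ, 0 < c ∧ ∀ s, 2 ≤ |s| → c * s ^ 2 ≤ W s ∧ W s ≤ C * s ^ 2

/-- `Φ(s) = ∫₀ˢ √(W/2)`. -/
def wellPrimitive (W : ℝ → ℝ) (s : ℝ) : ℝ := ∫ a in (0 : ℝ)..s, Real.sqrt (W a / 2)

/-- `σ = ∫_{-1}^1 √(W/2)`. -/
def wellConst (W : ℝ → ℝ) : ℝ := ∫ a in (-1 : ℝ)..1, Real.sqrt (W a / 2)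

/-- The matrix `(h_{ij})` of a metric in coordinates. -/
def metricMatrix {m : ℕ} (h : CoordMetric (Rn m)) (x : Rn m) : Matrix (Fin m) (Fin m) ℝ :=
  Matrix.of fun i j => h x (EuclideanSpace.single i 1) (EuclideanSpace.single j 1)

/-- `u` is a critical point of
`F_{ε,f}(u) = ∫_N ε |∇u|² / 2 + W(u) / ε - f u`, that is, a weak solution of
`-ε Δu + W'(u)/ε = f`: the first variation vanishes for all test functions supported in a chart
(hence, by a partition of unity, for all test functions). By elliptic regularity a critical point
has a `C¹` representative, which is the one that is used. -/
def IsCriticalPoint (G : SmoothMetric n N) (W : ℝ → ℝ) (ε : ℝ) (f u : N → ℝ) : Prop :=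
  ContMDiff (𝓡 (n + 1)) 𝓘(ℝ, ℝ) 1 u ∧
  ∀ e ∈ atlas (Rn (n + 1)) N, ∀ ζ : Rn (n + 1) → ℝ, ContDiff ℝ 1 ζ → HasCompactSupport ζ →
    tsupport ζ ⊆ e.target →
    let M := metricMatrix (pullbackMetric G e.symm)
    ∫ x, (ε * (∑ i, ∑ j, (M x)⁻¹ i j * fderiv ℝ (u ∘ e.symm) x (EuclideanSpace.single i 1) *
            fderiv ℝ ζ x (EuclideanSpace.single j 1)) +
          deriv W (u (e.symm x)) / ε * ζ x - f (e.symm x) * ζ x) *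
        Real.sqrt (M x).det = 0

/-- The integral of `φ` against the varifold associated with `u : U → ℝ`, namely
`∫_ℝ |{w = t}| dt` with `w = Φ ∘ u`, where `|{w = t}|` is the multiplicity one varifold of the level
set. -/
def levelVarifoldIntegral {n : ℕ} (W : ℝ → ℝ) (U : Set (Rn1 n)) (u : Rn1 n → ℝ)
    (φ : Rn1 n × (Rn1 n →L[ℝ] Rn1 n) → ℝ) : ℝ :=
  ∫ t : ℝ, ∫ x in {x | x ∈ U ∧ wellPrimitive W (u x) = t},
    φ (x, normalProj (gradient (fun a => wellPrimitive W (u a)) x)) ∂μHE[n]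

/-- `V` is, in the open set `U`, the pull-back by the local parametrization `ψ : U → N` of
`σ⁻¹ V_N` for a limit `(g, 0)`-varifold `V_N` on `N`, the limit of the varifolds of critical points
`u_j` of `F_{ε_j, σ g_j}`. The pull-back takes the multiplicity one varifolds of the level sets on
`N` to those of the level sets in `U`. -/
def IsPullbackOfLimitVarifold {O : Set (Rn1 n)} (G : SmoothMetric n N) (W : ℝ → ℝ) (g : N → ℝ)
    (ψ : Rn1 n → N) (U : Set (Rn1 n)) (V : Varifold n O) : Prop :=
  ∃ (ε : ℕ → ℝ) (gs us : ℕ → N → ℝ), (∀ j, 0 < ε j) ∧ Tendsto ε atTop (𝓝 0) ∧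
    (∀ j, IsC11 n (gs j)) ∧ TendstoC11 n gs g ∧
    (∀ j, IsCriticalPoint G W (ε j) (fun x => wellConst W * gs j x) (us j)) ∧
    ∀ φ : Rn1 n × (Rn1 n →L[ℝ] Rn1 n) → ℝ, Continuous φ → HasCompactSupport φ →
      tsupport φ ⊆ U ×ˢ univ →
      Tendsto (fun j => levelVarifoldIntegral W U (us j ∘ ψ) φ) atTop
        (𝓝 (wellConst W * ∫ P, φ P ∂V.measure))

end Manifold

end

/-! Let `K` be the set of points of the ball over which all the `u j` agree. The density of `V` at
`(x, t)` is the number of sheets through that point (`hasDensity_sheetCount`), so the point of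
density `q` makes `K` nonempty, and over the complement of `K` all densities are at most `q - 1`.
There the quasi-embedded structure applies. Comparing its multiplicities with the number of sheets
gives each sheet a sign `κ j` in `{-1, 0, 1}` such that, near `x`, the graph of `u j` has mean
curvature `κ j * g` for the upward normal (`exists_isSignedAt`). Since `g > 0`, the signs are
locally constant. Among sheets that meet over `x` the signs do not decrease with the index, two
sheets of equal sign have sign `0` and coincide nearby, and an even number of them have sign `0`.

The key claim is `coincide_of_sign_le`: outside `K`, if `i < j` and `κ j ≤ κ i`, then `u i = u j`.
Join the point, inside the complement of `K`, to a ball that touches `K` at some `x₀`. The signs are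
constant on this connected set and the coincidence set of `u i` and `u j` is open and closed in it.
If they differ at the given point, they are strictly ordered in the ball, while they meet
tangentially at `x₀`. The Hopf lemma `hopf_touching` forbids this. Hence over each point outside `K`
the signs increase strictly, except that the sheets of sign `0` all coincide, and there are at most
three heights.

Parity makes the choice of sheets the same on all components of the complement of `K`. If `q` is
odd, the signs `-1` and `1` cannot both occur, and the lowest and the highest sheet cover
everything. If `q` is even, the lowest sheet has sign `-1`, the highest has sign `1`, and all the
others coincide.

The Hopf lemma needs care because at `x₀` the sheets are only `C^{1,α}`. The linear equation for `u₂
- u₁` has coefficients containing second derivatives, which need not stay bounded at `x₀`. The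
argument therefore doubles the variables and only compares the two equations at a maximum of `u₁ x -
u₂ y` plus a barrier minus `‖x - y‖² / (2ε)`. One step (`hopf_step`) carries a lower bound for `u₂ -
u₁` from scale `r` to scale `τ r`, with a loss `a` in the slope that does not depend on `τ`.
Choosing `τ` so small that `τ ^ α ≤ a / 2`, the iterated lower bound outgrows the upper bound that
`C^{1,α}` tangency imposes. -/

/-! ### Frames that are orthonormal for a bilinear form -/

/-- Bilinear forms on `ℝⁿ`. -/
abbrev Bilin (n : ℕ) : Type := Rn n →L[ℝ] Rn n →L[ℝ] ℝ

/-- `ξ` is an orthonormal frame for the bilinear form `A`. -/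
def IsFrame {n : ℕ} (A : Bilin n) (ξ : Fin n → Rn n) : Prop :=
  ∀ a b, A (ξ a) (ξ b) = if a = b then 1 else 0

/-- The spectral theorem for the symmetric operator that represents `A` through the inner product.
-/
theorem exists_orthonormalBasis_diag {n : ℕ} (A : Bilin n) (hA : ∀ v w, A v w = A w v) :
    ∃ (e : OrthonormalBasis (Fin n) ℝ (Rn n)) (μ : Fin n → ℝ),
      ∀ a b, A (e a) (e b) = if a = b then μ a else 0 := by
  let S : Rn n →ₗ[ℝ] Rn n :=
    ((InnerProductSpace.toDual ℝ (Rn n)).symm.toContinuousLinearEquiv.toContinuousLinearMap.comp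
      A : Rn n →L[ℝ] Rn n)
  have hS : ∀ v w, inner ℝ (S v) w = A v w := by
    intro v w
    simp [S]
  have hsym : S.IsSymmetric := by
    intro v w
    rw [hS, real_inner_comm, hS, hA]
  have hn : Module.finrank ℝ (Rn n) = n := by simp
  refine ⟨hsym.eigenvectorBasis hn, hsym.eigenvalues hn, fun a b => ?_⟩
  rw [← hS, hsym.apply_eigenvectorBasis]
  simp [inner_smul_left, OrthonormalBasis.inner_eq_ite]

/-- Rescaling an eigenbasis of `A` by the inverse roots of the eigenvalues gives a map `S` for which
`A (S v) (S w)` is the Euclidean product. An orthonormal eigenbasis of `B` pulled back by `S`,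
mapped by `S`, then works for both forms. -/
theorem exists_isFrame_diag {n : ℕ} (A B : Bilin n) (hA : ∀ v w, A v w = A w v)
    (hpos : ∀ v, v ≠ 0 → 0 < A v v) (hB : ∀ v w, B v w = B w v) :
    ∃ (ξ : Fin n → Rn n) (l : Fin n → ℝ), IsFrame A ξ ∧
      ∀ a b, B (ξ a) (ξ b) = if a = b then l a else 0 := by
  obtain ⟨e, μ, he⟩ := exists_orthonormalBasis_diag A hA
  have hμ : ∀ a, 0 < μ a := by
    intro a
    have := hpos (e a) (e.orthonormal.ne_zero a)
    rwa [he, if_pos rfl] at this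
  let S : Rn n →L[ℝ] Rn n := LinearMap.toContinuousLinearMap
    (e.toBasis.constr ℝ (fun a => (Real.sqrt (μ a))⁻¹ • e a))
  have hSe : ∀ a, S (e a) = (Real.sqrt (μ a))⁻¹ • e a := by
    intro a
    have := e.toBasis.constr_basis ℝ (fun a => (Real.sqrt (μ a))⁻¹ • e a) a
    rw [OrthonormalBasis.coe_toBasis] at this
    exact this
  have hAS : ∀ v w, A (S v) (S w) = inner ℝ v w := by
    intro v w
    have h1 : (A.bilinearComp S S) = innerSL ℝ := by
      apply ContinuousLinearMap.coe_injective
      refine e.toBasis.ext fun a => ?_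
      apply ContinuousLinearMap.coe_injective
      refine e.toBasis.ext fun b => ?_
      rw [OrthonormalBasis.coe_toBasis]
      change A (S (e a)) (S (e b)) = inner ℝ (e a) (e b)
      simp only [hSe, map_smul, smul_apply, he, OrthonormalBasis.inner_eq_ite, smul_eq_mul]
      split_ifs with hab
      · subst hab
        have := Real.mul_self_sqrt (hμ a).le
        have h0 : Real.sqrt (μ a) ≠ 0 := (Real.sqrt_pos.2 (hμ a)).ne'
        field_simp
        nlinarith
      · simp
    have := congrArg (fun F : Bilin n => F v w) h1
    exact this
  obtain ⟨e', l, he'⟩ := exists_orthonormalBasis_diag (B.bilinearComp S S)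
    (fun v w => by simp [hB (S v)])
  refine ⟨fun a => S (e' a), l, fun a b => ?_, fun a b => ?_⟩
  · rw [hAS, OrthonormalBasis.inner_eq_ite]
  · simpa using he' a b

theorem IsFrame.linearIndependent {n : ℕ} {A : Bilin n} {ξ : Fin n → Rn n} (h : IsFrame A ξ) :
    LinearIndependent ℝ ξ := by
  rw [Fintype.linearIndependent_iff]
  intro c hc a
  have := congrArg (fun v => A v (ξ a)) hc
  simpa [IsFrame, h _ a, sum_apply] using this

/-- A frame spans: every vector is the sum of its coefficients against the frame. -/
theorem IsFrame.sum_coeff {n : ℕ} {A : Bilin n} {ξ : Fin n → Rn n} (h : IsFrame A ξ) (y : Rn n) :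
    y = ∑ a, A y (ξ a) • ξ a := by
  have hc : Fintype.card (Fin n) = Module.finrank ℝ (Rn n) := by simp
  let b : Module.Basis (Fin n) ℝ (Rn n) := Module.Basis.mk h.linearIndependent
    (h.linearIndependent.span_eq_top_of_card_eq_finrank' hc).ge
  have hb : ∀ a, b a = ξ a := fun a => by simp [b]
  have hy := b.sum_repr y
  have hcoef : ∀ a, A y (ξ a) = b.repr y a := by
    intro a
    conv_lhs => rw [← hy]
    simp [hb, h _ a, sum_apply]
  conv_lhs => rw [← hy]
  simp [hcoef, hb]

/-- Expanding one factor of `⟪y, y⟫` in the frame and applying Cauchy-Schwarz leaves `A y y`, the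
sum of the squared coefficients. The bound says that a frame of a bounded form sees every direction,
which the barrier needs. -/
theorem IsFrame.norm_sq_le {n : ℕ} {A : Bilin n} {ξ : Fin n → Rn n} (h : IsFrame A ξ) (y : Rn n) :
    ‖y‖ ^ 2 ≤ ‖A‖ * ∑ a, (inner ℝ y (ξ a)) ^ 2 := by
  have hy := h.sum_coeff y
  have h1 : ‖y‖ ^ 2 = ∑ a, A y (ξ a) * inner ℝ y (ξ a) := by
    rw [← real_inner_self_eq_norm_sq]
    conv_lhs => rw [hy, sum_inner]
    refine Finset.sum_congr rfl fun a _ => ?_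
    rw [real_inner_smul_left, ← hy, real_inner_comm]
  have h2 : ∑ a, (A y (ξ a)) ^ 2 = A y y := by
    rw [congrArg (A y) hy, map_sum]
    simp [sq]
  have h3 := Finset.sum_mul_sq_le_sq_mul_sq Finset.univ (fun a => A y (ξ a))
    (fun a => inner ℝ y (ξ a))
  rw [← h1, h2] at h3
  have h4 : A y y ≤ ‖A‖ * ‖y‖ ^ 2 := by
    calc A y y ≤ ‖A y y‖ := le_abs_self _
      _ ≤ ‖A‖ * ‖y‖ * ‖y‖ := A.le_opNorm₂ y y
      _ = _ := by ring
  have h5 : 0 ≤ ∑ a, (inner ℝ y (ξ a)) ^ 2 := Finset.sum_nonneg fun a _ => sq_nonneg _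
  have h6 := h3.trans (mul_le_mul_of_nonneg_right h4 h5)
  by_cases h0 : ‖y‖ = 0
  · rw [h0]
    have := mul_nonneg (norm_nonneg A) h5
    simpa using this
  · have : 0 < ‖y‖ ^ 2 := by positivity
    nlinarith

/-! ### Second order conditions along lines -/

/-- `φ` is twice differentiable at `0`, with first derivative `a` and second derivative `b`. -/
def HasSecondDeriv (φ : ℝ → ℝ) (a b : ℝ) : Prop :=
  ∃ φ' : ℝ → ℝ, (∀ᶠ t in 𝓝 0, HasDerivAt φ (φ' t) t) ∧ φ' 0 = a ∧ HasDerivAt φ' b 0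

theorem HasSecondDeriv.add {φ ψ : ℝ → ℝ} {a b c d : ℝ} (h : HasSecondDeriv φ a b)
    (k : HasSecondDeriv ψ c d) : HasSecondDeriv (fun t => φ t + ψ t) (a + c) (b + d) := by
  obtain ⟨φ', h1, h2, h3⟩ := h
  obtain ⟨ψ', k1, k2, k3⟩ := k
  refine ⟨fun t => φ' t + ψ' t, ?_, by simp [h2, k2], h3.add k3⟩
  filter_upwards [h1, k1] with t ht kt using ht.add kt

theorem HasSecondDeriv.const_mul {φ : ℝ → ℝ} {a b : ℝ} (c : ℝ) (h : HasSecondDeriv φ a b) :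
    HasSecondDeriv (fun t => c * φ t) (c * a) (c * b) := by
  obtain ⟨φ', h1, h2, h3⟩ := h
  refine ⟨fun t => c * φ' t, ?_, by simp [h2], h3.const_mul c⟩
  filter_upwards [h1] with t ht using ht.const_mul c

theorem hasDerivAt_quadratic (a b c t : ℝ) :
    HasDerivAt (fun t : ℝ => a + b * t + c * t ^ 2) (b + c * (2 * t)) t := by
  have h := (((hasDerivAt_id' t).const_mul b).const_add a).add
    (((hasDerivAt_id' t).fun_pow 2).const_mul c)
  exact h.congr_deriv (by simp)

theorem hasDerivAt_linear (b c t : ℝ) : HasDerivAt (fun t : ℝ => b + c * (2 * t)) (2 * c) t :=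
  ((((hasDerivAt_id' t).const_mul 2).const_mul c).const_add b).congr_deriv (by ring)

theorem hasSecondDeriv_quadratic (a b c : ℝ) :
    HasSecondDeriv (fun t => a + b * t + c * t ^ 2) b (2 * c) :=
  ⟨fun t => b + c * (2 * t), Eventually.of_forall fun t => hasDerivAt_quadratic a b c t, by simp,
    hasDerivAt_linear b c 0⟩

theorem hasSecondDeriv_exp_quadratic (a b c : ℝ) :
    HasSecondDeriv (fun t => Real.exp (a + b * t + c * t ^ 2)) (Real.exp a * b)
      (Real.exp a * (b ^ 2 + 2 * c)) := by
  refine ⟨fun t => Real.exp (a + b * t + c * t ^ 2) * (b + c * (2 * t)),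
    Eventually.of_forall fun t => (hasDerivAt_quadratic a b c t).exp, by simp, ?_⟩
  have h := (hasDerivAt_quadratic a b c 0).exp.mul (hasDerivAt_linear b c 0)
  exact h.congr_deriv (by simp; ring)

theorem ContDiffAt.hasSecondDeriv {E : Type*} [NormedAddCommGroup E] [NormedSpace ℝ E]
    {u : E → ℝ} {x : E} (hu : ContDiffAt ℝ 2 u x) (v : E) :
    HasSecondDeriv (fun t : ℝ => u (x + t • v)) (fderiv ℝ u x v)
      (fderiv ℝ (fderiv ℝ u) x v v) := by
  have hline : ∀ t : ℝ, HasDerivAt (fun t : ℝ => x + t • v) v t := fun t => by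
    simpa only [one_smul] using ((hasDerivAt_id' t).smul_const v).const_add x
  have h1 : ∀ᶠ y in 𝓝 x, DifferentiableAt ℝ u y := by
    filter_upwards [hu.eventually (by simp)] with y hy using hy.differentiableAt (by simp)
  have ht : Tendsto (fun t : ℝ => x + t • v) (𝓝 0) (𝓝 x) := by
    simpa using (hline 0).continuousAt.tendsto
  refine ⟨fun t => fderiv ℝ u (x + t • v) v, ?_, by simp, ?_⟩
  · filter_upwards [ht.eventually h1] with t ht
    have h := HasFDerivAt.comp_hasDerivAt (f := fun t : ℝ => x + t • v) t ht.hasFDerivAt (hline t)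
    exact h
  · have h2 : DifferentiableAt ℝ (fderiv ℝ u) (x + (0 : ℝ) • v) := by
      simp only [zero_smul, add_zero]
      exact (hu.fderiv_right (m := 1) (by norm_num)).differentiableAt (by simp)
    have h3 := HasFDerivAt.comp_hasDerivAt (f := fun t : ℝ => x + t • v) 0 h2.hasFDerivAt (hline 0)
    have h4 := h3.clm_apply (hasDerivAt_const 0 v)
    simpa using h4

/-- If `b > 0`, the second derivative test makes `0` a local minimum as well, so `φ` is locally
constant and `b = 0`. -/
theorem HasSecondDeriv.of_isLocalMax {φ : ℝ → ℝ} {a b : ℝ} (h : HasSecondDeriv φ a b)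
    (hmax : IsLocalMax φ 0) : a = 0 ∧ b ≤ 0 := by
  obtain ⟨φ', h1, h2, h3⟩ := h
  have ha : φ' 0 = 0 := hmax.hasDerivAt_eq_zero h1.self_of_nhds
  refine ⟨h2 ▸ ha, ?_⟩
  by_contra! hb
  have hd : deriv φ =ᶠ[𝓝 0] φ' := h1.mono fun t ht => ht.deriv
  have hdd : deriv (deriv φ) 0 = b := by rw [hd.deriv_eq, h3.deriv]
  have hmin : IsLocalMin φ 0 := isLocalMin_of_deriv_deriv_pos (by rwa [hdd])
    (by rw [hd.self_of_nhds, ha]) h1.self_of_nhds.continuousAt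
  have hconst : φ =ᶠ[𝓝 0] fun _ => φ 0 := by
    filter_upwards [hmin, hmax] with t h1 h2 using le_antisymm h2 h1
  have : deriv (deriv φ) 0 = 0 := by
    rw [hconst.deriv.deriv_eq]; simp
  rw [hdd] at this
  exact hb.ne' this

theorem IsFrame.norm_sq_vector_le {n : ℕ} {A : Bilin n} {ξ : Fin n → Rn n} (h : IsFrame A ξ) {μ : ℝ}
    (hμ : 0 < μ) (hA : ∀ v, μ * ‖v‖ ^ 2 ≤ A v v) (a : Fin n) : ‖ξ a‖ ^ 2 ≤ 1 / μ := by
  have h1 := hA (ξ a)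
  rw [h a a, if_pos rfl] at h1
  rw [le_div_iff₀ hμ]
  linarith

theorem abs_bilin_le {n : ℕ} (A : Bilin n) (v : Rn n) : |A v v| ≤ ‖A‖ * ‖v‖ ^ 2 := by
  calc |A v v| ≤ ‖A‖ * ‖v‖ * ‖v‖ := A.le_opNorm₂ v v
    _ = _ := by ring

/-- The comparison of two elliptic equations with coefficients at distance `d`, at a maximum point
obtained by doubling the variables. -/
theorem exists_frame_sum_le {n : ℕ} {L μ b : ℝ} (hL : 0 ≤ L) (hμ : 0 < μ) (hb : 0 ≤ b) (k₂ : ℝ) :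
    ∃ C : ℝ, 0 ≤ C ∧ ∀ (G₁ G₂ Q₁ Q₂ : Bilin n) (s₁ s₂ k₁ d ε : ℝ) (X₁ X₂ B : Rn n → ℝ),
      0 ≤ d → 0 < ε → L * d / μ ≤ 1 / 2 → ‖G₁ - G₂‖ ≤ L * d → ‖Q₁ - Q₂‖ ≤ L * d →
      |s₁ - s₂| ≤ L * d → ‖Q₂‖ ≤ b → (∀ v w, G₁ v w = G₁ w v) → (∀ v w, G₂ v w = G₂ w v) →
      (∀ v, μ * ‖v‖ ^ 2 ≤ G₁ v v) → 0 ≤ s₁ → k₂ ≤ k₁ →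
      (∀ ξ, IsFrame G₁ ξ → ∑ a, (X₁ (ξ a) + Q₁ (ξ a) (ξ a)) = k₁ * s₁) →
      (∀ ξ, IsFrame G₂ ξ → ∑ a, (X₂ (ξ a) + Q₂ (ξ a) (ξ a)) = k₂ * s₂) →
      (∀ ξ η, X₁ ξ + B ξ - X₂ η ≤ ‖ξ - η‖ ^ 2 / ε) →
      ∃ ξ, IsFrame G₁ ξ ∧ ∑ a, B (ξ a) ≤ C * (d + d ^ 2 / ε) := by
  -- The first summand pays for the coupling term and multiplies `d ^ 2 / ε`; the other two collect
  -- the differences of the lower order terms and of the right hand sides, which are linear in `d`.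
  refine ⟨n * (4 * (L / μ) ^ 2 / μ) + (n * (L / μ + 2 * (L / μ) * b / μ) + |k₂| * L),
    by positivity, ?_⟩
  intro G₁ G₂ Q₁ Q₂ s₁ s₂ k₁ d ε X₁ X₂ B hd hε hsmall hG hQ hs hQb hsym₁ hsym₂ hμG hs₁ hk hX₁ hX₂
    hineq
  have hpos : ∀ v, v ≠ 0 → 0 < G₁ v v := fun v hv =>
    lt_of_lt_of_le (by have := norm_pos_iff.2 hv; positivity) (hμG v)
  -- The coupling penalizes `‖ξ - η‖ ^ 2`, so the two frames must be close. In a frame of `G₁` that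
  -- diagonalizes `G₂`, a frame of `G₂` arises by rescaling each vector by a factor within `2 * e`
  -- of `1`.
  obtain ⟨ξ, l, hξ, hl⟩ := exists_isFrame_diag G₁ G₂ hsym₁ hpos hsym₂
  have hξn := hξ.norm_sq_vector_le hμ hμG
  set e := L * d / μ with he
  have he0 : 0 ≤ e := by positivity
  have hquad : ∀ (A : Bilin n) a, ‖A‖ ≤ L * d → |A (ξ a) (ξ a)| ≤ e := by
    intro A a hA
    refine (abs_bilin_le A (ξ a)).trans ?_
    calc ‖A‖ * ‖ξ a‖ ^ 2 ≤ L * d * (1 / μ) :=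
          mul_le_mul hA (hξn a) (sq_nonneg _) (by positivity)
      _ = e := by rw [he]; ring
  have hl1 : ∀ a, |1 - l a| ≤ e := by
    intro a
    have := hquad (G₁ - G₂) a hG
    simpa [hξ a a, hl a a] using this
  have hlpos : ∀ a, 1 / 2 ≤ l a := fun a => by
    have := abs_le.1 (hl1 a); linarith
  set c : Fin n → ℝ := fun a => (Real.sqrt (l a))⁻¹ with hc
  have hc2 : ∀ a, c a ^ 2 = (l a)⁻¹ := fun a => by
    rw [hc]; simp only [inv_pow]; rw [Real.sq_sqrt (by linarith [hlpos a])]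
  have hcpos : ∀ a, 0 < c a := fun a => inv_pos.2 (Real.sqrt_pos.2 (by linarith [hlpos a]))
  have hc2e : ∀ a, |1 - c a ^ 2| ≤ 2 * e := by
    intro a
    have h1 : 0 < l a := by linarith [hlpos a]
    have h2 : 1 - c a ^ 2 = -(1 - l a) * (l a)⁻¹ := by rw [hc2]; field_simp; ring
    rw [h2, abs_mul, abs_neg, abs_of_pos (inv_pos.2 h1)]
    have h3 : (l a)⁻¹ ≤ 2 := by
      rw [inv_le_comm₀ h1 (by norm_num)]; linarith [hlpos a]
    nlinarith [hl1 a, abs_nonneg (1 - l a), inv_pos.2 h1]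
  have hce : ∀ a, |1 - c a| ≤ 2 * e := by
    intro a
    have h1 : 1 - c a ^ 2 = (1 - c a) * (1 + c a) := by ring
    have h2 := hc2e a
    rw [h1, abs_mul, abs_of_pos (by linarith [hcpos a] : 0 < 1 + c a)] at h2
    nlinarith [hcpos a, abs_nonneg (1 - c a)]
  set η : Fin n → Rn n := fun a => c a • ξ a with hη
  have hηf : IsFrame G₂ η := by
    intro a a'
    simp only [hη, map_smul, smul_apply, smul_eq_mul, hl a a']
    split_ifs with h
    · subst h
      have h1 : l a ≠ 0 := by linarith [hlpos a]
      have := hc2 a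
      rw [← mul_assoc, ← sq, this, inv_mul_cancel₀ h1]
    · simp
  have hdiff : ∀ a, ‖ξ a - η a‖ ^ 2 ≤ (2 * e) ^ 2 * (1 / μ) := by
    intro a
    have h1 : ξ a - η a = (1 - c a) • ξ a := by simp [hη, sub_smul]
    rw [h1, norm_smul, mul_pow, Real.norm_eq_abs]
    exact mul_le_mul (pow_le_pow_left₀ (abs_nonneg _) (hce a) 2) (hξn a) (sq_nonneg _)
      (by positivity)
  have hQdiff : ∀ a, Q₁ (ξ a) (ξ a) - Q₂ (η a) (η a) ≤ e + 2 * e * (b / μ) := by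
    intro a
    have h1 : Q₁ (ξ a) (ξ a) - Q₂ (η a) (η a) =
        (Q₁ - Q₂) (ξ a) (ξ a) + (1 - c a ^ 2) * Q₂ (ξ a) (ξ a) := by
      simp [hη]; ring
    rw [h1]
    have h2 := (abs_le.1 (hquad (Q₁ - Q₂) a hQ)).2
    have h3 : |Q₂ (ξ a) (ξ a)| ≤ b / μ := by
      refine (abs_bilin_le Q₂ (ξ a)).trans ?_
      calc ‖Q₂‖ * ‖ξ a‖ ^ 2 ≤ b * (1 / μ) := mul_le_mul hQb (hξn a) (sq_nonneg _) hb
        _ = b / μ := by ring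
    have h4 : (1 - c a ^ 2) * Q₂ (ξ a) (ξ a) ≤ 2 * e * (b / μ) := by
      refine (le_abs_self _).trans ?_
      rw [abs_mul]
      exact mul_le_mul (hc2e a) h3 (abs_nonneg _) (by positivity)
    linarith
  refine ⟨ξ, hξ, ?_⟩
  have hsum : ∑ a, B (ξ a) ≤ ∑ a : Fin n, ((2 * e) ^ 2 * (1 / μ) / ε + (e + 2 * e * (b / μ)) +
      ((X₂ (η a) + Q₂ (η a) (η a)) - (X₁ (ξ a) + Q₁ (ξ a) (ξ a)))) := by
    refine Finset.sum_le_sum fun a _ => ?_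
    have h1 := hineq (ξ a) (η a)
    have h2 := div_le_div_of_nonneg_right (hdiff a) hε.le
    have h3 := hQdiff a
    linarith
  rw [Finset.sum_add_distrib, Finset.sum_sub_distrib, hX₁ ξ hξ, hX₂ η hηf] at hsum
  simp only [Finset.sum_const, Finset.card_univ, Fintype.card_fin, nsmul_eq_mul] at hsum
  -- The difference `k₁ - k₂` enters with a good sign because `s₁ ≥ 0`, so it is dropped and the
  -- constant depends on `k₂` alone.
  have hks : k₂ * s₂ - k₁ * s₁ ≤ |k₂| * (L * d) := by
    have h1 : k₂ * s₂ - k₁ * s₁ = -(k₂ * (s₁ - s₂)) - (k₁ - k₂) * s₁ := by ring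
    have h2 : -(k₂ * (s₁ - s₂)) ≤ |k₂| * (L * d) := by
      refine (neg_le_abs _).trans ?_
      rw [abs_mul]
      exact mul_le_mul_of_nonneg_left hs (abs_nonneg _)
    have h3 := mul_nonneg (sub_nonneg.2 hk) hs₁
    linarith
  refine hsum.trans ?_
  have e1 : (n : ℝ) * ((2 * e) ^ 2 * (1 / μ) / ε + (e + 2 * e * (b / μ))) + |k₂| * (L * d) =
      (n * (4 * (L / μ) ^ 2 / μ)) * (d ^ 2 / ε) +
        (n * (L / μ + 2 * (L / μ) * b / μ) + |k₂| * L) * d := by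
    rw [he]; ring
  have p1 : 0 ≤ (n : ℝ) * (4 * (L / μ) ^ 2 / μ) := by positivity
  have p2 : 0 ≤ (n : ℝ) * (L / μ + 2 * (L / μ) * b / μ) + |k₂| * L := by positivity
  have p3 : 0 ≤ d ^ 2 / ε := by positivity
  nlinarith [mul_nonneg p1 hd, mul_nonneg p2 p3]

/-! ### Jets and quasilinear equations -/

/-- First order jets `(x, u, ∇u)` of functions on `ℝⁿ`. -/
abbrev Jet (n : ℕ) : Type := Rn n × ℝ × (Rn n →L[ℝ] ℝ)

/-- The first order jet of `u` at `x`. -/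
noncomputable def jet {n : ℕ} (u : Rn n → ℝ) (x : Rn n) : Jet n := (x, u x, fderiv ℝ u x)

/-- The quasilinear equation `∑ₐ (D²u(ξₐ, ξₐ) + Q(ξₐ, ξₐ)) = k s`, for all frames `ξ` that are
orthonormal for `G`, with coefficients evaluated at the jet of `u`. -/
def SolvesAt {n : ℕ} (G Q : Jet n → Bilin n) (s : Jet n → ℝ) (k : ℝ) (u : Rn n → ℝ) (x : Rn n) :
    Prop :=
  ContDiffAt ℝ 2 u x ∧ ∀ ξ, IsFrame (G (jet u x)) ξ →
    ∑ a, (fderiv ℝ (fderiv ℝ u) x (ξ a) (ξ a) + Q (jet u x) (ξ a) (ξ a)) = k * s (jet u x)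

/-- Near the jet `θ₀` the coefficients are bounded and Lipschitz, and the equation is uniformly
elliptic. -/
structure RegularCoeffs {n : ℕ} (G Q : Jet n → Bilin n) (s : Jet n → ℝ) (θ₀ : Jet n)
    (L μ b δ : ℝ) : Prop where
  L_nonneg : 0 ≤ L
  μ_pos : 0 < μ
  b_nonneg : 0 ≤ b
  δ_pos : 0 < δ
  lip_G : ∀ θ ∈ Metric.ball θ₀ δ, ∀ θ' ∈ Metric.ball θ₀ δ, ‖G θ - G θ'‖ ≤ L * ‖θ - θ'‖
  lip_Q : ∀ θ ∈ Metric.ball θ₀ δ, ∀ θ' ∈ Metric.ball θ₀ δ, ‖Q θ - Q θ'‖ ≤ L * ‖θ - θ'‖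
  lip_s : ∀ θ ∈ Metric.ball θ₀ δ, ∀ θ' ∈ Metric.ball θ₀ δ, |s θ - s θ'| ≤ L * ‖θ - θ'‖
  symm_G : ∀ θ ∈ Metric.ball θ₀ δ, ∀ v w, G θ v w = G θ w v
  elliptic : ∀ θ ∈ Metric.ball θ₀ δ, ∀ v, μ * ‖v‖ ^ 2 ≤ G θ v v
  bound_G : ∀ θ ∈ Metric.ball θ₀ δ, ‖G θ‖ ≤ b
  bound_Q : ∀ θ ∈ Metric.ball θ₀ δ, ‖Q θ‖ ≤ b
  nonneg_s : ∀ θ ∈ Metric.ball θ₀ δ, 0 ≤ s θ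

/-! ### The Hopf lemma by doubling the variables -/

/-- The function whose maximum is studied in the doubling argument. -/
noncomputable def doubled {n : ℕ} (u₁ u₂ : Rn n → ℝ) (p : Rn n →L[ℝ] ℝ) (c : Rn n)
    (A r m η ε : ℝ) (x y : Rn n) : ℝ :=
  u₁ x - u₂ y - p (x - y) + m * r * (Real.exp (-(A * ‖x - c‖ ^ 2 / r ^ 2)) - η) -
    ‖x - y‖ ^ 2 / (2 * ε)

/-- The conditions for a maximum along the line `t ↦ (x + t ξ, y + t ζ)`. The directions are
independent: `ξ = ζ` removes the coupling and compares gradients, `ξ = 0` controls `x - y`, and two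
nearby frames give the comparison of second derivatives. -/
theorem doubled_max_conditions {n : ℕ} {u₁ u₂ : Rn n → ℝ} {p : Rn n →L[ℝ] ℝ} {c : Rn n}
    {A r m η ε : ℝ} {x y : Rn n} (h₁ : ContDiffAt ℝ 2 u₁ x) (h₂ : ContDiffAt ℝ 2 u₂ y)
    (hmax : ∀ᶠ P : Rn n × Rn n in 𝓝 (x, y),
      doubled u₁ u₂ p c A r m η ε P.1 P.2 ≤ doubled u₁ u₂ p c A r m η ε x y) (ξ ζ : Rn n) :
    fderiv ℝ u₁ x ξ - fderiv ℝ u₂ y ζ - p (ξ - ζ) -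
        m * r * (Real.exp (-(A * ‖x - c‖ ^ 2 / r ^ 2)) * (2 * A * inner ℝ (x - c) ξ / r ^ 2)) -
        inner ℝ (x - y) (ξ - ζ) / ε = 0 ∧
      fderiv ℝ (fderiv ℝ u₁) x ξ ξ - fderiv ℝ (fderiv ℝ u₂) y ζ ζ +
        m * r * (Real.exp (-(A * ‖x - c‖ ^ 2 / r ^ 2)) *
          ((2 * A * inner ℝ (x - c) ξ / r ^ 2) ^ 2 - 2 * A * ‖ξ‖ ^ 2 / r ^ 2)) -
        ‖ξ - ζ‖ ^ 2 / ε ≤ 0 := by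
  have hline : Tendsto (fun t : ℝ => ((x + t • ξ, y + t • ζ) : Rn n × Rn n)) (𝓝 0) (𝓝 (x, y)) := by
    have : Continuous (fun t : ℝ => ((x + t • ξ, y + t • ζ) : Rn n × Rn n)) := by fun_prop
    simpa using this.tendsto 0
  have hsq : ∀ (v w : Rn n) (t : ℝ), ‖v + t • w‖ ^ 2 =
      ‖v‖ ^ 2 + 2 * inner ℝ v w * t + ‖w‖ ^ 2 * t ^ 2 := by
    intro v w t
    rw [norm_add_sq_real, norm_smul, real_inner_smul_right, mul_pow, Real.norm_eq_abs, sq_abs]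
    ring
  have e1 := h₁.hasSecondDeriv ξ
  have e2 := (h₂.hasSecondDeriv ζ).const_mul (-1)
  have e3 := hasSecondDeriv_quadratic (-p (x - y) - m * r * η) (-p (ξ - ζ)) 0
  have e4 := (hasSecondDeriv_exp_quadratic (-(A * ‖x - c‖ ^ 2 / r ^ 2))
    (-(2 * A * inner ℝ (x - c) ξ / r ^ 2)) (-(A * ‖ξ‖ ^ 2 / r ^ 2))).const_mul (m * r)
  have e5 := hasSecondDeriv_quadratic (-(‖x - y‖ ^ 2 / (2 * ε)))
    (-(inner ℝ (x - y) (ξ - ζ) / ε)) (-(‖ξ - ζ‖ ^ 2 / (2 * ε)))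
  have e := (((e1.add e2).add e3).add e4).add e5
  have hφ : ∀ t : ℝ, doubled u₁ u₂ p c A r m η ε (x + t • ξ) (y + t • ζ) =
      (u₁ (x + t • ξ) + -1 * u₂ (y + t • ζ) +
        (-p (x - y) - m * r * η + -p (ξ - ζ) * t + 0 * t ^ 2) +
        m * r * Real.exp (-(A * ‖x - c‖ ^ 2 / r ^ 2) + -(2 * A * inner ℝ (x - c) ξ / r ^ 2) * t +
          -(A * ‖ξ‖ ^ 2 / r ^ 2) * t ^ 2) +
        (-(‖x - y‖ ^ 2 / (2 * ε)) + -(inner ℝ (x - y) (ξ - ζ) / ε) * t +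
          -(‖ξ - ζ‖ ^ 2 / (2 * ε)) * t ^ 2)) := by
    intro t
    have a1 : x + t • ξ - c = (x - c) + t • ξ := by abel
    have a2 : x + t • ξ - (y + t • ζ) = (x - y) + t • (ξ - ζ) := by rw [smul_sub]; abel
    rw [doubled, a1, a2, hsq, hsq, map_add, map_smul, smul_eq_mul]
    have a3 : -(A * (‖x - c‖ ^ 2 + 2 * inner ℝ (x - c) ξ * t + ‖ξ‖ ^ 2 * t ^ 2) / r ^ 2) =
        -(A * ‖x - c‖ ^ 2 / r ^ 2) + -(2 * A * inner ℝ (x - c) ξ / r ^ 2) * t +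
          -(A * ‖ξ‖ ^ 2 / r ^ 2) * t ^ 2 := by ring
    rw [a3]
    ring
  have hlm := e.of_isLocalMax (by
    filter_upwards [hline.eventually hmax] with t ht
    rw [← hφ t, ← hφ 0]
    simpa using ht)
  obtain ⟨f1, f2⟩ := hlm
  constructor
  · rw [← f1]; ring
  · refine le_trans (le_of_eq ?_) f2
    ring

theorem lipschitz_sub_linear {n : ℕ} {u : Rn n → ℝ} {p : Rn n →L[ℝ] ℝ} {x₀ : Rn n} {R κ : ℝ}
    (hu : ∀ x ∈ Metric.ball x₀ R, DifferentiableAt ℝ u x ∧ ‖fderiv ℝ u x - p‖ ≤ κ) :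
    ∀ x ∈ Metric.ball x₀ R, ∀ y ∈ Metric.ball x₀ R, |u x - u y - p (x - y)| ≤ κ * ‖x - y‖ := by
  intro x hx y hy
  have := (convex_ball x₀ R).norm_image_sub_le_of_norm_hasFDerivWithin_le
    (f := fun z => u z - p z) (f' := fun z => fderiv ℝ u z - p) (C := κ)
    (fun z hz => ((hu z hz).1.hasFDerivAt.sub p.hasFDerivAt).hasFDerivWithinAt)
    (fun z hz => (hu z hz).2) hy hx
  rw [Real.norm_eq_abs] at this
  convert this using 2
  rw [map_sub]; ring

/-- Completing the square: the most that a Lipschitz gain can win over the penalty for `x ≠ y`. -/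
theorem linear_sub_quadratic_le {c t ε : ℝ} (hε : 0 < ε) :
    c * t - t ^ 2 / (2 * ε) ≤ c ^ 2 * ε / 2 := by
  have h : c ^ 2 * ε / 2 - (c * t - t ^ 2 / (2 * ε)) = (c * ε - t) ^ 2 / (2 * ε) := by
    field_simp
    ring
  have : 0 ≤ (c * ε - t) ^ 2 / (2 * ε) := by positivity
  linarith

/-- Keeps the jets where the coefficients are controlled: since the gradient stays within `1` of
`p`, the height changes over a distance `2 * r` by less than `(1 + ‖p‖) * (2 * r)`. -/
theorem jet_mem_ball {n : ℕ} {u : Rn n → ℝ} {x₀ w : Rn n} {p : Rn n →L[ℝ] ℝ} {r κ δ : ℝ}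
    (hκ : κ ≤ 1) (hκδ : κ ≤ δ / 2) (hrδ : r ≤ δ / (3 * (1 + ‖p‖)))
    (hu : ∀ x ∈ Metric.ball x₀ (3 * r), DifferentiableAt ℝ u x ∧ ‖fderiv ℝ u x - p‖ ≤ κ)
    (hw : ‖w - x₀‖ < 2 * r) : jet u w ∈ Metric.ball ((x₀, u x₀, p) : Jet n) δ := by
  have hr : 0 < r := by linarith [norm_nonneg (w - x₀)]
  have hwb : w ∈ Metric.ball x₀ (3 * r) := by rw [mem_ball_iff_norm]; linarith
  have h1 := lipschitz_sub_linear hu w hwb x₀ (Metric.mem_ball_self (by positivity))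
  have hp0 := norm_nonneg p
  have h2 : |u w - u x₀| ≤ (1 + ‖p‖) * ‖w - x₀‖ := by
    have h3 : |p (w - x₀)| ≤ ‖p‖ * ‖w - x₀‖ := p.le_opNorm _
    have h4 : u w - u x₀ = (u w - u x₀ - p (w - x₀)) + p (w - x₀) := by ring
    have h5 : κ * ‖w - x₀‖ ≤ 1 * ‖w - x₀‖ := mul_le_mul_of_nonneg_right hκ (norm_nonneg _)
    rw [h4]
    refine (abs_add_le _ _).trans ?_
    linarith
  have h5 : 3 * r * (1 + ‖p‖) ≤ δ := by
    rw [le_div_iff₀ (by positivity)] at hrδ; linarith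
  have h6 : (1 + ‖p‖) * ‖w - x₀‖ ≤ (1 + ‖p‖) * (2 * r) :=
    mul_le_mul_of_nonneg_left hw.le (by positivity)
  have h7 : 0 < r * (1 + ‖p‖) := by positivity
  have h8 : 0 ≤ r * ‖p‖ := by positivity
  rw [mem_ball_iff_norm, jet, Prod.mk_sub_mk, Prod.mk_sub_mk, Prod.norm_def, Prod.norm_def]
  refine max_lt ?_ (max_lt ?_ ?_)
  · change ‖w - x₀‖ < δ
    linarith
  · change |u w - u x₀| < δ
    linarith
  · exact lt_of_le_of_lt (hu w hwb).2 (by linarith)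

/-- The distance of the two jets at an interior maximum. -/
theorem doubled_jet_dist {n : ℕ} {u₁ u₂ : Rn n → ℝ} {p : Rn n →L[ℝ] ℝ} {c x y : Rn n}
    {A r m η κ M Ex : ℝ} (hA : 0 < A) (hr : 0 < r) (hr1 : r ≤ 1) (hm : 0 < m) (hM : 0 < M)
    (hMr : M * r ≤ 1) (hκ : 0 < κ) (hκ1 : κ ≤ 1) (hη : 0 ≤ η)
    (hEx : Ex = Real.exp (-(A * ‖x - c‖ ^ 2 / r ^ 2)))
    (hu₂ : ‖fderiv ℝ u₂ y - p‖ ≤ κ) (hlip : |u₁ x - u₁ y - p (x - y)| ≤ κ * ‖x - y‖)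
    (hle : u₁ y ≤ u₂ y) (hx : ‖x - c‖ < r)
    (hpos : 0 < doubled u₁ u₂ p c A r m η (M * m * r) x y)
    (hcond : ∀ ξ ζ : Rn n, fderiv ℝ u₁ x ξ - fderiv ℝ u₂ y ζ - p (ξ - ζ) -
        m * r * (Ex * (2 * A * inner ℝ (x - c) ξ / r ^ 2)) -
        inner ℝ (x - y) (ξ - ζ) / (M * m * r) = 0) :
    ‖jet u₁ x - jet u₂ y‖ ≤ (2 * A + 2 + ‖p‖) * m := by
  have hε : 0 < M * m * r := by positivity
  have hp0 := norm_nonneg p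
  have hxy0 := norm_nonneg (x - y)
  have hExpos : 0 < Ex := hEx ▸ Real.exp_pos _
  have hEx1 : Ex ≤ 1 := by
    rw [hEx, Real.exp_le_one_iff]
    have : 0 ≤ A * ‖x - c‖ ^ 2 / r ^ 2 := by positivity
    linarith
  -- Moving `y` alone in the direction `x - y` gives `‖x - y‖ ^ 2 / ε ≤ κ * ‖x - y‖`, so `‖x - y‖ ≤
  -- κ * ε` with `ε = M * m * r`.
  have hxy : ‖x - y‖ ≤ m := by
    have h1 : ‖x - y‖ ^ 2 ≤ (M * m * r) * (κ * ‖x - y‖) := by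
      have h2 := hcond 0 (x - y)
      simp only [map_zero, inner_zero_right, zero_sub, inner_neg_right,
        real_inner_self_eq_norm_sq, map_neg, mul_zero, zero_div, neg_div] at h2
      have h3 : ‖x - y‖ ^ 2 / (M * m * r) = (fderiv ℝ u₂ y - p) (x - y) := by
        simp only [sub_apply]
        linarith
      have h4 : (fderiv ℝ u₂ y - p) (x - y) ≤ κ * ‖x - y‖ :=
        (le_abs_self _).trans (((fderiv ℝ u₂ y - p).le_opNorm _).trans
          (mul_le_mul_of_nonneg_right hu₂ hxy0))
      rw [← h3, div_le_iff₀ hε] at h4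
      linarith
    have h5 : M * m * r * κ ≤ m := by
      calc M * m * r * κ = m * (M * r * κ) := by ring
        _ ≤ m * (1 * 1) := mul_le_mul_of_nonneg_left
            (mul_le_mul hMr hκ1 hκ.le zero_le_one) hm.le
        _ = m := by ring
    by_contra! hlt
    have h6 : ‖x - y‖ * ‖x - y‖ ≤ m * ‖x - y‖ := by
      calc ‖x - y‖ * ‖x - y‖ = ‖x - y‖ ^ 2 := by ring
        _ ≤ (M * m * r * κ) * ‖x - y‖ := by rw [mul_assoc (M * m * r)]; exact h1
        _ ≤ m * ‖x - y‖ := mul_le_mul_of_nonneg_right h5 hxy0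
    exact absurd (le_of_mul_le_mul_right h6 (hm.trans hlt)) (not_le.2 hlt)
  -- Moving both points together leaves only the gradient of the barrier as the difference of the
  -- two gradients.
  have hp12 : ‖fderiv ℝ u₁ x - fderiv ℝ u₂ y‖ ≤ 2 * A * m := by
    refine ContinuousLinearMap.opNorm_le_bound _ (by positivity) fun v => ?_
    have h1 := hcond v v
    simp only [sub_self, map_zero, inner_zero_right, zero_div, sub_zero] at h1
    have h2 : (fderiv ℝ u₁ x - fderiv ℝ u₂ y) v =
        2 * A * m * (Ex * (inner ℝ (x - c) v / r)) := by
      rw [sub_apply]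
      have : m * r * (Ex * (2 * A * inner ℝ (x - c) v / r ^ 2)) =
        2 * A * m * (Ex * (inner ℝ (x - c) v / r)) := by field_simp
      linarith
    rw [h2, Real.norm_eq_abs, abs_mul, abs_of_pos (by positivity : 0 < 2 * A * m)]
    refine mul_le_mul_of_nonneg_left ?_ (by positivity)
    rw [abs_mul, abs_of_pos hExpos, abs_div, abs_of_pos hr]
    have h3 : |inner ℝ (x - c) v| / r ≤ ‖v‖ := by
      rw [div_le_iff₀ hr]
      refine (abs_real_inner_le_norm _ _).trans ?_
      rw [mul_comm]
      exact mul_le_mul_of_nonneg_left hx.le (norm_nonneg _)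
    have h4 : 0 ≤ |inner ℝ (x - c) v| / r := by positivity
    calc Ex * (|inner ℝ (x - c) v| / r) ≤ 1 * (|inner ℝ (x - c) v| / r) :=
          mul_le_mul_of_nonneg_right hEx1 h4
      _ ≤ ‖v‖ := by rwa [one_mul]
  -- The upper bound comes from `u₁ y ≤ u₂ y` and the Lipschitz bound of `u₁`, the lower bound from
  -- the positivity of the maximum.
  have hz12 : |u₁ x - u₂ y| ≤ (2 + ‖p‖) * m := by
    have h2 : |p (x - y)| ≤ ‖p‖ * ‖x - y‖ := p.le_opNorm _
    have h2' := abs_le.1 h2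
    have h1' := abs_le.1 hlip
    have h3 : ‖p‖ * ‖x - y‖ ≤ ‖p‖ * m := mul_le_mul_of_nonneg_left hxy (norm_nonneg _)
    have h4 : κ * ‖x - y‖ ≤ 1 * m := mul_le_mul hκ1 hxy hxy0 zero_le_one
    rw [doubled, ← hEx] at hpos
    have h5 : 0 ≤ ‖x - y‖ ^ 2 / (2 * (M * m * r)) := by positivity
    have h6 : m * r * (Ex - η) ≤ m := by
      calc m * r * (Ex - η) ≤ m * r * 1 := mul_le_mul_of_nonneg_left (by linarith) (by positivity)
        _ ≤ m * 1 * 1 := by gcongr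
        _ = m := by ring
    rw [abs_le]
    constructor <;> linarith
  have g1 : 0 ≤ A * m := by positivity
  have g2 : 0 ≤ ‖p‖ * m := by positivity
  rw [jet, jet, Prod.mk_sub_mk, Prod.mk_sub_mk, Prod.norm_def, Prod.norm_def]
  refine max_le ?_ (max_le ?_ ?_)
  · change ‖x - y‖ ≤ _
    linarith
  · change |u₁ x - u₂ y| ≤ _
    linarith
  · change ‖fderiv ℝ u₁ x - fderiv ℝ u₂ y‖ ≤ _
    linarith

/-- The barrier is a strict subsolution. -/
theorem barrier_lower_bound {n : ℕ} {G : Bilin n} {ξ : Fin n → Rn n} (hξ : IsFrame G ξ) {b μ A : ℝ}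
    (hb : 0 ≤ b) (hμ : 0 < μ) (hA : A = (b + 1) * (2 * n / μ + 1)) (hG : ‖G‖ ≤ b)
    (hell : ∀ v, μ * ‖v‖ ^ 2 ≤ G v v) {m r E Ex : ℝ} (hm : 0 < m) (hr : 0 < r) (hE : 0 < E)
    (hEx : E ≤ Ex) {y : Rn n} (hy : r / 2 < ‖y‖) :
    m * E / r ≤ ∑ a, m * r * (Ex * ((2 * A * inner ℝ y (ξ a) / r ^ 2) ^ 2 -
      2 * A * ‖ξ a‖ ^ 2 / r ^ 2)) := by
  have h1 := hξ.norm_sq_le y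
  have hn : 0 ≤ 2 * n / μ := by positivity
  have hA1 : 1 ≤ A := by
    rw [hA]
    nlinarith
  have h2 : ∑ a, ‖ξ a‖ ^ 2 ≤ n * (1 / μ) := by
    refine (Finset.sum_le_sum fun a _ => hξ.norm_sq_vector_le hμ hell a).trans ?_
    simp
  set S := ∑ a, (inner ℝ y (ξ a)) ^ 2 with hS
  have h0 : 0 ≤ S := Finset.sum_nonneg fun a _ => sq_nonneg _
  -- Outside the half ball the frame has a definite component along `y`. The factor `b + 1` in `A`
  -- makes the gradient square of the barrier outweigh its negative second order term.
  have h3 : r ^ 2 / 4 ≤ (b + 1) * S := by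
    have h4 : (r / 2) ^ 2 ≤ ‖y‖ ^ 2 := pow_le_pow_left₀ (by positivity) hy.le 2
    have h5 : ‖G‖ * S ≤ b * S := mul_le_mul_of_nonneg_right hG h0
    linarith
  have e1 : ∑ a, m * r * (Ex * ((2 * A * inner ℝ y (ξ a) / r ^ 2) ^ 2 -
      2 * A * ‖ξ a‖ ^ 2 / r ^ 2)) =
      m * Ex / r * (A * (4 * A / r ^ 2 * S - 2 * ∑ a, ‖ξ a‖ ^ 2)) := by
    rw [hS, Finset.mul_sum, Finset.mul_sum, ← Finset.sum_sub_distrib, Finset.mul_sum,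
      Finset.mul_sum]
    refine Finset.sum_congr rfl fun a _ => ?_
    field_simp
    ring
  rw [e1]
  have h4 : 2 * n / μ + 1 ≤ 4 * A / r ^ 2 * S := by
    have h5 : 4 * A / r ^ 2 * S = (2 * n / μ + 1) * (4 / r ^ 2 * ((b + 1) * S)) := by
      rw [hA]; ring
    rw [h5]
    have h6 : 1 ≤ 4 / r ^ 2 * ((b + 1) * S) := by
      calc (1 : ℝ) = 4 / r ^ 2 * (r ^ 2 / 4) := by field_simp
        _ ≤ _ := mul_le_mul_of_nonneg_left h3 (by positivity)
    exact le_mul_of_one_le_right (by positivity) h6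
  have h8 : 1 ≤ A * (4 * A / r ^ 2 * S - 2 * ∑ a, ‖ξ a‖ ^ 2) := by
    have h9 : 1 ≤ 4 * A / r ^ 2 * S - 2 * ∑ a, ‖ξ a‖ ^ 2 := by
      have : 2 * n / μ = 2 * (n * (1 / μ)) := by ring
      linarith
    exact one_le_mul_of_one_le_of_one_le hA1 h9
  have hExpos := hE.trans_le hEx
  calc m * E / r = m * E / r * 1 := by ring
    _ ≤ m * Ex / r * _ := mul_le_mul (by gcongr) h8 (by norm_num) (by positivity)

set_option maxHeartbeats 1600000 in
/-- An interior maximum with positive value is impossible. -/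
theorem doubled_no_interior_max {n : ℕ} {G Q : Jet n → Bilin n} {s : Jet n → ℝ} {x₀ : Rn n}
    {z₀ : ℝ} {p : Rn n →L[ℝ] ℝ} {L μ b δ : ℝ}
    (hreg : RegularCoeffs G Q s (x₀, z₀, p) L μ b δ) (k₂ : ℝ) :
    ∃ A : ℝ, 1 ≤ A ∧ ∃ M : ℝ, 0 < M ∧ ∃ r₀ κ₀ : ℝ, 0 < r₀ ∧ 0 < κ₀ ∧
      ∀ (u₁ u₂ : Rn n → ℝ) (k₁ r m κ η : ℝ) (c x y : Rn n), k₂ ≤ k₁ → 0 < r → r ≤ r₀ → 0 < κ →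
        κ ≤ κ₀ → 0 < m → m ≤ 2 * κ → u₁ x₀ = z₀ → u₂ x₀ = z₀ → 0 ≤ η →
        (∀ x ∈ Metric.ball x₀ (3 * r), DifferentiableAt ℝ u₁ x ∧ ‖fderiv ℝ u₁ x - p‖ ≤ κ) →
        (∀ x ∈ Metric.ball x₀ (3 * r), DifferentiableAt ℝ u₂ x ∧ ‖fderiv ℝ u₂ x - p‖ ≤ κ) →
        ‖c - x₀‖ = r → r / 2 < ‖x - c‖ → ‖x - c‖ < r → ‖y - c‖ < r → u₁ y ≤ u₂ y →
        SolvesAt G Q s k₁ u₁ x → SolvesAt G Q s k₂ u₂ y →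
        0 < doubled u₁ u₂ p c A r m η (M * m * r) x y →
        (∀ᶠ P : Rn n × Rn n in 𝓝 (x, y), doubled u₁ u₂ p c A r m η (M * m * r) P.1 P.2 ≤
          doubled u₁ u₂ p c A r m η (M * m * r) x y) → False := by
  have hL := hreg.L_nonneg
  have hμ := hreg.μ_pos
  have hb := hreg.b_nonneg
  have hδ := hreg.δ_pos
  obtain ⟨C, hC, hcomp⟩ := exists_frame_sum_le (n := n) hL hμ hb k₂
  set A : ℝ := (b + 1) * (2 * n / μ + 1) with hA
  have hA1 : 1 ≤ A := by
    have : 0 ≤ 2 * n / μ := by positivity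
    nlinarith
  set C₁ : ℝ := 2 * A + 2 + ‖p‖ with hC₁
  have hC₁pos : 0 < C₁ := by positivity
  set E := Real.exp (-A) with hE
  have hEpos : 0 < E := Real.exp_pos _
  -- With this `M` the coupling error costs at most a quarter of the barrier's contribution.
  set M : ℝ := 1 + 4 * C * C₁ ^ 2 / E with hM
  have hMpos : 0 < M := by positivity
  -- The bounds on `r` give `M * r ≤ 1`, make the first order error at most a quarter of the
  -- barrier's contribution, and keep the jets in the `δ`-ball. The last bound on `κ`, with `m ≤ 2 *
  -- κ`, keeps the two forms close enough for the comparison of frames.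
  refine ⟨A, hA1, M, hMpos, min (min 1 (1 / M)) (min (E / (4 * (C * C₁ + 1)))
    (δ / (3 * (1 + ‖p‖)))), min (min 1 (δ / 2)) (μ / (4 * (L * C₁ + 1))), by positivity,
    by positivity, ?_⟩
  intro u₁ u₂ k₁ r m κ η c x y hk hr hr₀ hκ hκ₀ hm hmκ hz₁ hz₂ hη hu₁ hu₂ hc hx1 hx2 hy2 hle hs₁ hs₂
    hposΦ hmax
  simp only [le_min_iff] at hr₀ hκ₀
  obtain ⟨⟨hr1, hrM⟩, hrE, hrδ⟩ := hr₀
  obtain ⟨⟨hκ1, hκδ⟩, hκμ⟩ := hκ₀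
  have hMr : M * r ≤ 1 := by rwa [le_div_iff₀ hMpos, mul_comm] at hrM
  have hε : 0 < M * m * r := by positivity
  have hball : ∀ w, ‖w - c‖ < r → w ∈ Metric.ball x₀ (3 * r) ∧ ‖w - x₀‖ < 2 * r := by
    intro w hw
    have : ‖w - x₀‖ ≤ ‖w - c‖ + ‖c - x₀‖ := by
      simpa using norm_add_le (w - c) (c - x₀)
    refine ⟨?_, by linarith⟩
    rw [mem_ball_iff_norm]; linarith
  have hxb := (hball x hx2).1
  have hyb := (hball y hy2).1
  have hj₁ := jet_mem_ball hκ1 hκδ hrδ hu₁ (hball x hx2).2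
  have hj₂ := jet_mem_ball hκ1 hκδ hrδ hu₂ (hball y hy2).2
  rw [hz₁] at hj₁
  rw [hz₂] at hj₂
  have hcond := doubled_max_conditions hs₁.1 hs₂.1 hmax
  set Ex := Real.exp (-(A * ‖x - c‖ ^ 2 / r ^ 2)) with hEx
  have hExpos : 0 < Ex := Real.exp_pos _
  have hExE : E ≤ Ex := by
    rw [hE, hEx, Real.exp_le_exp, neg_le_neg_iff, div_le_iff₀ (by positivity)]
    have : ‖x - c‖ ^ 2 ≤ r ^ 2 := pow_le_pow_left₀ (norm_nonneg _) hx2.le 2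
    nlinarith
  have hd : ‖jet u₁ x - jet u₂ y‖ ≤ C₁ * m :=
    doubled_jet_dist (by linarith) hr hr1 hm hMpos hMr hκ hκ1 hη hEx (hu₂ y hyb).2
      (lipschitz_sub_linear hu₁ x hxb y hyb) hle hx2 hposΦ fun ξ ζ => (hcond ξ ζ).1
  have hsmall : L * (C₁ * m) / μ ≤ 1 / 2 := by
    rw [le_div_iff₀ (by positivity)] at hκμ
    rw [div_le_iff₀ hμ]
    have h1 : L * C₁ * m ≤ L * C₁ * (2 * κ) := mul_le_mul_of_nonneg_left hmκ (by positivity)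
    nlinarith
  have hLd := mul_le_mul_of_nonneg_left hd hL
  obtain ⟨ξ, hξ, hsum⟩ := hcomp (G (jet u₁ x)) (G (jet u₂ y)) (Q (jet u₁ x)) (Q (jet u₂ y))
    (s (jet u₁ x)) (s (jet u₂ y)) k₁ (C₁ * m) (M * m * r)
    (fun v => fderiv ℝ (fderiv ℝ u₁) x v v) (fun v => fderiv ℝ (fderiv ℝ u₂) y v v)
    (fun v => m * r * (Ex * ((2 * A * inner ℝ (x - c) v / r ^ 2) ^ 2 - 2 * A * ‖v‖ ^ 2 / r ^ 2)))
    (by positivity) hε hsmall ((hreg.lip_G _ hj₁ _ hj₂).trans hLd)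
    ((hreg.lip_Q _ hj₁ _ hj₂).trans hLd) ((hreg.lip_s _ hj₁ _ hj₂).trans hLd)
    (hreg.bound_Q _ hj₂) (hreg.symm_G _ hj₁) (hreg.symm_G _ hj₂) (hreg.elliptic _ hj₁)
    (hreg.nonneg_s _ hj₁) hk hs₁.2 hs₂.2 (fun v w => by have := (hcond v w).2; linarith)
  have hlow := barrier_lower_bound hξ hb hμ hA (hreg.bound_G _ hj₁) (hreg.elliptic _ hj₁) hm hr hEpos
    hExE hx1
  have hfin := hlow.trans hsum
  -- Because the jets differ by a multiple of `m` and `ε = M * m * r`, the coupling error scales as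
  -- `m / r`, like the barrier. The errors add up to at most half of the barrier's `m * E / r`.
  have e2 : C * (C₁ * m + (C₁ * m) ^ 2 / (M * m * r)) = m / r * (C * C₁ * r + C * C₁ ^ 2 / M) := by
    field_simp
  have e3 : m * E / r = m / r * E := by ring
  rw [e2, e3] at hfin
  have hfin' := le_of_mul_le_mul_left hfin (by positivity)
  have g1 : C * C₁ * r ≤ E / 4 := by
    rw [le_div_iff₀ (by positivity)] at hrE
    nlinarith
  have g2 : C * C₁ ^ 2 / M ≤ E / 4 := by
    rw [div_le_iff₀ hMpos, hM]
    have : E / 4 * (1 + 4 * C * C₁ ^ 2 / E) = E / 4 + C * C₁ ^ 2 := by field_simp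
    rw [this]; linarith
  linarith

/-! ### The slope of the barrier, and the iteration of the Hopf estimate -/

theorem exp_neg_sub_le {s t : ℝ} (hs : 0 ≤ s) :
    Real.exp (-s) - Real.exp (-t) ≤ |s - t| := by
  rcases le_total t s with h | h
  · have : Real.exp (-s) ≤ Real.exp (-t) := Real.exp_le_exp.2 (by linarith)
    linarith [abs_nonneg (s - t)]
  · rw [abs_of_nonpos (by linarith)]
    have h1 : Real.exp (-s) - Real.exp (-t) = Real.exp (-s) * (1 - Real.exp (-(t - s))) := by
      rw [mul_sub, mul_one, ← Real.exp_add]; congr 2; ring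
    have h2 : Real.exp (-s) ≤ 1 := by rw [Real.exp_le_one_iff]; linarith
    have h3 : 1 - Real.exp (-(t - s)) ≤ t - s := by linarith [Real.add_one_le_exp (-(t - s))]
    have h4 : 0 ≤ 1 - Real.exp (-(t - s)) := by
      have : Real.exp (-(t - s)) ≤ 1 := by rw [Real.exp_le_one_iff]; linarith
      linarith
    rw [h1]
    nlinarith [Real.exp_pos (-s)]

theorem barrier_lipschitz {n : ℕ} {c x y : Rn n} {A r : ℝ} (hA : 0 ≤ A) (hr : 0 < r)
    (hx : ‖x - c‖ ≤ r) (hy : ‖y - c‖ ≤ r) :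
    Real.exp (-(A * ‖x - c‖ ^ 2 / r ^ 2)) - Real.exp (-(A * ‖y - c‖ ^ 2 / r ^ 2)) ≤
      2 * A / r * ‖x - y‖ := by
  refine (exp_neg_sub_le (by positivity)).trans ?_
  have h1 : A * ‖x - c‖ ^ 2 / r ^ 2 - A * ‖y - c‖ ^ 2 / r ^ 2 =
      A / r ^ 2 * ((‖x - c‖ + ‖y - c‖) * (‖x - c‖ - ‖y - c‖)) := by ring
  have h2 : |‖x - c‖ - ‖y - c‖| ≤ ‖x - y‖ := by
    simpa using abs_norm_sub_norm_le (x - c) (y - c)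
  rw [h1, abs_mul, abs_mul, abs_of_nonneg (by positivity : 0 ≤ A / r ^ 2),
    abs_of_nonneg (by positivity : 0 ≤ ‖x - c‖ + ‖y - c‖)]
  calc A / r ^ 2 * ((‖x - c‖ + ‖y - c‖) * |‖x - c‖ - ‖y - c‖|)
      ≤ A / r ^ 2 * ((2 * r) * ‖x - y‖) := by
        refine mul_le_mul_of_nonneg_left ?_ (by positivity)
        exact mul_le_mul (by linarith) h2 (abs_nonneg _) (by positivity)
    _ = 2 * A / r * ‖x - y‖ := by field_simp

/-- One step of the Hopf lemma: a lower bound of `u₂ - u₁` in the middle of the ball of radius `r`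
touching `x₀` propagates to the ball of radius `τ r`, with the loss of a factor independent of
`τ`. -/
theorem hopf_step {n : ℕ} {G Q : Jet n → Bilin n} {s : Jet n → ℝ} {x₀ : Rn n}
    {z₀ : ℝ} {p : Rn n →L[ℝ] ℝ} {L μ b δ : ℝ}
    (hreg : RegularCoeffs G Q s (x₀, z₀, p) L μ b δ) (k₂ : ℝ) :
    ∃ a : ℝ, 0 < a ∧ a ≤ 1 ∧ ∀ τ : ℝ, 0 < τ → τ ≤ 1 → ∃ r₀ κ₀ : ℝ, 0 < r₀ ∧ 0 < κ₀ ∧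
      ∀ (u₁ u₂ : Rn n → ℝ) (k₁ r m κ : ℝ) (N : Rn n), k₂ ≤ k₁ → 0 < r → r ≤ r₀ → 0 < κ →
        κ ≤ κ₀ → 0 < m → ‖N‖ = 1 → u₁ x₀ = z₀ → u₂ x₀ = z₀ →
        (∀ x ∈ Metric.ball x₀ (3 * r), DifferentiableAt ℝ u₁ x ∧ ‖fderiv ℝ u₁ x - p‖ ≤ κ) →
        (∀ x ∈ Metric.ball x₀ (3 * r), DifferentiableAt ℝ u₂ x ∧ ‖fderiv ℝ u₂ x - p‖ ≤ κ) →
        (∀ x ∈ Metric.closedBall (x₀ + r • N) r, u₁ x ≤ u₂ x) →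
        (∀ x ∈ Metric.ball (x₀ + r • N) r, SolvesAt G Q s k₁ u₁ x ∧ SolvesAt G Q s k₂ u₂ x) →
        (∀ x ∈ Metric.closedBall (x₀ + r • N) (r / 2), m * r ≤ u₂ x - u₁ x) →
        ∀ x ∈ Metric.closedBall (x₀ + (τ * r) • N) (τ * r / 2),
          a * m * (τ * r) ≤ u₂ x - u₁ x := by
  obtain ⟨A, hA1, M, hM, r₀, κ₀, hr₀pos, hκ₀pos, hint⟩ := doubled_no_interior_max hreg k₂
  set E := Real.exp (-A) with hE
  have hEpos : 0 < E := Real.exp_pos _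
  have hApos : 0 < A := by linarith
  have hEA : E * A ≤ 1 := by
    have h1 : A ≤ Real.exp A := by linarith [Real.add_one_le_exp A]
    have h2 : E * Real.exp A = 1 := by rw [hE, ← Real.exp_add]; simp
    calc E * A ≤ E * Real.exp A := mul_le_mul_of_nonneg_left h1 hEpos.le
      _ = 1 := h2
  -- At depth `τ * r / 2` inside the ball the barrier exceeds its boundary value `E` by at least `E
  -- * A * τ / 2`, that is `2 * β`. Half of it is spent on doubling the variables, and the other
  -- half is the bound that is kept.
  refine ⟨E * A / 4, by positivity, by linarith, fun τ hτ hτ1 => ?_⟩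
  set β := E * A * τ / 4 with hβ
  have hβpos : 0 < β := by positivity
  -- The last bound on `κ` makes the doubling error `(κ + 2 * A * m) ^ 2 * ε / 2` at most `m * r *
  -- β`. This is why the admissible oscillation of the gradients depends on `τ`, while the loss does
  -- not.
  refine ⟨r₀, min κ₀ (min 1 (2 * β / ((1 + 4 * A) ^ 2 * M))), hr₀pos, by positivity, ?_⟩
  intro u₁ u₂ k₁ r m κ N hk hr hrr hκ hκκ hm hN hz₁ hz₂ hu₁ hu₂ hle hsolve hmid x hx
  simp only [le_min_iff] at hκκ
  obtain ⟨hκ0, hκ1, hκβ⟩ := hκκ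
  set c := x₀ + r • N with hc
  have hcx : ‖c - x₀‖ = r := by simp [hc, norm_smul, hN, abs_of_pos hr]
  have hmem : ∀ w, ‖w - c‖ ≤ r → w ∈ Metric.ball x₀ (3 * r) := by
    intro w hw
    have : ‖w - x₀‖ ≤ ‖w - c‖ + ‖c - x₀‖ := by simpa using norm_add_le (w - c) (c - x₀)
    rw [mem_ball_iff_norm]; linarith
  have hlip₁ := lipschitz_sub_linear hu₁
  have hlip₂ := lipschitz_sub_linear hu₂
  -- The two functions agree at `x₀` and their gradients are `κ`-close to `p`, so their gap at the
  -- center is at most `2 * κ * r`.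
  have hmκ : m ≤ 2 * κ := by
    have h1 := hmid c (Metric.mem_closedBall_self (by positivity))
    have hx₀ : x₀ ∈ Metric.ball x₀ (3 * r) := Metric.mem_ball_self (by positivity)
    have hcb := hmem c (by simpa using hr.le)
    have h2 := abs_le.1 (hlip₁ c hcb x₀ hx₀)
    have h3 := abs_le.1 (hlip₂ c hcb x₀ hx₀)
    rw [hcx] at h2 h3
    have : m * r ≤ 2 * κ * r := by linarith
    exact le_of_mul_le_mul_right this hr
  have hε : 0 < M * m * r := by positivity
  set D : Set (Rn n) := {w | r / 2 ≤ ‖w - c‖ ∧ ‖w - c‖ ≤ r} with hD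
  have hDcompact : IsCompact D := by
    have hcl : IsClosed D := by
      have hcn : Continuous fun w : Rn n => ‖w - c‖ := by fun_prop
      exact (isClosed_le continuous_const hcn).inter (isClosed_le hcn continuous_const)
    refine (isCompact_closedBall c r).of_isClosed_subset hcl fun w hw => ?_
    rw [mem_closedBall_iff_norm]; exact hw.2
  set Φ := doubled u₁ u₂ p c A r m (E + β) (M * m * r) with hΦ
  set X : Rn n → ℝ := fun w => Real.exp (-(A * ‖w - c‖ ^ 2 / r ^ 2)) with hX
  have hcoef : (κ + 2 * A * m) ^ 2 * (M * m * r) / 2 ≤ m * r * β := by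
    have h1 : κ + 2 * A * m ≤ (1 + 4 * A) * κ := by nlinarith
    have h2 : (κ + 2 * A * m) ^ 2 ≤ ((1 + 4 * A) * κ) ^ 2 :=
      pow_le_pow_left₀ (by positivity) h1 2
    have h3 : κ * ((1 + 4 * A) ^ 2 * M) ≤ 2 * β := by rwa [le_div_iff₀ (by positivity)] at hκβ
    have h4 : ((1 + 4 * A) * κ) ^ 2 * M ≤ 2 * β := by
      calc ((1 + 4 * A) * κ) ^ 2 * M = κ * (κ * ((1 + 4 * A) ^ 2 * M)) := by ring
        _ ≤ 1 * (κ * ((1 + 4 * A) ^ 2 * M)) := mul_le_mul_of_nonneg_right hκ1 (by positivity)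
        _ ≤ 2 * β := by rwa [one_mul]
    have h5 : (κ + 2 * A * m) ^ 2 * M ≤ 2 * β :=
      (mul_le_mul_of_nonneg_right h2 hM.le).trans h4
    have h6 : 0 < m * r := by positivity
    calc (κ + 2 * A * m) ^ 2 * (M * m * r) / 2 = (κ + 2 * A * m) ^ 2 * M * (m * r) / 2 := by ring
      _ ≤ 2 * β * (m * r) / 2 := by gcongr
      _ = m * r * β := by ring
  -- the values on the boundary
  have hbdry : ∀ w ∈ D, (¬ (r / 2 < ‖w - c‖ ∧ ‖w - c‖ < r)) → u₁ w - u₂ w + m * r * (X w - E) ≤ 0 := by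
    intro w hw hnot
    rw [not_and_or, not_lt, not_lt] at hnot
    rcases hnot with h | h
    · have h1 := hmid w (by rw [mem_closedBall_iff_norm]; exact h)
      have h2 : X w ≤ 1 := by
        rw [hX]; simp only [Real.exp_le_one_iff, Left.neg_nonpos_iff]; positivity
      have h3 : m * r * (X w - E) ≤ m * r * 1 :=
        mul_le_mul_of_nonneg_left (by linarith) (by positivity)
      linarith
    · have h1 : ‖w - c‖ = r := le_antisymm hw.2 h
      have h2 : X w = E := by
        rw [hX, hE]; simp only [h1]; congr 2; field_simp
      rw [h2]
      have := hle w (by rw [mem_closedBall_iff_norm]; exact hw.2)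
      linarith
  -- A positive maximum over pairs in the closed annulus is excluded: boundary points by `hbdry` and
  -- the margin `β`, interior points by the comparison of the equations.
  have hΦneg : ∀ w ∈ D, ∀ w' ∈ D, Φ w w' ≤ 0 := by
    by_contra! hcon
    obtain ⟨w₀, hw₀, w₀', hw₀', hpos₀⟩ := hcon
    have hcont : ContinuousOn (fun P : Rn n × Rn n => Φ P.1 P.2) (D ×ˢ D) := by
      have c1 : ContinuousOn u₁ D := fun w hw =>
        (hu₁ w (hmem w hw.2)).1.continuousAt.continuousWithinAt
      have c2 : ContinuousOn u₂ D := fun w hw =>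
        (hu₂ w (hmem w hw.2)).1.continuousAt.continuousWithinAt
      have d1 : ContinuousOn (fun P : Rn n × Rn n => u₁ P.1) (D ×ˢ D) :=
        c1.comp continuousOn_fst fun P hP => hP.1
      have d2 : ContinuousOn (fun P : Rn n × Rn n => u₂ P.2) (D ×ˢ D) :=
        c2.comp continuousOn_snd fun P hP => hP.2
      have d3 : Continuous (fun P : Rn n × Rn n => p (P.1 - P.2)) := by fun_prop
      have d4 : Continuous (fun P : Rn n × Rn n =>
          m * r * (Real.exp (-(A * ‖P.1 - c‖ ^ 2 / r ^ 2)) - (E + β)) -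
            ‖P.1 - P.2‖ ^ 2 / (2 * (M * m * r))) := by fun_prop
      refine (((d1.sub d2).sub d3.continuousOn).add d4.continuousOn).congr fun P _ => ?_
      simp only [hΦ, doubled, Pi.add_apply, Pi.sub_apply]
      ring
    obtain ⟨P, hP, hPmax⟩ := (hDcompact.prod hDcompact).exists_isMaxOn ⟨(w₀, w₀'), hw₀, hw₀'⟩ hcont
    have hPpos : 0 < Φ P.1 P.2 := hpos₀.trans_le (hPmax (show (w₀, w₀') ∈ D ×ˢ D from ⟨hw₀, hw₀'⟩))
    obtain ⟨x', y'⟩ := P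
    obtain ⟨hx', hy'⟩ := hP
    simp only at hx' hy' hPpos
    have hquad := fun t : ℝ => linear_sub_quadratic_le (c := t) (t := ‖x' - y'‖) hε
    -- If `x'` is on the boundary, replace `y'` by `x'` in `u₂`; the Lipschitz gain `κ * ‖x' - y'‖`
    -- is absorbed by the penalty and the margin.
    have hxin : r / 2 < ‖x' - c‖ ∧ ‖x' - c‖ < r := by
      by_contra hnot
      have h1 := hbdry x' hx' hnot
      have h2 := (abs_le.1 (hlip₂ x' (hmem x' hx'.2) y' (hmem y' hy'.2))).2
      have h3 := hquad κ
      have h4 : κ ^ 2 * (M * m * r) / 2 ≤ (κ + 2 * A * m) ^ 2 * (M * m * r) / 2 := by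
        gcongr
        have : 0 ≤ 2 * A * m := by positivity
        linarith
      have h5 : Φ x' y' = (u₁ x' - u₂ x' + m * r * (X x' - E)) + (u₂ x' - u₂ y' - p (x' - y')) -
          m * r * β - ‖x' - y'‖ ^ 2 / (2 * (M * m * r)) := by
        simp only [hΦ, doubled, hX]; ring
      linarith
    -- If `y'` is on the boundary, it is `x'` that is replaced, in `u₁` and in the barrier. The
    -- slope of the barrier raises the Lipschitz constant to `κ + 2 * A * m`.
    have hyin : r / 2 < ‖y' - c‖ ∧ ‖y' - c‖ < r := by
      by_contra hnot
      have h1 := hbdry y' hy' hnot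
      have h2 := (abs_le.1 (hlip₁ x' (hmem x' hx'.2) y' (hmem y' hy'.2))).2
      have h3 := hquad (κ + 2 * A * m)
      have h4 : m * r * (X x' - X y') ≤ 2 * A * m * ‖x' - y'‖ := by
        calc m * r * (X x' - X y') ≤ m * r * (2 * A / r * ‖x' - y'‖) :=
              mul_le_mul_of_nonneg_left (barrier_lipschitz hApos.le hr hx'.2 hy'.2) (by positivity)
          _ = _ := by field_simp
      have h5 : Φ x' y' = (u₁ y' - u₂ y' + m * r * (X y' - E)) + (u₁ x' - u₁ y' - p (x' - y')) +
          m * r * (X x' - X y') - m * r * β - ‖x' - y'‖ ^ 2 / (2 * (M * m * r)) := by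
        simp only [hΦ, doubled, hX]; ring
      linarith
    have hxs := hsolve x' (by rw [mem_ball_iff_norm]; exact hxin.2)
    have hys := hsolve y' (by rw [mem_ball_iff_norm]; exact hyin.2)
    refine hint u₁ u₂ k₁ r m κ (E + β) c x' y' hk hr hrr hκ hκ0 hm hmκ hz₁ hz₂ (by positivity)
      hu₁ hu₂ hcx hxin.1 hxin.2 hyin.2 (hle y' (by rw [mem_closedBall_iff_norm]; exact hy'.2))
      hxs.1 hys.2 hPpos ?_
    have hcn : Continuous fun w : Rn n => ‖w - c‖ := by fun_prop
    have o1 : ∀ᶠ w in 𝓝 x', w ∈ D := by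
      have : ∀ᶠ w in 𝓝 x', r / 2 < ‖w - c‖ ∧ ‖w - c‖ < r :=
        (hcn.continuousAt.eventually_const_lt hxin.1).and (hcn.continuousAt.eventually_lt_const hxin.2)
      exact this.mono fun w hw => ⟨hw.1.le, hw.2.le⟩
    have o2 : ∀ᶠ w in 𝓝 y', w ∈ D := by
      have : ∀ᶠ w in 𝓝 y', r / 2 < ‖w - c‖ ∧ ‖w - c‖ < r :=
        (hcn.continuousAt.eventually_const_lt hyin.1).and (hcn.continuousAt.eventually_lt_const hyin.2)
      exact this.mono fun w hw => ⟨hw.1.le, hw.2.le⟩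
    filter_upwards [o1.prod_nhds o2] with P hP using hPmax hP
  -- conclusion
  by_cases hin : ‖x - c‖ ≤ r / 2
  · have h1 := hmid x (by rw [mem_closedBall_iff_norm]; exact hin)
    refine le_trans ?_ h1
    have h2 : E * A / 4 * τ ≤ 1 := by
      have : E * A * τ ≤ 1 * 1 := mul_le_mul hEA hτ1 hτ.le zero_le_one
      linarith
    calc E * A / 4 * m * (τ * r) = (E * A / 4 * τ) * (m * r) := by ring
      _ ≤ 1 * (m * r) := mul_le_mul_of_nonneg_right h2 (by positivity)
      _ = m * r := one_mul _
  · push Not at hin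
    rw [mem_closedBall_iff_norm] at hx
    have hxc : ‖x - c‖ ≤ (1 - τ / 2) * r := by
      have h1 : x - c = (x - (x₀ + (τ * r) • N)) - ((1 - τ) * r) • N := by
        rw [hc, sub_mul, sub_smul, one_mul]; abel
      rw [h1]
      refine (norm_sub_le _ _).trans ?_
      rw [norm_smul, hN, mul_one, Real.norm_eq_abs,
        abs_of_nonneg (mul_nonneg (by linarith) hr.le)]
      linarith
    have hxD : x ∈ D := ⟨hin.le, hxc.trans (by nlinarith)⟩
    -- On the diagonal the penalty vanishes, and the barrier bounds `u₂ - u₁` from below.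
    have h1 := hΦneg x hxD x hxD
    have h2 : Φ x x = u₁ x - u₂ x + m * r * (X x - E - β) := by
      simp only [hΦ, doubled, hX, sub_self, map_zero, norm_zero]; ring
    have h3 : E + 2 * β ≤ X x := by
      have h4 : ‖x - c‖ ^ 2 ≤ ((1 - τ / 2) * r) ^ 2 := pow_le_pow_left₀ (norm_nonneg _) hxc 2
      have h5 : A * ‖x - c‖ ^ 2 / r ^ 2 ≤ A * (1 - τ / 2) ^ 2 := by
        rw [div_le_iff₀ (by positivity)]
        calc A * ‖x - c‖ ^ 2 ≤ A * ((1 - τ / 2) * r) ^ 2 := mul_le_mul_of_nonneg_left h4 hApos.le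
          _ = _ := by ring
      have h6 : X x = E * Real.exp (A - A * ‖x - c‖ ^ 2 / r ^ 2) := by
        simp only [hX, hE]
        rw [← Real.exp_add]
        ring_nf
      have h7 := Real.add_one_le_exp (A - A * ‖x - c‖ ^ 2 / r ^ 2)
      have h8 : A * (τ / 2) + 1 ≤ Real.exp (A - A * ‖x - c‖ ^ 2 / r ^ 2) := by
        refine le_trans ?_ h7
        have : A * (1 - τ / 2) ^ 2 ≤ A * (1 - τ / 2) := by
          refine mul_le_mul_of_nonneg_left ?_ hApos.le
          nlinarith
        linarith
      rw [h6]
      calc E + 2 * β = E * (A * (τ / 2) + 1) := by rw [hβ]; ring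
        _ ≤ _ := mul_le_mul_of_nonneg_left h8 hEpos.le
    rw [h2] at h1
    have h9 : m * r * β ≤ m * r * (X x - E - β) :=
      mul_le_mul_of_nonneg_left (by linarith) (by positivity)
    have h10 : E * A / 4 * m * (τ * r) = m * r * β := by rw [hβ]; ring
    rw [h10]; linarith

/-- **Hopf lemma.** Two ordered solutions of a quasilinear equation in a ball, which touch at a
boundary point `x₀` where they are only `C^{1,α}`, cannot be strictly ordered in the ball. -/
theorem hopf_touching {n : ℕ} {G Q : Jet n → Bilin n} {s : Jet n → ℝ} {x₀ N : Rn n}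
    {L μ b δ R k₁ k₂ α H : ℝ} {u₁ u₂ : Rn n → ℝ}
    (hreg : RegularCoeffs G Q s (jet u₁ x₀) L μ b δ) (hk : k₂ ≤ k₁) (hN : ‖N‖ = 1) (hR : 0 < R)
    (hα : 0 < α) (h₁ : ∀ᶠ x in 𝓝 x₀, DifferentiableAt ℝ u₁ x ∧
      ‖fderiv ℝ u₁ x - fderiv ℝ u₁ x₀‖ ≤ H * ‖x - x₀‖ ^ α)
    (h₂ : ∀ᶠ x in 𝓝 x₀, DifferentiableAt ℝ u₂ x ∧
      ‖fderiv ℝ u₂ x - fderiv ℝ u₂ x₀‖ ≤ H * ‖x - x₀‖ ^ α)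
    (hle : ∀ᶠ x in 𝓝 x₀, u₁ x ≤ u₂ x) (heq : u₁ x₀ = u₂ x₀)
    (hlt : ∀ x ∈ Metric.ball (x₀ + R • N) R, u₁ x < u₂ x)
    (hs : ∀ x ∈ Metric.ball (x₀ + R • N) R, SolvesAt G Q s k₁ u₁ x ∧ SolvesAt G Q s k₂ u₂ x) :
    False := by
  set p := fderiv ℝ u₁ x₀ with hp
  -- Ordered functions that touch are tangent: `x₀` is a minimum of the difference.
  have hp₂ : fderiv ℝ u₂ x₀ = p := by
    have hmin : IsLocalMin (fun x => u₂ x - u₁ x) x₀ := by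
      filter_upwards [hle] with x hx
      rw [heq, sub_self]; linarith
    have h0 := hmin.fderiv_eq_zero
    rw [fderiv_fun_sub h₂.self_of_nhds.1 h₁.self_of_nhds.1] at h0
    exact sub_eq_zero.1 h0
  rw [hp₂] at h₂
  obtain ⟨a, ha, ha1, hstep⟩ := hopf_step (x₀ := x₀) (z₀ := u₁ x₀) (p := p) hreg k₂
  -- Per step the slope of the lower bound loses the factor `a`, and the Hölder bound on the slope
  -- gains `τ ^ α`; the latter is made smaller by a factor two.
  obtain ⟨τ, hτ, hτ1, hτa⟩ : ∃ τ : ℝ, 0 < τ ∧ τ ≤ 1 ∧ τ ^ α ≤ a / 2 := by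
    refine ⟨(a / 2) ^ (1 / α), by positivity, Real.rpow_le_one (by positivity) (by linarith)
      (by positivity), ?_⟩
    rw [← Real.rpow_mul (by positivity), one_div_mul_cancel hα.ne', Real.rpow_one]
  obtain ⟨r₀, κ₀, hr₀, hκ₀, hstep⟩ := hstep τ hτ hτ1
  -- a neighbourhood where everything is controlled
  have hsmall : ∀ᶠ x in 𝓝 x₀, H * ‖x - x₀‖ ^ α ≤ κ₀ := by
    have hc : ContinuousAt (fun x : Rn n => H * ‖x - x₀‖ ^ α) x₀ := by
      refine continuousAt_const.mul (ContinuousAt.rpow_const (by fun_prop) (Or.inr hα.le))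
    refine (hc.eventually_lt_const (u := κ₀) ?_).mono fun x hx => hx.le
    simpa [Real.zero_rpow hα.ne'] using hκ₀
  obtain ⟨ρ, hρ, hgood⟩ := Metric.eventually_nhds_iff_ball.1 (h₁.and (h₂.and (hle.and hsmall)))
  set r := min r₀ (min R (ρ / 3)) with hr
  have hrpos : 0 < r := by positivity
  have hrr₀ : r ≤ r₀ := min_le_left _ _
  have hrR : r ≤ R := (min_le_right _ _).trans (min_le_left _ _)
  have hrρ : 3 * r ≤ ρ := by
    have : r ≤ ρ / 3 := (min_le_right _ _).trans (min_le_right _ _)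
    linarith
  have hballR : ∀ t, 0 < t → t ≤ r → Metric.ball (x₀ + t • N) t ⊆ Metric.ball (x₀ + R • N) R := by
    intro t ht htr
    refine Metric.ball_subset_ball' ?_
    rw [dist_eq_norm]
    have : x₀ + t • N - (x₀ + R • N) = (t - R) • N := by rw [sub_smul]; abel
    rw [this, norm_smul, hN, mul_one, Real.norm_eq_abs, abs_of_nonpos (by linarith)]
    linarith
  have hball3 : ∀ t, 0 < t → t ≤ r → Metric.closedBall (x₀ + t • N) t ⊆ Metric.ball x₀ ρ := by
    intro t ht htr
    refine (Metric.closedBall_subset_ball' (ε₂ := 3 * t) ?_).trans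
      (Metric.ball_subset_ball (by linarith))
    rw [dist_eq_norm, add_sub_cancel_left, norm_smul, hN, mul_one, Real.norm_eq_abs, abs_of_pos ht]
    linarith
  obtain ⟨m, hm, hmid⟩ : ∃ m : ℝ, 0 < m ∧
      ∀ x ∈ Metric.closedBall (x₀ + r • N) (r / 2), m * r ≤ u₂ x - u₁ x := by
    have hsub : Metric.closedBall (x₀ + r • N) (r / 2) ⊆ Metric.ball (x₀ + r • N) r :=
      Metric.closedBall_subset_ball (by linarith)
    have hcont : ContinuousOn (fun x => u₂ x - u₁ x) (Metric.closedBall (x₀ + r • N) (r / 2)) := by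
      intro x hx
      have := hgood x (hball3 r hrpos le_rfl (Metric.ball_subset_closedBall (hsub hx)))
      exact (this.2.1.1.continuousAt.sub this.1.1.continuousAt).continuousWithinAt
    obtain ⟨x, hx, hmin⟩ := (isCompact_closedBall (x₀ + r • N) (r / 2)).exists_isMinOn
      ⟨_, Metric.mem_closedBall_self (by positivity)⟩ hcont
    have hpos := hlt x (hballR r hrpos le_rfl (hsub hx))
    refine ⟨(u₂ x - u₁ x) / r, div_pos (by linarith) hrpos, fun y hy => ?_⟩
    rw [div_mul_cancel₀ _ hrpos.ne']
    exact hmin hy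
  have hτk : ∀ k : ℕ, 0 < τ ^ k * r ∧ τ ^ k * r ≤ r := fun k =>
    ⟨by positivity, mul_le_of_le_one_left hrpos.le (pow_le_one₀ hτ.le hτ1)⟩
  have hiter : ∀ k : ℕ, ∀ x ∈ Metric.closedBall (x₀ + (τ ^ k * r) • N) (τ ^ k * r / 2),
      a ^ k * m * (τ ^ k * r) ≤ u₂ x - u₁ x := by
    intro k
    induction k with
    | zero => simpa using hmid
    | succ k ih =>
      obtain ⟨hpos, hler⟩ := hτk k
      have hb : ∀ x ∈ Metric.ball x₀ (3 * (τ ^ k * r)), x ∈ Metric.ball x₀ ρ := fun x hx =>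
        Metric.ball_subset_ball (by linarith) hx
      have := hstep u₁ u₂ k₁ (τ ^ k * r) (a ^ k * m) κ₀ N hk hpos (hler.trans hrr₀) hκ₀ le_rfl
        (by positivity) hN rfl heq.symm
        (fun x hx => ⟨(hgood x (hb x hx)).1.1, (hgood x (hb x hx)).1.2.trans
          (hgood x (hb x hx)).2.2.2⟩)
        (fun x hx => ⟨(hgood x (hb x hx)).2.1.1, (hgood x (hb x hx)).2.1.2.trans
          (hgood x (hb x hx)).2.2.2⟩)
        (fun x hx => (hgood x (hball3 _ hpos hler hx)).2.2.1)
        (fun x hx => hs x (hballR _ hpos hler hx)) ih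
      intro x hx
      have e : τ ^ (k + 1) * r = τ * (τ ^ k * r) := by ring
      rw [e] at hx ⊢
      have := this x hx
      calc a ^ (k + 1) * m * (τ * (τ ^ k * r)) = a * (a ^ k * m) * (τ * (τ ^ k * r)) := by ring
        _ ≤ _ := this
  have hH : 0 ≤ H := by
    have hx : x₀ + r • N ∈ Metric.ball x₀ ρ := hball3 r hrpos le_rfl
      (Metric.mem_closedBall_self hrpos.le)
    have h := (norm_nonneg _).trans (hgood _ hx).1.2
    rw [add_sub_cancel_left, norm_smul, hN, mul_one, Real.norm_eq_abs, abs_of_pos hrpos] at h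
    exact nonneg_of_mul_nonneg_left h (by positivity)
  -- Tangency at `x₀` with Hölder gradients forces the gap at distance `t` to be of order `t ^ (1 +
  -- α)`.
  have hupper : ∀ t, 0 < t → t ≤ r →
      u₂ (x₀ + t • N) - u₁ (x₀ + t • N) ≤ 2 * (H * (3 * t) ^ α) * t := by
    intro t ht htr
    have hb : ∀ x ∈ Metric.ball x₀ (3 * t), x ∈ Metric.ball x₀ ρ ∧
        H * ‖x - x₀‖ ^ α ≤ H * (3 * t) ^ α := fun x hx => by
      refine ⟨Metric.ball_subset_ball (by linarith) hx, mul_le_mul_of_nonneg_left ?_ hH⟩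
      rw [mem_ball_iff_norm] at hx
      exact Real.rpow_le_rpow (norm_nonneg _) hx.le hα.le
    have hm1 : x₀ ∈ Metric.ball x₀ (3 * t) := Metric.mem_ball_self (by positivity)
    have hnorm : ‖x₀ + t • N - x₀‖ = t := by
      rw [add_sub_cancel_left, norm_smul, hN, mul_one, Real.norm_eq_abs, abs_of_pos ht]
    have hm2 : x₀ + t • N ∈ Metric.ball x₀ (3 * t) := by
      rw [mem_ball_iff_norm, hnorm]; linarith
    have l1 := (abs_le.1 (lipschitz_sub_linear (κ := H * (3 * t) ^ α) (fun x hx =>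
      ⟨(hgood x (hb x hx).1).1.1, (hgood x (hb x hx).1).1.2.trans (hb x hx).2⟩) _ hm2 _ hm1)).1
    have l2 := (abs_le.1 (lipschitz_sub_linear (κ := H * (3 * t) ^ α) (fun x hx =>
      ⟨(hgood x (hb x hx).1).2.1.1, (hgood x (hb x hx).1).2.1.2.trans (hb x hx).2⟩) _ hm2 _ hm1)).2
    rw [hnorm] at l1 l2
    linarith
  -- At distance `τ ^ k * r` the two bounds give `a ^ k * m ≤ (a / 2) ^ k * C`, with `C` independent
  -- of `k`, which fails for large `k`.
  have hbound : ∀ k : ℕ, m * 2 ^ k ≤ 2 * (H * (3 * r) ^ α) := by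
    intro k
    obtain ⟨hpos, hler⟩ := hτk k
    have h1 := hiter k _ (Metric.mem_closedBall_self (by positivity))
    have h2 := le_of_mul_le_mul_right (h1.trans (hupper _ hpos hler)) hpos
    have h3 : (3 * (τ ^ k * r)) ^ α = (τ ^ α) ^ k * (3 * r) ^ α := by
      rw [← Real.rpow_natCast (τ ^ α) k, ← Real.rpow_mul hτ.le, mul_comm α, Real.rpow_mul hτ.le,
        Real.rpow_natCast, ← Real.mul_rpow (by positivity) (by positivity)]
      ring_nf
    have h4 : (τ ^ α) ^ k ≤ (a / 2) ^ k := pow_le_pow_left₀ (by positivity) hτa k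
    have h5 : a ^ k * m ≤ (a / 2) ^ k * (2 * (H * (3 * r) ^ α)) := by
      refine h2.trans ?_
      rw [h3]
      have : 0 ≤ 2 * (H * (3 * r) ^ α) := by positivity
      calc 2 * (H * ((τ ^ α) ^ k * (3 * r) ^ α)) = (τ ^ α) ^ k * (2 * (H * (3 * r) ^ α)) := by ring
        _ ≤ _ := mul_le_mul_of_nonneg_right h4 this
    have h6 : a ^ k * (m * 2 ^ k) ≤ a ^ k * (2 * (H * (3 * r) ^ α)) := by
      calc a ^ k * (m * 2 ^ k) = (a ^ k * m) * 2 ^ k := by ring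
        _ ≤ (a / 2) ^ k * (2 * (H * (3 * r) ^ α)) * 2 ^ k :=
            mul_le_mul_of_nonneg_right h5 (by positivity)
        _ = (a / 2 * 2) ^ k * (2 * (H * (3 * r) ^ α)) := by rw [mul_pow]; ring
        _ = _ := by rw [div_mul_cancel₀ _ (two_ne_zero)]
    exact le_of_mul_le_mul_left h6 (by positivity)
  obtain ⟨k, hk⟩ := pow_unbounded_of_one_lt (2 * (H * (3 * r) ^ α) / m) (one_lt_two (α := ℝ))
  rw [div_lt_iff₀ hm] at hk
  linarith [hbound k]

/-! ### The splitting `ℝⁿ⁺¹ = ℝⁿ × ℝ` -/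

/-- The projection `(x, t) ↦ x`. -/
noncomputable def base {n : ℕ} : Rn1 n →L[ℝ] Rn n :=
  LinearMap.toContinuousLinearMap
    { toFun := fun X => WithLp.toLp 2 fun i => X (Fin.castSucc i)
      map_add' := fun _ _ => rfl
      map_smul' := fun _ _ => rfl }

/-- The projection `(x, t) ↦ t`. -/
noncomputable def height {n : ℕ} : Rn1 n →L[ℝ] ℝ :=
  LinearMap.toContinuousLinearMap
    { toFun := fun X => X (Fin.last n)
      map_add' := fun _ _ => rfl
      map_smul' := fun _ _ => rfl }

@[simp] theorem base_pt {n : ℕ} (x : Rn n) (t : ℝ) : base (pt x t) = x := by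
  ext i
  change (Fin.snoc (α := fun _ => ℝ) (fun i => x i) t) (Fin.castSucc i) = x i
  simp

@[simp] theorem height_pt {n : ℕ} (x : Rn n) (t : ℝ) : height (pt x t) = t := by
  change (Fin.snoc (α := fun _ => ℝ) (fun i => x i) t) (Fin.last n) = t
  simp

@[simp] theorem pt_base_height {n : ℕ} (X : Rn1 n) : pt (base X) (height X) = X := by
  ext i
  refine Fin.lastCases ?_ (fun i => ?_) i
  · change (Fin.snoc (α := fun _ => ℝ) (fun i => X (Fin.castSucc i)) (X (Fin.last n))) (Fin.last n) = _
    simp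
  · change (Fin.snoc (α := fun _ => ℝ) (fun i => X (Fin.castSucc i)) (X (Fin.last n)))
      (Fin.castSucc i) = _
    simp

theorem ext_base_height {n : ℕ} {X Y : Rn1 n} (h : base X = base Y) (h' : height X = height Y) :
    X = Y := by
  rw [← pt_base_height X, h, h', pt_base_height]

/-- The linear isomorphism `(x, t) ↦ pt x t`. -/
noncomputable def ptL {n : ℕ} : (Rn n × ℝ) →L[ℝ] Rn1 n :=
  LinearMap.toContinuousLinearMap
    { toFun := fun P => pt P.1 P.2
      map_add' := fun P P' => ext_base_height (by simp) (by simp)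
      map_smul' := fun c P => ext_base_height (by simp) (by simp) }

@[simp] theorem ptL_apply {n : ℕ} (P : Rn n × ℝ) : ptL P = pt P.1 P.2 := rfl

theorem pt_add {n : ℕ} (x y : Rn n) (s t : ℝ) : pt (x + y) (s + t) = pt x s + pt y t :=
  ptL.map_add (x, s) (y, t)

theorem pt_sub {n : ℕ} (x y : Rn n) (s t : ℝ) : pt (x - y) (s - t) = pt x s - pt y t :=
  ptL.map_sub (x, s) (y, t)

theorem pt_smul {n : ℕ} (c : ℝ) (x : Rn n) (s : ℝ) : pt (c • x) (c * s) = c • pt x s :=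
  ptL.map_smul c (x, s)

@[simp] theorem pt_zero {n : ℕ} : pt (0 : Rn n) 0 = 0 := ptL.map_zero

theorem norm_pt_sq {n : ℕ} (x : Rn n) (t : ℝ) : ‖pt x t‖ ^ 2 = ‖x‖ ^ 2 + t ^ 2 := by
  rw [EuclideanSpace.norm_sq_eq, EuclideanSpace.norm_sq_eq, Fin.sum_univ_castSucc]
  congr 1
  · refine Finset.sum_congr rfl fun i _ => ?_
    change ‖(Fin.snoc (α := fun _ => ℝ) (fun i => x i) t) (Fin.castSucc i)‖ ^ 2 = _
    simp
  · change ‖(Fin.snoc (α := fun _ => ℝ) (fun i => x i) t) (Fin.last n)‖ ^ 2 = _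
    simp

theorem norm_base_le {n : ℕ} (X : Rn1 n) : ‖base X‖ ≤ ‖X‖ := by
  have h := norm_pt_sq (base X) (height X)
  rw [pt_base_height] at h
  exact (pow_le_pow_iff_left₀ (norm_nonneg _) (norm_nonneg _) two_ne_zero).1
    (by nlinarith [sq_nonneg (height X)])

theorem continuous_pt {n : ℕ} : Continuous fun P : Rn n × ℝ => pt P.1 P.2 := ptL.continuous

/-! ### The prescribed mean curvature equation for vertical graphs -/

/-- The differential `v ↦ (v, p v)` of a graph with gradient `p`. -/
noncomputable def graphTangent {n : ℕ} (p : Rn n →L[ℝ] ℝ) : Rn n →L[ℝ] Rn1 n :=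
  ptL.comp ((ContinuousLinearMap.id ℝ (Rn n)).prod p)

@[simp] theorem graphTangent_apply {n : ℕ} (p : Rn n →L[ℝ] ℝ) (v : Rn n) :
    graphTangent p v = pt v (p v) := rfl

/-- The covector `(v, t) ↦ t - p v`, which defines the tangent space of a graph. -/
noncomputable def graphConormal {n : ℕ} (p : Rn n →L[ℝ] ℝ) : Rn1 n →L[ℝ] ℝ := height - p.comp base

@[simp] theorem graphConormal_apply {n : ℕ} (p : Rn n →L[ℝ] ℝ) (X : Rn1 n) :
    graphConormal p X = height X - p (base X) := rfl

/-- The upward normal vector `N` of a graph, in the metric `h`, with `h (N, ·) = (-p, 1)`. -/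
noncomputable def graphNormal {n : ℕ} (h : CoordMetric (Rn1 n)) (θ : Jet n) : Rn1 n :=
  (h (pt θ.1 θ.2.1)).inverse (graphConormal θ.2.2)

/-- The Christoffel symbols, as a bilinear form in the first two vectors. -/
noncomputable def christoffelForm {F : Type*} [NormedAddCommGroup F] [NormedSpace ℝ F]
    (h : CoordMetric F) (x a : F) : F →L[ℝ] F →L[ℝ] ℝ :=
  let D : F →L[ℝ] F →L[ℝ] F →L[ℝ] ℝ := fderiv ℝ h x
  let T : F →L[ℝ] F →L[ℝ] ℝ :=
    (ContinuousLinearMap.compL ℝ F (F →L[ℝ] ℝ) ℝ (ContinuousLinearMap.apply ℝ ℝ a)).comp D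
  (1 / 2 : ℝ) • (T + T.flip - D a)

theorem christoffelForm_apply {F : Type*} [NormedAddCommGroup F] [NormedSpace ℝ F]
    (h : CoordMetric F) (x a v w : F) : christoffelForm h x a v w = christoffel h x v w a := by
  simp only [christoffelForm, christoffel, smul_apply, add_apply, sub_apply,
    ContinuousLinearMap.comp_apply, ContinuousLinearMap.flip_apply, smul_eq_mul,
    ContinuousLinearMap.compL_apply, ContinuousLinearMap.apply_apply]
  ring

/-- The first fundamental form of a graph. -/
noncomputable def graphForm {n : ℕ} (h : CoordMetric (Rn1 n)) (θ : Jet n) : Bilin n :=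
  (h (pt θ.1 θ.2.1)).bilinearComp (graphTangent θ.2.2) (graphTangent θ.2.2)

/-- The first order terms of the mean curvature of a graph. -/
noncomputable def graphChristoffel {n : ℕ} (h : CoordMetric (Rn1 n)) (θ : Jet n) : Bilin n :=
  (christoffelForm h (pt θ.1 θ.2.1) (graphNormal h θ)).bilinearComp (graphTangent θ.2.2)
    (graphTangent θ.2.2)

/-- The right hand side of the prescribed mean curvature equation of a graph. -/
noncomputable def graphRhs {n : ℕ} (h : CoordMetric (Rn1 n)) (g : Rn1 n → ℝ) (θ : Jet n) : ℝ :=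
  g (pt θ.1 θ.2.1) * Real.sqrt (h (pt θ.1 θ.2.1) (graphNormal h θ) (graphNormal h θ))

/-- The graph of `u` has at `x` mean curvature `k g`, with respect to the upward normal. -/
def SolvesPMC {n : ℕ} (h : CoordMetric (Rn1 n)) (g : Rn1 n → ℝ) (k : ℝ) (u : Rn n → ℝ) (x : Rn n) :
    Prop :=
  SolvesAt (graphForm h) (graphChristoffel h) (graphRhs h g) k u x

/-- A Riemannian metric `h` of class `C²` and a positive function `g` of class `C¹` on `U`. -/
structure IsPMCData {n : ℕ} (h : CoordMetric (Rn1 n)) (g : Rn1 n → ℝ) (U : Set (Rn1 n)) : Prop where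
  isOpen : IsOpen U
  contDiffOn_metric : ContDiffOn ℝ 2 h U
  symm : ∀ X ∈ U, ∀ v w, h X v w = h X w v
  pos : ∀ X ∈ U, ∀ v, v ≠ 0 → 0 < h X v v
  contDiffOn_fun : ContDiffOn ℝ 1 g U
  fun_pos : ∀ X ∈ U, 0 < g X

theorem contDiff_graphTangent {n : ℕ} {k : WithTop ℕ∞} :
    ContDiff ℝ k (graphTangent : (Rn n →L[ℝ] ℝ) → _) := by
  rw [contDiff_clm_apply_iff]
  intro v
  have : (fun p : Rn n →L[ℝ] ℝ => graphTangent p v) = fun p => ptL (v, p v) := rfl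
  rw [this]
  exact ptL.contDiff.comp (contDiff_const.prodMk (contDiff_id.clm_apply contDiff_const))

theorem contDiff_graphConormal {n : ℕ} {k : WithTop ℕ∞} :
    ContDiff ℝ k (graphConormal : (Rn n →L[ℝ] ℝ) → _) :=
  contDiff_const.sub (contDiff_id.clm_comp contDiff_const)

set_option maxSynthPendingDepth 6 in
theorem contDiffOn_christoffel {E F : Type*} [NormedAddCommGroup E] [NormedSpace ℝ E]
    [NormedAddCommGroup F] [NormedSpace ℝ F] {h : CoordMetric F} {U : Set F} {S : Set E}
    (hU : IsOpen U) (hh : ContDiffOn ℝ 2 h U) {X v w a : E → F} (hX : ContDiffOn ℝ 1 X S)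
    (hXU : ∀ θ ∈ S, X θ ∈ U) (hv : ContDiffOn ℝ 1 v S) (hw : ContDiffOn ℝ 1 w S)
    (ha : ContDiffOn ℝ 1 a S) :
    ContDiffOn ℝ 1 (fun θ => christoffel h (X θ) (v θ) (w θ) (a θ)) S := by
  have h1 : ContDiffOn ℝ 1 (fun θ => fderiv ℝ h (X θ)) S :=
    (hh.fderiv_of_isOpen hU (by norm_num)).comp hX hXU
  exact ((((h1.clm_apply hv).clm_apply hw).clm_apply ha).add
    (((h1.clm_apply hw).clm_apply hv).clm_apply ha) |>.sub
    (((h1.clm_apply ha).clm_apply hv).clm_apply hw) |>.div_const 2)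

namespace IsPMCData

variable {n : ℕ} {h : CoordMetric (Rn1 n)} {g : Rn1 n → ℝ} {U : Set (Rn1 n)}

/-- The metric at a point, as an isomorphism of the space with its dual. -/
noncomputable def toEquiv (H : IsPMCData h g U) {X : Rn1 n} (hX : X ∈ U) :
    Rn1 n ≃L[ℝ] (Rn1 n →L[ℝ] ℝ) :=
  LinearEquiv.toContinuousLinearEquiv (LinearEquiv.ofInjectiveOfFinrankEq (h X : Rn1 n →ₗ[ℝ] _)
    (by
      rw [← LinearMap.ker_eq_bot, LinearMap.ker_eq_bot']
      intro v hv
      by_contra hne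
      have := H.pos X hX v hne
      have h0 : h X v = 0 := hv
      rw [h0] at this
      simp at this)
    (by
      rw [(InnerProductSpace.toDual ℝ (Rn1 n)).toLinearEquiv.finrank_eq]))

theorem coe_toEquiv (H : IsPMCData h g U) {X : Rn1 n} (hX : X ∈ U) :
    (H.toEquiv hX : Rn1 n →L[ℝ] (Rn1 n →L[ℝ] ℝ)) = h X := by
  ext v w
  rfl

/-- `ContinuousLinearMap.inverse` is `0` on maps that are not invertible; positivity of the metric
on `U` makes the inverse genuine here. -/
theorem metric_graphNormal (H : IsPMCData h g U) {θ : Jet n} (hθ : pt θ.1 θ.2.1 ∈ U) :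
    h (pt θ.1 θ.2.1) (graphNormal h θ) = graphConormal θ.2.2 := by
  rw [graphNormal, ← H.coe_toEquiv hθ, ContinuousLinearMap.inverse_equiv]
  exact (H.toEquiv hθ).apply_symm_apply _

/-- The jets over `U`. -/
def jetsOver (n : ℕ) (U : Set (Rn1 n)) : Set (Jet n) := {θ | pt θ.1 θ.2.1 ∈ U}

theorem contDiff_jet_point {k : WithTop ℕ∞} : ContDiff ℝ k fun θ : Jet n => pt θ.1 θ.2.1 :=
  ptL.contDiff.comp (contDiff_fst.prodMk (contDiff_fst.comp contDiff_snd))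

theorem isOpen_jetsOver (H : IsPMCData h g U) : IsOpen (jetsOver n U) :=
  H.isOpen.preimage (contDiff_jet_point (k := 0)).continuous

theorem contDiffOn_graphNormal (H : IsPMCData h g U) :
    ContDiffOn ℝ 2 (graphNormal h) (jetsOver n U) := by
  intro θ hθ
  have h1 : ContDiffAt ℝ 2 (fun θ : Jet n => h (pt θ.1 θ.2.1)) θ :=
    (H.contDiffOn_metric.contDiffAt (H.isOpen.mem_nhds hθ)).comp θ contDiff_jet_point.contDiffAt
  have h2 : ContDiffAt ℝ 2 (ContinuousLinearMap.inverse : (Rn1 n →L[ℝ] (Rn1 n →L[ℝ] ℝ)) → _)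
      (h (pt θ.1 θ.2.1)) := by
    rw [← H.coe_toEquiv hθ]
    exact contDiffAt_map_inverse _
  exact ((h2.comp θ h1).clm_apply (contDiff_graphConormal.contDiffAt.comp θ
    (contDiff_snd.comp contDiff_snd).contDiffAt)).contDiffWithinAt

theorem contDiffOn_tangent_apply (v : Rn n) :
    ContDiffOn ℝ 2 (fun θ : Jet n => graphTangent θ.2.2 v) (jetsOver n U) :=
  ((contDiff_graphTangent.comp (contDiff_snd.comp contDiff_snd)).clm_apply
    contDiff_const).contDiffOn

theorem contDiffOn_metric_comp (H : IsPMCData h g U) :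
    ContDiffOn ℝ 2 (fun θ : Jet n => h (pt θ.1 θ.2.1)) (jetsOver n U) :=
  H.contDiffOn_metric.comp contDiff_jet_point.contDiffOn fun _ hθ => hθ

theorem contDiffOn_graphForm (H : IsPMCData h g U) :
    ContDiffOn ℝ 1 (graphForm h) (jetsOver n U) := by
  rw [contDiffOn_clm_apply]
  intro v
  rw [contDiffOn_clm_apply]
  intro w
  exact ((H.contDiffOn_metric_comp.clm_apply (contDiffOn_tangent_apply v)).clm_apply
    (contDiffOn_tangent_apply w)).of_le (by norm_num)

theorem contDiffOn_graphChristoffel (H : IsPMCData h g U) :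
    ContDiffOn ℝ 1 (graphChristoffel h) (jetsOver n U) := by
  rw [contDiffOn_clm_apply]
  intro v
  rw [contDiffOn_clm_apply]
  intro w
  have hX : ContDiffOn ℝ 1 (fun θ : Jet n => pt θ.1 θ.2.1) (jetsOver n U) :=
    contDiff_jet_point.contDiffOn
  have hv := (contDiffOn_tangent_apply (U := U) v).of_le (show (1 : WithTop ℕ∞) ≤ 2 by norm_num)
  have hw := (contDiffOn_tangent_apply (U := U) w).of_le (show (1 : WithTop ℕ∞) ≤ 2 by norm_num)
  have hN := H.contDiffOn_graphNormal.of_le (show (1 : WithTop ℕ∞) ≤ 2 by norm_num)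
  refine (contDiffOn_christoffel H.isOpen H.contDiffOn_metric hX (fun _ hθ => hθ) hv hw hN).congr
    fun θ _ => ?_
  exact christoffelForm_apply h _ _ _ _

theorem metric_graphNormal_self_pos (H : IsPMCData h g U) {θ : Jet n} (hθ : θ ∈ jetsOver n U) :
    0 < h (pt θ.1 θ.2.1) (graphNormal h θ) (graphNormal h θ) := by
  refine H.pos _ hθ _ fun h0 => ?_
  have h1 := H.metric_graphNormal hθ
  rw [h0, map_zero] at h1
  have h2 := congrArg (fun F : Rn1 n →L[ℝ] ℝ => F (pt 0 1)) h1
  simp at h2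

theorem graphRhs_pos (H : IsPMCData h g U) {θ : Jet n} (hθ : θ ∈ jetsOver n U) :
    0 < graphRhs h g θ :=
  mul_pos (H.fun_pos _ hθ) (Real.sqrt_pos.2 (H.metric_graphNormal_self_pos hθ))

theorem contDiffOn_graphRhs (H : IsPMCData h g U) :
    ContDiffOn ℝ 1 (graphRhs h g) (jetsOver n U) := by
  have hN := H.contDiffOn_graphNormal.of_le (show (1 : WithTop ℕ∞) ≤ 2 by norm_num)
  have hh := H.contDiffOn_metric_comp.of_le (show (1 : WithTop ℕ∞) ≤ 2 by norm_num)
  have hg : ContDiffOn ℝ 1 (fun θ : Jet n => g (pt θ.1 θ.2.1)) (jetsOver n U) :=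
    H.contDiffOn_fun.comp contDiff_jet_point.contDiffOn fun _ hθ => hθ
  exact hg.mul (((hh.clm_apply hN).clm_apply hN).sqrt fun θ hθ =>
    (H.metric_graphNormal_self_pos hθ).ne')

theorem graphTangent_injective (p : Rn n →L[ℝ] ℝ) : Function.Injective (graphTangent p) := by
  intro v w hvw
  have := congrArg base hvw
  simpa using this

theorem graphForm_pos (H : IsPMCData h g U) {θ : Jet n} (hθ : θ ∈ jetsOver n U) {v : Rn n}
    (hv : v ≠ 0) : 0 < graphForm h θ v v :=
  H.pos _ hθ _ fun h0 => hv (graphTangent_injective θ.2.2 (h0.trans (map_zero _).symm))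

/-- The constant is the minimum over the compact unit sphere; homogeneity does the rest. The sphere
is empty when `n = 0`, hence the case distinction. -/
theorem exists_ellipticity {A : Bilin n} (hA : ∀ v, v ≠ 0 → 0 < A v v) :
    ∃ μ : ℝ, 0 < μ ∧ ∀ v, μ * ‖v‖ ^ 2 ≤ A v v := by
  rcases (Metric.sphere (0 : Rn n) 1).eq_empty_or_nonempty with hempty | hne
  · refine ⟨1, one_pos, fun v => ?_⟩
    have hv : v = 0 := by
      by_contra hv
      have : (‖v‖⁻¹ • v) ∈ Metric.sphere (0 : Rn n) 1 := by
        simp [norm_smul, inv_mul_cancel₀ (norm_ne_zero_iff.2 hv)]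
      rw [hempty] at this
      exact this
    simp [hv]
  · have hc : Continuous fun v : Rn n => A v v := by fun_prop
    obtain ⟨v₀, hv₀, hmin⟩ := (isCompact_sphere (0 : Rn n) 1).exists_isMinOn hne hc.continuousOn
    have hv₀' : ‖v₀‖ = 1 := by simpa using hv₀
    refine ⟨A v₀ v₀, hA _ (fun h0 => by simp [h0] at hv₀'), fun v => ?_⟩
    by_cases hv : v = 0
    · simp [hv]
    have hn := norm_ne_zero_iff.2 hv
    have h1 : (‖v‖⁻¹ • v) ∈ Metric.sphere (0 : Rn n) 1 := by
      simp [norm_smul, inv_mul_cancel₀ hn]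
    have h2 : A v₀ v₀ ≤ A (‖v‖⁻¹ • v) (‖v‖⁻¹ • v) := hmin h1
    simp only [map_smul, smul_apply, smul_eq_mul] at h2
    have h3 : A v v = (‖v‖⁻¹ * (‖v‖⁻¹ * A v v)) * ‖v‖ ^ 2 := by field_simp
    rw [h3]
    exact mul_le_mul_of_nonneg_right h2 (sq_nonneg _)

/-- A `C²` metric and a `C¹` function give `C¹` coefficients, which are locally Lipschitz. Half of
the ellipticity constant at `θ₀` survives nearby by continuity. -/
theorem exists_regularCoeffs (H : IsPMCData h g U) {θ₀ : Jet n} (hθ₀ : θ₀ ∈ jetsOver n U) :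
    ∃ L μ b δ, RegularCoeffs (graphForm h) (graphChristoffel h) (graphRhs h g) θ₀ L μ b δ := by
  have hnhds := H.isOpen_jetsOver.mem_nhds hθ₀
  have cG := H.contDiffOn_graphForm.contDiffAt hnhds
  have cQ := H.contDiffOn_graphChristoffel.contDiffAt hnhds
  have cs := H.contDiffOn_graphRhs.contDiffAt hnhds
  obtain ⟨K₁, t₁, ht₁, hK₁⟩ := cG.exists_lipschitzOnWith
  obtain ⟨K₂, t₂, ht₂, hK₂⟩ := cQ.exists_lipschitzOnWith
  obtain ⟨K₃, t₃, ht₃, hK₃⟩ := cs.exists_lipschitzOnWith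
  obtain ⟨μ, hμ, hell⟩ := exists_ellipticity fun v hv => H.graphForm_pos hθ₀ hv
  have e1 : ∀ᶠ θ in 𝓝 θ₀, ‖graphForm h θ - graphForm h θ₀‖ < min 1 (μ / 2) := by
    have := cG.continuousAt.eventually (Metric.ball_mem_nhds _ (show 0 < min 1 (μ / 2) by positivity))
    simpa [dist_eq_norm] using this
  have e2 : ∀ᶠ θ in 𝓝 θ₀, ‖graphChristoffel h θ - graphChristoffel h θ₀‖ < 1 := by
    have := cQ.continuousAt.eventually (Metric.ball_mem_nhds _ one_pos)
    simpa [dist_eq_norm] using this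
  obtain ⟨δ, hδ, hball⟩ := Metric.eventually_nhds_iff_ball.1
    ((eventually_mem_set.2 hnhds).and ((eventually_mem_set.2 ht₁).and ((eventually_mem_set.2 ht₂).and
      ((eventually_mem_set.2 ht₃).and (e1.and e2)))))
  have lip : ∀ {E : Type _} [NormedAddCommGroup E] (f : Jet n → E) (K : NNReal) (t : Set (Jet n)),
      LipschitzOnWith K f t → ∀ θ ∈ t, ∀ θ' ∈ t, K ≤ K₁ + K₂ + K₃ →
      ‖f θ - f θ'‖ ≤ (K₁ + K₂ + K₃ : NNReal) * ‖θ - θ'‖ := by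
    intro E _ f K t hf θ hθ θ' hθ' hK
    have := hf.norm_sub_le hθ hθ'
    exact this.trans (mul_le_mul_of_nonneg_right (by exact_mod_cast hK) (norm_nonneg _))
  refine ⟨(K₁ + K₂ + K₃ : NNReal), μ / 2,
    max (‖graphForm h θ₀‖ + 1) (‖graphChristoffel h θ₀‖ + 1), δ, ?_⟩
  constructor
  · positivity
  · positivity
  · positivity
  · exact hδ
  · intro θ hθ θ' hθ'
    exact lip _ K₁ t₁ hK₁ θ (hball θ hθ).2.1 θ' (hball θ' hθ').2.1 (by
      rw [add_assoc]; exact le_self_add)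
  · intro θ hθ θ' hθ'
    exact lip _ K₂ t₂ hK₂ θ (hball θ hθ).2.2.1 θ' (hball θ' hθ').2.2.1 (by
      rw [add_comm K₁, add_assoc]; exact le_self_add)
  · intro θ hθ θ' hθ'
    exact lip _ K₃ t₃ hK₃ θ (hball θ hθ).2.2.2.1 θ' (hball θ' hθ').2.2.2.1 le_add_self
  · intro θ hθ v w
    exact H.symm _ (hball θ hθ).1 _ _
  · intro θ hθ v
    have h1 := (hball θ hθ).2.2.2.2.1
    have h2 := abs_bilin_le (graphForm h θ - graphForm h θ₀) v
    have h3 : ‖graphForm h θ - graphForm h θ₀‖ * ‖v‖ ^ 2 ≤ μ / 2 * ‖v‖ ^ 2 :=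
      mul_le_mul_of_nonneg_right (h1.le.trans (min_le_right _ _)) (sq_nonneg _)
    have h4 := (abs_le.1 (h2.trans h3)).1
    simp only [sub_apply] at h4
    have := hell v
    linarith
  · intro θ hθ
    refine le_trans ?_ (le_max_left _ _)
    have h1 := (hball θ hθ).2.2.2.2.1.le.trans (min_le_left _ _)
    have := norm_le_insert' (graphForm h θ) (graphForm h θ₀)
    linarith
  · intro θ hθ
    refine le_trans ?_ (le_max_right _ _)
    have h1 := (hball θ hθ).2.2.2.2.2.le
    have := norm_le_insert' (graphChristoffel h θ) (graphChristoffel h θ₀)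
    linarith
  · intro θ hθ
    exact (H.graphRhs_pos (hball θ hθ).1).le

end IsPMCData

/-! ### Densities of sheets -/

theorem normalProj_apply {n : ℕ} (ν w : Rn1 n) :
    normalProj ν w = w - ((‖ν‖ ^ 2)⁻¹ * inner ℝ ν w) • ν := by
  rw [normalProj, Submodule.starProjection_orthogonal_val, Submodule.starProjection_singleton]
  simp [div_eq_inv_mul]

/-- Continuity away from `0` gives the measurability of the tangent plane along a sheet. -/
theorem continuousAt_normalProj {n : ℕ} {ν : Rn1 n} (hν : ν ≠ 0) :
    ContinuousAt (normalProj : Rn1 n → _) ν := by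
  have h : ContinuousOn (normalProj : Rn1 n → _) {ν | ν ≠ 0} := by
    rw [continuousOn_clm_apply]
    intro w
    simp_rw [normalProj_apply]
    have c1 : ContinuousOn (fun ν : Rn1 n => (‖ν‖ ^ 2)⁻¹) {ν | ν ≠ 0} :=
      (continuous_norm.pow 2).continuousOn.inv₀ fun ν hν => pow_ne_zero 2 (norm_ne_zero_iff.2 hν)
    have c2 : Continuous fun ν : Rn1 n => inner ℝ ν w := continuous_id.inner continuous_const
    exact continuousOn_const.sub ((c1.mul c2.continuousOn).smul continuousOn_id)
  exact h.continuousAt (isOpen_ne.mem_nhds hν)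

/-- The area element of the graph of `f`. -/
noncomputable def areaElement {n : ℕ} (f : Rn n → ℝ) (x : Rn n) : ℝ :=
  Real.sqrt (1 + ‖gradient f x‖ ^ 2)

theorem continuousOn_gradient {n : ℕ} {Ω : Set (Rn n)} (hΩ : IsOpen Ω) {f : Rn n → ℝ}
    (hf : ContDiffOn ℝ 1 f Ω) : ContinuousOn (gradient f) Ω := by
  have h := hf.continuousOn_fderiv_of_isOpen hΩ le_rfl
  exact (InnerProductSpace.toDual ℝ (Rn n)).symm.continuous.comp_continuousOn h

theorem continuousOn_areaElement {n : ℕ} {Ω : Set (Rn n)} (hΩ : IsOpen Ω) {f : Rn n → ℝ}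
    (hf : ContDiffOn ℝ 1 f Ω) : ContinuousOn (areaElement f) Ω :=
  ((continuousOn_const.add ((continuousOn_gradient hΩ hf).norm.pow 2))).sqrt

theorem continuousOn_sheet {n : ℕ} {Ω : Set (Rn n)} {f : Rn n → ℝ} (hf : ContinuousOn f Ω)
    (Y : Rn1 n) (T : Rn1 n ≃ₗᵢ[ℝ] Rn1 n) : ContinuousOn (sheet Y T f) Ω :=
  continuousOn_const.add (T.continuous.comp_continuousOn
    (continuous_pt.comp_continuousOn (continuousOn_id.prodMk hf)))

theorem continuousOn_sheetNormal {n : ℕ} {Ω : Set (Rn n)} (hΩ : IsOpen Ω) {f : Rn n → ℝ}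
    (hf : ContDiffOn ℝ 1 f Ω) (T : Rn1 n ≃ₗᵢ[ℝ] Rn1 n) : ContinuousOn (sheetNormal T f) Ω :=
  T.continuous.comp_continuousOn
    (continuous_pt.comp_continuousOn ((continuousOn_gradient hΩ hf).neg.prodMk continuousOn_const))

theorem sheetNormal_ne_zero {n : ℕ} (T : Rn1 n ≃ₗᵢ[ℝ] Rn1 n) (f : Rn n → ℝ) (x : Rn n) :
    sheetNormal T f x ≠ 0 := by
  intro h
  rw [sheetNormal, LinearIsometryEquiv.map_eq_zero_iff] at h
  have := congrArg height h
  simp at this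

/-- The points and the tangent planes of a `C¹` sheet depend measurably on `x`, so the push-forward
that defines the varifold is not the default `0`, and its weight is the area integral. -/
theorem sheetVarifold_weight_apply {n : ℕ} {Ω : Set (Rn n)} (hΩ : IsOpen Ω) {f : Rn n → ℝ}
    (hf : ContDiffOn ℝ 1 f Ω) (Y : Rn1 n) (T : Rn1 n ≃ₗᵢ[ℝ] Rn1 n) {A : Set (Rn1 n)}
    (hA : MeasurableSet A) :
    (sheetVarifold Ω Y T f).map Prod.fst A =
      ∫⁻ x in sheet Y T f ⁻¹' A ∩ Ω, ENNReal.ofReal (areaElement f x) := by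
  set μ := (volume.restrict Ω).withDensity
      (fun x => ENNReal.ofReal (Real.sqrt (1 + ‖gradient f x‖ ^ 2))) with hμ
  have hac : μ ≪ volume.restrict Ω := withDensity_absolutelyContinuous _ _
  have m1 : AEMeasurable (sheet Y T f) μ :=
    ((continuousOn_sheet hf.continuousOn Y T).aemeasurable hΩ.measurableSet).mono_ac hac
  have m2 : AEMeasurable (fun x => normalProj (sheetNormal T f x)) μ := by
    have : ContinuousOn (fun x => normalProj (sheetNormal T f x)) Ω := fun x hx =>
      (continuousAt_normalProj (sheetNormal_ne_zero T f x)).comp_continuousWithinAt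
        (continuousOn_sheetNormal hΩ hf T x hx)
    exact (this.aemeasurable hΩ.measurableSet).mono_ac hac
  rw [sheetVarifold, AEMeasurable.map_map_of_aemeasurable measurable_fst.aemeasurable (m1.prodMk m2)]
  change μ.map (sheet Y T f) A = _
  rw [Measure.map_apply_of_aemeasurable m1 hA, hμ, withDensity_apply', Measure.restrict_restrict']
  · rfl
  · exact hΩ.measurableSet

/-- The linear map `ξ ↦ ξ + c ⟨a, ξ⟩ a` with `|ξ + c ⟨a, ξ⟩ a|² = |ξ|² + ⟨a, ξ⟩²`. -/
theorem exists_linearMap_norm_eq_graph {n : ℕ} (a : Rn n) : ∃ M : Rn n →ₗ[ℝ] Rn n,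
    LinearMap.det M = Real.sqrt (1 + ‖a‖ ^ 2) ∧ ∀ ξ, ‖M ξ‖ = ‖pt ξ (inner ℝ a ξ)‖ := by
  set J := Real.sqrt (1 + ‖a‖ ^ 2) with hJ
  have hJ2 : J ^ 2 = 1 + ‖a‖ ^ 2 := Real.sq_sqrt (by positivity)
  have hJ0 : 0 ≤ J := Real.sqrt_nonneg _
  -- The positive root of `2 * c + c ^ 2 * ‖a‖ ^ 2 = 1`, for which the determinant `1 + c * ‖a‖ ^ 2`
  -- equals `J`.
  set c : ℝ := 1 / (J + 1) with hc
  have hca : c * ‖a‖ ^ 2 = J - 1 := by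
    rw [hc]
    have : ‖a‖ ^ 2 = (J + 1) * (J - 1) := by linear_combination -hJ2
    rw [this]; field_simp
  refine ⟨LinearMap.transvection (innerSL ℝ a : Rn n →ₗ[ℝ] ℝ) (c • a), ?_, fun ξ => ?_⟩
  · rw [LinearMap.transvection.det]
    have : (innerSL ℝ a : Rn n →ₗ[ℝ] ℝ) (c • a) = c * ‖a‖ ^ 2 := by
      rw [map_smul, smul_eq_mul]
      change c * inner ℝ a a = _
      rw [real_inner_self_eq_norm_sq]
    rw [this, hca]; ring
  · have e : LinearMap.transvection (innerSL ℝ a : Rn n →ₗ[ℝ] ℝ) (c • a) ξ =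
        ξ + (inner ℝ a ξ * c) • a := by
      rw [mul_smul]; rfl
    rw [← sq_eq_sq₀ (norm_nonneg _) (norm_nonneg _), norm_pt_sq, e, norm_add_sq_real,
      real_inner_smul_right, norm_smul, mul_pow, Real.norm_eq_abs, sq_abs, real_inner_comm ξ a]
    have : 2 * c + c * (c * ‖a‖ ^ 2) = 1 := by
      rw [hca, hc]; field_simp; ring
    linear_combination (inner ℝ ξ a) ^ 2 * this

/-- The ellipsoid is the projection of a flat disk of radius `c * r` in the hyperplane of slope `a`,
and the factor in front is the Jacobian of the graph. -/
theorem volume_graph_ellipsoid {n : ℕ} (a x₀ : Rn n) {c r : ℝ} (hc : 0 < c) :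
    ENNReal.ofReal (Real.sqrt (1 + ‖a‖ ^ 2)) *
      volume {x : Rn n | ‖pt (x - x₀) (inner ℝ a (x - x₀))‖ < c * r} =
      ENNReal.ofReal (c ^ n) * volume (Metric.ball (0 : Rn n) r) := by
  obtain ⟨M, hdet, hM⟩ := exists_linearMap_norm_eq_graph a
  have hJ : 0 < Real.sqrt (1 + ‖a‖ ^ 2) := Real.sqrt_pos.2 (by positivity)
  have e : {x : Rn n | ‖pt (x - x₀) (inner ℝ a (x - x₀))‖ < c * r} =
      (fun x => x - x₀) ⁻¹' (M ⁻¹' (Metric.ball 0 (c * r))) := by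
    ext x
    simp only [mem_ofPred_eq, mem_preimage, mem_ball_zero_iff, hM]
  have e2 : volume ((fun x => x - x₀) ⁻¹' (M ⁻¹' (Metric.ball (0 : Rn n) (c * r)))) =
      volume (M ⁻¹' (Metric.ball (0 : Rn n) (c * r))) := by
    simp_rw [sub_eq_add_neg]
    exact measure_preimage_add_right _ _ _
  rw [e, e2, Measure.addHaar_preimage_linearMap _ (by rw [hdet]; exact hJ.ne'), hdet,
    Measure.addHaar_ball_mul_of_pos _ _ hc, ← mul_assoc, ← ENNReal.ofReal_mul hJ.le,
    abs_of_pos (inv_pos.2 hJ), mul_inv_cancel₀ hJ.ne']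
  simp

theorem norm_sheet_sub {n : ℕ} (Y : Rn1 n) (T : Rn1 n ≃ₗᵢ[ℝ] Rn1 n) (f : Rn n → ℝ) (x y : Rn n) :
    ‖sheet Y T f x - sheet Y T f y‖ = ‖pt (x - y) (f x - f y)‖ := by
  rw [sheet, sheet, add_sub_add_left_eq_sub, ← map_sub, LinearIsometryEquiv.norm_map, pt_sub]

theorem norm_pt_le_norm_pt {n : ℕ} (x : Rn n) (s t : ℝ) :
    ‖pt x s‖ ≤ ‖pt x t‖ + |s - t| := by
  have h1 : pt x s = pt x t + pt 0 (s - t) := by rw [← pt_add]; simp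
  have h2 : ‖pt (0 : Rn n) (s - t)‖ = |s - t| := by
    rw [← sq_eq_sq₀ (norm_nonneg _) (abs_nonneg _), norm_pt_sq, sq_abs]; simp
  rw [h1, ← h2]
  exact norm_add_le _ _

theorem norm_le_norm_pt {n : ℕ} (x : Rn n) (t : ℝ) : ‖x‖ ≤ ‖pt x t‖ := by
  simpa using norm_base_le (pt x t)

/-- A sheet has density one at its points. -/
theorem sheet_density_one {n : ℕ} {Ω : Set (Rn n)} (hΩ : IsOpen Ω) {f : Rn n → ℝ}
    (hf : ContDiffOn ℝ 1 f Ω) (Y : Rn1 n) (T : Rn1 n ≃ₗᵢ[ℝ] Rn1 n) {x₀ : Rn n} (hx₀ : x₀ ∈ Ω) :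
    Tendsto (fun r : ℝ => (sheetVarifold Ω Y T f).map Prod.fst
      (Metric.ball (sheet Y T f x₀) r) / volume (Metric.ball (0 : Rn n) r)) (𝓝[>] 0) (𝓝 1) := by
  set a := gradient f x₀ with ha
  set J := areaElement f x₀ with hJ
  have hJpos : 0 < J := Real.sqrt_pos.2 (by positivity)
  have hfx : HasFDerivAt f (fderiv ℝ f x₀) x₀ :=
    ((hf.contDiffAt (hΩ.mem_nhds hx₀)).differentiableAt (by simp)).hasFDerivAt
  have hgrad : ∀ ξ, fderiv ℝ f x₀ ξ = inner ℝ a ξ := fun ξ => by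
    rw [ha, gradient, InnerProductSpace.toDual_symm_apply]
  -- On a small ball `f` is within `η * ‖x - x₀‖` of its linear part and its area element within the
  -- factor `1 ± η` of `J`. The part of the sheet in the `r`-ball thus lies between two such
  -- ellipsoids, with `c = (1 ± η)⁻¹`.
  have key : ∀ η : ℝ, 0 < η → η < 1 → ∀ᶠ r in 𝓝[>] (0 : ℝ),
      ENNReal.ofReal ((1 - η) * (1 + η)⁻¹ ^ n) ≤ (sheetVarifold Ω Y T f).map Prod.fst
        (Metric.ball (sheet Y T f x₀) r) / volume (Metric.ball (0 : Rn n) r) ∧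
      (sheetVarifold Ω Y T f).map Prod.fst (Metric.ball (sheet Y T f x₀) r) /
        volume (Metric.ball (0 : Rn n) r) ≤ ENNReal.ofReal ((1 + η) * (1 - η)⁻¹ ^ n) := by
    intro η hη hη1
    have e1 : ∀ᶠ x in 𝓝 x₀, J * (1 - η) ≤ areaElement f x ∧ areaElement f x ≤ J * (1 + η) := by
      have hc := (continuousOn_areaElement hΩ hf).continuousAt (hΩ.mem_nhds hx₀)
      exact ((hc.eventually_const_lt (by nlinarith : J * (1 - η) < J)).and
        (hc.eventually_lt_const (by nlinarith : J < J * (1 + η)))).mono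
        fun x hx => ⟨hx.1.le, hx.2.le⟩
    have e2 := hfx.isLittleO.def hη
    obtain ⟨ρ, hρ, hball⟩ := Metric.eventually_nhds_iff_ball.1
      ((eventually_mem_set.2 (hΩ.mem_nhds hx₀)).and (e1.and e2))
    have hr1 : ∀ᶠ r in 𝓝[>] (0 : ℝ), 0 < r ∧ r < ρ * (1 - η) := by
      have : Ioo 0 (ρ * (1 - η)) ∈ 𝓝[>] (0 : ℝ) :=
        Ioo_mem_nhdsGT (mul_pos hρ (by linarith))
      exact this
    filter_upwards [hr1] with r hr
    obtain ⟨hr0, hrρ⟩ := hr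
    have hρη : ρ * (1 - η) ≤ ρ := by nlinarith
    have hvol0 : volume (Metric.ball (0 : Rn n) r) ≠ 0 := (Metric.measure_ball_pos _ _ hr0).ne'
    have hvolt : volume (Metric.ball (0 : Rn n) r) ≠ ⊤ := measure_ball_lt_top.ne
    rw [sheetVarifold_weight_apply hΩ hf Y T Metric.isOpen_ball.measurableSet]
    set S := sheet Y T f ⁻¹' Metric.ball (sheet Y T f x₀) r ∩ Ω with hS
    have hSmem : ∀ x, x ∈ S ↔ ‖pt (x - x₀) (f x - f x₀)‖ < r ∧ x ∈ Ω := by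
      intro x
      rw [hS, mem_inter_iff, mem_preimage, mem_ball_iff_norm, norm_sheet_sub]
    set E : ℝ → Set (Rn n) := fun c => {x | ‖pt (x - x₀) (inner ℝ a (x - x₀))‖ < c * r} with hE
    have hEmeas : ∀ c, MeasurableSet (E c) := fun c => by
      have hc : Continuous fun x : Rn n => ‖pt (x - x₀) (inner ℝ a (x - x₀))‖ := by
        have : Continuous fun x : Rn n => ((x - x₀, inner ℝ a (x - x₀)) : Rn n × ℝ) := by fun_prop
        exact (continuous_pt.comp this).norm
      exact (isOpen_lt hc continuous_const).measurableSet
    have hclose : ∀ x ∈ Metric.ball x₀ ρ, |(f x - f x₀) - inner ℝ a (x - x₀)| ≤ η * ‖x - x₀‖ := by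
      intro x hx
      have := (hball x hx).2.2
      rwa [hgrad] at this
    have hsub1 : E (1 + η)⁻¹ ⊆ S ∩ Metric.ball x₀ ρ := by
      intro x hx
      have hx' : ‖pt (x - x₀) (inner ℝ a (x - x₀))‖ < (1 + η)⁻¹ * r := hx
      have h1 := norm_le_norm_pt (x - x₀) (inner ℝ a (x - x₀))
      have h2 : (1 + η)⁻¹ * r ≤ r := by
        have : (1 + η)⁻¹ ≤ 1 := inv_le_one_of_one_le₀ (by linarith)
        nlinarith
      have hxb : x ∈ Metric.ball x₀ ρ := by rw [mem_ball_iff_norm]; linarith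
      refine ⟨(hSmem x).2 ⟨?_, (hball x hxb).1⟩, hxb⟩
      have h3 := norm_pt_le_norm_pt (x - x₀) (f x - f x₀) (inner ℝ a (x - x₀))
      have h4 := hclose x hxb
      have h5 : ‖pt (x - x₀) (inner ℝ a (x - x₀))‖ * (1 + η) < r := by
        have := mul_lt_mul_of_pos_right hx' (by linarith : 0 < 1 + η)
        rwa [mul_comm (1 + η)⁻¹ r, mul_assoc, inv_mul_cancel₀ (by linarith), mul_one] at this
      nlinarith
    have hSb : S ⊆ Metric.ball x₀ ρ := by
      intro x hx
      have h1 := norm_le_norm_pt (x - x₀) (f x - f x₀)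
      have h2 := ((hSmem x).1 hx).1
      rw [mem_ball_iff_norm]; linarith
    have hsub2 : S ⊆ E (1 - η)⁻¹ ∩ Metric.ball x₀ ρ := by
      intro x hx
      have hxb := hSb hx
      refine ⟨?_, hxb⟩
      have h2 := ((hSmem x).1 hx).1
      have h3 := norm_pt_le_norm_pt (x - x₀) (inner ℝ a (x - x₀)) (f x - f x₀)
      have h4 := hclose x hxb
      have h1 := norm_le_norm_pt (x - x₀) (inner ℝ a (x - x₀))
      rw [abs_sub_comm] at h4
      have h5 : ‖pt (x - x₀) (inner ℝ a (x - x₀))‖ * (1 - η) < r := by nlinarith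
      change ‖pt (x - x₀) (inner ℝ a (x - x₀))‖ < (1 - η)⁻¹ * r
      rw [mul_comm, ← div_eq_mul_inv, lt_div_iff₀ (by linarith)]
      exact h5
    have hvE : ∀ c, 0 < c → ENNReal.ofReal J * volume (E c) =
        ENNReal.ofReal (c ^ n) * volume (Metric.ball (0 : Rn n) r) := fun c hc =>
      volume_graph_ellipsoid a x₀ hc
    constructor
    · rw [ENNReal.le_div_iff_mul_le (Or.inl hvol0) (Or.inl hvolt)]
      calc ENNReal.ofReal ((1 - η) * (1 + η)⁻¹ ^ n) * volume (Metric.ball (0 : Rn n) r)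
          = ENNReal.ofReal (1 - η) * (ENNReal.ofReal ((1 + η)⁻¹ ^ n) *
              volume (Metric.ball (0 : Rn n) r)) := by
            rw [ENNReal.ofReal_mul (by linarith), mul_assoc]
        _ = ENNReal.ofReal (J * (1 - η)) * volume (E (1 + η)⁻¹) := by
            rw [← hvE _ (by positivity), ← mul_assoc, ← ENNReal.ofReal_mul (by linarith),
              mul_comm (1 - η)]
        _ = ∫⁻ x in E (1 + η)⁻¹, ENNReal.ofReal (J * (1 - η)) := by
            rw [setLIntegral_const]
        _ ≤ ∫⁻ x in E (1 + η)⁻¹, ENNReal.ofReal (areaElement f x) :=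
            setLIntegral_mono' (hEmeas _) fun x hx =>
              ENNReal.ofReal_le_ofReal (hball x (hsub1 hx).2).2.1.1
        _ ≤ _ := lintegral_mono_set fun x hx => (hsub1 hx).1
    · rw [ENNReal.div_le_iff_le_mul (Or.inl hvol0) (Or.inl hvolt)]
      calc ∫⁻ x in S, ENNReal.ofReal (areaElement f x)
          ≤ ∫⁻ x in E (1 - η)⁻¹ ∩ Metric.ball x₀ ρ, ENNReal.ofReal (areaElement f x) :=
            lintegral_mono_set hsub2
        _ ≤ ∫⁻ x in E (1 - η)⁻¹ ∩ Metric.ball x₀ ρ, ENNReal.ofReal (J * (1 + η)) :=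
            setLIntegral_mono' ((hEmeas _).inter Metric.isOpen_ball.measurableSet) fun x hx =>
              ENNReal.ofReal_le_ofReal (hball x hx.2).2.1.2
        _ ≤ ∫⁻ x in E (1 - η)⁻¹, ENNReal.ofReal (J * (1 + η)) :=
            lintegral_mono_set inter_subset_left
        _ = ENNReal.ofReal (J * (1 + η)) * volume (E (1 - η)⁻¹) := by
            rw [setLIntegral_const]
        _ = ENNReal.ofReal (1 + η) * (ENNReal.ofReal ((1 - η)⁻¹ ^ n) *
              volume (Metric.ball (0 : Rn n) r)) := by
            rw [← hvE _ (inv_pos.2 (by linarith)), ← mul_assoc, ← ENNReal.ofReal_mul (by linarith),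
              mul_comm (1 + η)]
        _ = ENNReal.ofReal ((1 + η) * (1 - η)⁻¹ ^ n) * volume (Metric.ball (0 : Rn n) r) := by
            rw [ENNReal.ofReal_mul (by linarith), mul_assoc]
  have hlim1 : Tendsto (fun η : ℝ => ENNReal.ofReal ((1 - η) * (1 + η)⁻¹ ^ n)) (𝓝[>] 0) (𝓝 1) := by
    have : ContinuousAt (fun η : ℝ => (1 - η) * (1 + η)⁻¹ ^ n) 0 := by
      refine (by fun_prop : ContinuousAt (fun η : ℝ => 1 - η) 0).mul (ContinuousAt.pow ?_ n)
      exact ContinuousAt.inv₀ (by fun_prop) (by norm_num)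
    have h := ENNReal.tendsto_ofReal this.tendsto
    simp only [sub_zero, add_zero, inv_one, one_pow, mul_one, ENNReal.ofReal_one] at h
    exact h.mono_left nhdsWithin_le_nhds
  have hlim2 : Tendsto (fun η : ℝ => ENNReal.ofReal ((1 + η) * (1 - η)⁻¹ ^ n)) (𝓝[>] 0) (𝓝 1) := by
    have : ContinuousAt (fun η : ℝ => (1 + η) * (1 - η)⁻¹ ^ n) 0 := by
      refine (by fun_prop : ContinuousAt (fun η : ℝ => 1 + η) 0).mul (ContinuousAt.pow ?_ n)
      exact ContinuousAt.inv₀ (by fun_prop) (by norm_num)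
    have h := ENNReal.tendsto_ofReal this.tendsto
    simp only [sub_zero, add_zero, inv_one, one_pow, mul_one, ENNReal.ofReal_one] at h
    exact h.mono_left nhdsWithin_le_nhds
  have hη : ∀ᶠ η in 𝓝[>] (0 : ℝ), 0 < η ∧ η < 1 := Ioo_mem_nhdsGT one_pos
  refine tendsto_order.2 ⟨fun l hl => ?_, fun l hl => ?_⟩
  · obtain ⟨η, ⟨h0, h1⟩, h2⟩ := (hη.and (hlim1.eventually_const_lt hl)).exists
    filter_upwards [key η h0 h1] with r hr using h2.trans_le hr.1
  · obtain ⟨η, ⟨h0, h1⟩, h2⟩ := (hη.and (hlim2.eventually_lt_const hl)).exists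
    filter_upwards [key η h0 h1] with r hr using hr.2.trans_lt h2

/-! ### Multiplicities of sums of sheets -/

theorem sheet_eventually_off {n : ℕ} {Ω : Set (Rn n)} (hΩ : IsOpen Ω) {f : Rn n → ℝ}
    (hf : ContinuousOn f Ω) (Y : Rn1 n) (T : Rn1 n ≃ₗᵢ[ℝ] Rn1 n) {x : Rn n} (hx : x ∈ Ω) {t : ℝ}
    (ht : t ≠ f x) : ∃ ε > 0, sheet Y T f ⁻¹' Metric.ball (Y + T (pt x t)) ε ∩ Ω = ∅ := by
  have hc : ContinuousAt f x := hf.continuousAt (hΩ.mem_nhds hx)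
  have hd : 0 < |t - f x| / 2 := by
    have := abs_pos.2 (sub_ne_zero.2 ht); positivity
  obtain ⟨δ, hδ, hδf⟩ := Metric.continuousAt_iff.1 hc (|t - f x| / 2) hd
  refine ⟨min δ (|t - f x| / 2), by positivity, ?_⟩
  rw [eq_empty_iff_forall_notMem]
  rintro y ⟨hy, hyΩ⟩
  rw [mem_preimage, mem_ball_iff_norm, sheet, add_sub_add_left_eq_sub, ← map_sub,
    LinearIsometryEquiv.norm_map, ← pt_sub, lt_min_iff] at hy
  have h1 := (norm_le_norm_pt (y - x) (f y - t)).trans_lt hy.1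
  have h2 : |f y - t| ≤ ‖pt (y - x) (f y - t)‖ := by
    refine (pow_le_pow_iff_left₀ (abs_nonneg _) (norm_nonneg _) two_ne_zero).1 ?_
    rw [norm_pt_sq, sq_abs]
    nlinarith [sq_nonneg ‖y - x‖]
  have h3 := hδf (by rwa [dist_eq_norm])
  rw [Real.dist_eq] at h3
  have h4 : |t - f x| ≤ |f y - t| + |f y - f x| := by
    have : t - f x = -(f y - t) + (f y - f x) := by ring
    rw [this]
    exact (abs_add_le _ _).trans (by rw [abs_neg])
  linarith [hy.2]

theorem sheet_density {n : ℕ} {Ω : Set (Rn n)} (hΩ : IsOpen Ω) {f : Rn n → ℝ}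
    (hf : ContDiffOn ℝ 1 f Ω) (Y : Rn1 n) (T : Rn1 n ≃ₗᵢ[ℝ] Rn1 n) {x : Rn n} (hx : x ∈ Ω) (t : ℝ) :
    Tendsto (fun r : ℝ => (sheetVarifold Ω Y T f).map Prod.fst
      (Metric.ball (Y + T (pt x t)) r) / volume (Metric.ball (0 : Rn n) r)) (𝓝[>] 0)
      (𝓝 (if f x = t then 1 else 0)) := by
  split_ifs with h
  · rw [← h]
    exact sheet_density_one hΩ hf Y T hx
  · obtain ⟨ε, hε, hoff⟩ := sheet_eventually_off hΩ hf.continuousOn Y T hx (Ne.symm h)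
    refine tendsto_const_nhds.congr' ?_
    have : ∀ᶠ r in 𝓝[>] (0 : ℝ), r ∈ Ioo 0 ε := Ioo_mem_nhdsGT hε
    filter_upwards [this] with r hr
    rw [sheetVarifold_weight_apply hΩ hf Y T Metric.isOpen_ball.measurableSet]
    have : sheet Y T f ⁻¹' Metric.ball (Y + T (pt x t)) r ∩ Ω = ∅ := by
      rw [← subset_empty_iff, ← hoff]
      exact inter_subset_inter_left _ (preimage_mono (Metric.ball_subset_ball hr.2.le))
    rw [this]
    simp

theorem map_finset_sum_apply {α β ι : Type*} [MeasurableSpace α] [MeasurableSpace β] (s : Finset ι)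
    (μ : ι → Measure α) {f : α → β} (hf : Measurable f) {A : Set β} (hA : MeasurableSet A) :
    (∑ i ∈ s, μ i).map f A = ∑ i ∈ s, (μ i).map f A := by
  rw [Measure.map_apply hf hA, Measure.finsetSum_apply]
  exact Finset.sum_congr rfl fun i _ => (Measure.map_apply hf hA).symm

/-- A function of multiplicity `0` is a placeholder and carries no regularity. -/
theorem sum_sheet_density {n : ℕ} {ι : Type*} [Fintype ι] {Ω : Set (Rn n)} (hΩ : IsOpen Ω)
    (f : ι → Rn n → ℝ) (m : ι → ℕ) (hf : ∀ i, m i ≠ 0 → ContDiffOn ℝ 1 (f i) Ω) (Y : Rn1 n)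
    (T : Rn1 n ≃ₗᵢ[ℝ] Rn1 n) {x : Rn n} (hx : x ∈ Ω) (t : ℝ) :
    Tendsto (fun r : ℝ => (∑ i, m i • sheetVarifold Ω Y T (f i)).map Prod.fst
      (Metric.ball (Y + T (pt x t)) r) / volume (Metric.ball (0 : Rn n) r)) (𝓝[>] 0)
      (𝓝 ((∑ i, if f i x = t then m i else 0 : ℕ) : ℝ≥0∞)) := by
  have h1 : ∀ i, Tendsto (fun r : ℝ => (m i : ℝ≥0∞) * ((sheetVarifold Ω Y T (f i)).map Prod.fst
      (Metric.ball (Y + T (pt x t)) r) / volume (Metric.ball (0 : Rn n) r))) (𝓝[>] 0)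
      (𝓝 (((if f i x = t then m i else 0 : ℕ) : ℝ≥0∞))) := by
    intro i
    by_cases hm : m i = 0
    · simp [hm]
    · have := ENNReal.Tendsto.const_mul (a := (m i : ℝ≥0∞)) (sheet_density hΩ (hf i hm) Y T hx t)
        (Or.inr (ENNReal.natCast_ne_top _))
      convert this using 2
      split_ifs <;> simp
  have h2 := tendsto_finsetSum Finset.univ fun i _ => h1 i
  push_cast at h2 ⊢
  refine h2.congr fun r => ?_
  rw [map_finset_sum_apply _ _ measurable_fst Metric.isOpen_ball.measurableSet]
  simp_rw [div_eq_mul_inv, Finset.sum_mul]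
  refine Finset.sum_congr rfl fun i _ => ?_
  rw [← mul_assoc, Measure.map_apply measurable_fst Metric.isOpen_ball.measurableSet,
    Measure.map_apply measurable_fst Metric.isOpen_ball.measurableSet, Measure.smul_apply,
    nsmul_eq_mul]

theorem isOpen_unitBall (n : ℕ) : IsOpen (unitBall n) := Metric.isOpen_ball

/-- The number of sheets through `(x, t)`. -/
noncomputable def sheetCount {n q : ℕ} (u : Fin q → Rn n → ℝ) (x : Rn n) (t : ℝ) : ℕ :=
  (Finset.univ.filter fun j => u j x = t).card

theorem sum_graphVarifold_eq {n q : ℕ} (u : Fin q → Rn n → ℝ) (Ω : Set (Rn n)) :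
    ∑ j, graphVarifold Ω (u j) =
      ∑ j, (1 : ℕ) • sheetVarifold Ω 0 (LinearIsometryEquiv.refl ℝ (Rn1 n)) (u j) := by
  simp [graphVarifold]

section

variable {n q : ℕ} {V : Varifold n (cylinderOver (unitBall n))} {u : Fin q → Rn n → ℝ}

/-- The bridge from measures to combinatorics: from here on densities are numbers of sheets. -/
theorem hasDensity_sheetCount (hu : ∀ j, ContDiffOn ℝ 1 (u j) (unitBall n))
    (hV : V.measure = ∑ j, graphVarifold (unitBall n) (u j)) {x : Rn n} (hx : x ∈ unitBall n)
    (t : ℝ) : V.HasDensity (pt x t) (sheetCount u x t) := by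
  have h := sum_sheet_density (isOpen_unitBall n) u (fun _ => 1) (fun i _ => hu i) 0
    (LinearIsometryEquiv.refl ℝ (Rn1 n)) hx t
  rw [← sum_graphVarifold_eq, ← hV] at h
  simp only [LinearIsometryEquiv.coe_refl, id_eq, zero_add] at h
  rw [Varifold.HasDensity, sheetCount, Finset.card_filter]
  exact h

theorem hasDensity_unique {O : Set (Rn1 n)} {V : Varifold n O} {X : Rn1 n} {a b : ℝ≥0∞}
    (ha : V.HasDensity X a) (hb : V.HasDensity X b) : a = b :=
  tendsto_nhds_unique ha hb

/-- A point off all the graphs has a ball that meets none of them, and a point on a graph has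
density at least one. -/
theorem mem_spt_iff (hu : ∀ j, ContDiffOn ℝ 1 (u j) (unitBall n))
    (hV : V.measure = ∑ j, graphVarifold (unitBall n) (u j)) (X : Rn1 n) :
    X ∈ V.spt ↔ ∃ x ∈ unitBall n, ∃ j, X = pt x (u j x) := by
  constructor
  · rintro ⟨hX, x, hx, t, rfl⟩
    by_contra! hne
    have hoff : ∀ j, ∃ ε > 0, sheet 0 (LinearIsometryEquiv.refl ℝ (Rn1 n)) (u j) ⁻¹'
        Metric.ball (0 + LinearIsometryEquiv.refl ℝ (Rn1 n) (pt x t)) ε ∩ unitBall n = ∅ := fun j =>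
      sheet_eventually_off (isOpen_unitBall n) (hu j).continuousOn _ _ hx
        fun ht => hne x hx j (by rw [ht])
    choose ε hε hoff using hoff
    obtain ⟨δ, hδ, hδε⟩ : ∃ δ > 0, ∀ j, δ ≤ ε j := by
      rcases isEmpty_or_nonempty (Fin q) with h | h
      · exact ⟨1, one_pos, fun j => h.elim j⟩
      · obtain ⟨j, hj⟩ := Finite.exists_min ε
        exact ⟨ε j, hε j, hj⟩
    have hpos := (Measure.mem_support_iff_forall _).1 hX _ (Metric.ball_mem_nhds _ hδ)
    rw [Varifold.weight, hV, map_finset_sum_apply _ _ measurable_fst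
      Metric.isOpen_ball.measurableSet] at hpos
    have hzero : ∀ j, (graphVarifold (unitBall n) (u j)).map Prod.fst
        (Metric.ball (pt x t) δ) = 0 := by
      intro j
      rw [graphVarifold, sheetVarifold_weight_apply (isOpen_unitBall n) (hu j) _ _
        Metric.isOpen_ball.measurableSet]
      have : sheet 0 (LinearIsometryEquiv.refl ℝ (Rn1 n)) (u j) ⁻¹'
          Metric.ball (pt x t) δ ∩ unitBall n = ∅ := by
        rw [← subset_empty_iff, ← hoff j]
        refine inter_subset_inter_left _ (preimage_mono ?_)
        simpa using Metric.ball_subset_ball (hδε j)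
      rw [this]
      simp
    simp [hzero] at hpos
  · rintro ⟨x, hx, j, rfl⟩
    refine ⟨(Measure.mem_support_iff_forall _).2 fun O hO => ?_, x, hx, _, rfl⟩
    obtain ⟨ε, hε, hball⟩ := Metric.mem_nhds_iff.1 hO
    have hd := hasDensity_sheetCount hu hV hx (u j x)
    have hone : (0 : ℝ≥0∞) < sheetCount u x (u j x) := by
      have : 0 < sheetCount u x (u j x) := Finset.card_pos.2 ⟨j, by simp⟩
      exact_mod_cast this
    have hev := (hd.eventually_const_lt hone).and
      (show ∀ᶠ r in 𝓝[>] (0 : ℝ), r ∈ Ioo 0 ε from Ioo_mem_nhdsGT hε)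
    obtain ⟨r, hr1, hr2⟩ := hev.exists
    have : 0 < V.weight (Metric.ball (pt x (u j x)) r) := by
      by_contra h0
      rw [not_lt, nonpos_iff_eq_zero] at h0
      rw [h0, ENNReal.zero_div] at hr1
      exact lt_irrefl _ hr1
    exact this.trans_le (measure_mono ((Metric.ball_subset_ball hr2.2.le).trans hball))

/-! ### Boxes, and multiplicities in a tilted frame -/

theorem mem_box_iff {Y X : Rn1 n} {T : Rn1 n ≃ₗᵢ[ℝ] Rn1 n} {r s : ℝ} :
    X ∈ box Y T r s ↔ ‖base (T.symm (X - Y))‖ < r ∧ |height (T.symm (X - Y))| < s := by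
  constructor
  · rintro ⟨x, t, hx, ht, rfl⟩
    simpa using ⟨hx, ht⟩
  · rintro ⟨hx, ht⟩
    exact ⟨_, _, hx, ht, by rw [pt_base_height, T.apply_symm_apply, add_sub_cancel]⟩

theorem isOpen_box (Y : Rn1 n) (T : Rn1 n ≃ₗᵢ[ℝ] Rn1 n) (r s : ℝ) : IsOpen (box Y T r s) := by
  have e : box Y T r s = {X | ‖base (T.symm (X - Y))‖ < r} ∩ {X | |height (T.symm (X - Y))| < s} := by
    ext X
    exact mem_box_iff
  have hc : Continuous fun X : Rn1 n => T.symm (X - Y) :=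
    T.symm.continuous.comp (continuous_id.sub continuous_const)
  rw [e]
  exact (isOpen_lt (base.continuous.comp hc).norm continuous_const).inter
    (isOpen_lt (height.continuous.comp hc).abs continuous_const)

/-- In a box in which `V` is a sum of disks, the multiplicities given by the graphs and by the disks
agree. -/
theorem sheetCount_eq_sum {ι : Type*} [Fintype ι] (hu : ∀ j, ContDiffOn ℝ 1 (u j) (unitBall n))
    (hV : V.measure = ∑ j, graphVarifold (unitBall n) (u j)) {Y : Rn1 n}
    {T : Rn1 n ≃ₗᵢ[ℝ] Rn1 n} {r s : ℝ} {f : ι → Rn n → ℝ} {m : ι → ℕ}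
    (hf : ∀ i, m i ≠ 0 → ContDiffOn ℝ 1 (f i) (Metric.ball 0 r))
    (hVY : V.measure.restrict (box Y T r s ×ˢ univ) =
      ∑ i, m i • sheetVarifold (Metric.ball 0 r) Y T (f i))
    {x ξ : Rn n} {t τ : ℝ} (hx : x ∈ unitBall n) (hξ : ‖ξ‖ < r) (hτ : |τ| < s)
    (hX : pt x t = Y + T (pt ξ τ)) :
    sheetCount u x t = ∑ i, if f i ξ = τ then m i else 0 := by
  have h1 := hasDensity_sheetCount hu hV hx t
  have h2 := sum_sheet_density Metric.isOpen_ball f m hf Y T (mem_ball_zero_iff.2 hξ) τ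
  rw [← hVY, ← hX] at h2
  have hbox : pt x t ∈ box Y T r s := ⟨ξ, τ, hξ, hτ, hX⟩
  obtain ⟨ε, hε, hball⟩ := Metric.isOpen_iff.1 (isOpen_box Y T r s) _ hbox
  have h3 : ∀ᶠ ρ in 𝓝[>] (0 : ℝ), ρ ∈ Ioo 0 ε := Ioo_mem_nhdsGT hε
  have h4 : V.HasDensity (pt x t) ((∑ i, if f i ξ = τ then m i else 0 : ℕ) : ℝ≥0∞) := by
    refine h2.congr' ?_
    filter_upwards [h3] with ρ hρ
    congr 1
    have hsub : Metric.ball (pt x t) ρ ⊆ box Y T r s :=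
      (Metric.ball_subset_ball hρ.2.le).trans hball
    rw [Varifold.weight, Measure.map_apply measurable_fst Metric.isOpen_ball.measurableSet,
      Measure.map_apply measurable_fst Metric.isOpen_ball.measurableSet, Measure.restrict_apply
        (measurable_fst Metric.isOpen_ball.measurableSet)]
    congr 1
    ext P
    simp only [mem_inter_iff, mem_preimage, mem_prod, mem_univ, and_true]
    exact ⟨fun h => h.1, fun h => ⟨h, hsub h⟩⟩
  exact_mod_cast hasDensity_unique h1 h4

end

/-! ### Mean curvature of a tilted sheet that is a vertical graph -/

theorem bilin_eq_sum {n : ℕ} (β : Bilin n) (v w : Rn n) :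
    β v w = ∑ i, ∑ j, v i * β (EuclideanSpace.single i 1) (EuclideanSpace.single j 1) * w j := by
  have hv : ∀ v : Rn n, v = ∑ i, v i • EuclideanSpace.single i (1 : ℝ) := fun v => by
    ext j
    simp [Finset.sum_apply, Pi.single_apply]
  conv_lhs => rw [hv v, hv w]
  simp only [map_sum, map_smul, sum_apply, smul_apply, smul_eq_mul, Finset.mul_sum]
  rw [Finset.sum_comm]
  exact Finset.sum_congr rfl fun i _ => Finset.sum_congr rfl fun j _ => by ring

/-- If the columns of `Z` are the frame, then `Zᵀ * M * Z = 1`, so `M⁻¹ = Z * Zᵀ`, and the trace is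
cyclic. This turns the mean curvature into a sum over any orthonormal frame. -/
theorem trace_inv_mul_eq_sum_frame {n : ℕ} (γ β : Bilin n) {ζ : Fin n → Rn n} (h : IsFrame γ ζ) :
    ((Matrix.of fun i j => γ (EuclideanSpace.single i 1) (EuclideanSpace.single j 1))⁻¹ *
      Matrix.of fun i j => β (EuclideanSpace.single i 1) (EuclideanSpace.single j 1)).trace =
      ∑ a, β (ζ a) (ζ a) := by
  set M : Matrix (Fin n) (Fin n) ℝ :=
    Matrix.of fun i j => γ (EuclideanSpace.single i 1) (EuclideanSpace.single j 1) with hM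
  set P : Matrix (Fin n) (Fin n) ℝ :=
    Matrix.of fun i j => β (EuclideanSpace.single i 1) (EuclideanSpace.single j 1) with hP
  set Z : Matrix (Fin n) (Fin n) ℝ := Matrix.of fun i a => ζ a i with hZ
  have key : ∀ (δ : Bilin n) (a b : Fin n), (Z.transpose * (Matrix.of fun i j =>
      δ (EuclideanSpace.single i 1) (EuclideanSpace.single j 1)) * Z) a b = δ (ζ a) (ζ b) := by
    intro δ a b
    rw [bilin_eq_sum]
    simp only [Matrix.mul_apply, Matrix.transpose_apply, hZ, Matrix.of_apply, Finset.sum_mul]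
    rw [Finset.sum_comm]
  have h1 : Z.transpose * M * Z = 1 := by
    ext a b
    rw [hM, key, h a b, Matrix.one_apply]
  have h2 : Z * (Z.transpose * M) = 1 := mul_eq_one_comm.1 h1
  have h3 : M⁻¹ = Z * Z.transpose := Matrix.inv_eq_left_inv (by rw [Matrix.mul_assoc, h2])
  rw [h3, Matrix.mul_assoc, Matrix.trace_mul_comm, hP]
  exact Finset.sum_congr rfl fun a _ => key β a a

theorem fderiv_sheet_apply {n : ℕ} (Y : Rn1 n) (T : Rn1 n ≃ₗᵢ[ℝ] Rn1 n) {f : Rn n → ℝ} {x : Rn n}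
    (hf : DifferentiableAt ℝ f x) (v : Rn n) :
    fderiv ℝ (sheet Y T f) x v = T (pt v (fderiv ℝ f x v)) := by
  have h1 : HasFDerivAt (sheet Y T f)
      ((T.toContinuousLinearEquiv : Rn1 n →L[ℝ] Rn1 n).comp
        (ptL.comp ((ContinuousLinearMap.id ℝ (Rn n)).prod (fderiv ℝ f x)))) x :=
    ((T.toContinuousLinearEquiv : Rn1 n →L[ℝ] Rn1 n).hasFDerivAt.comp x
      ((ptL (n := n)).hasFDerivAt.comp x
        ((hasFDerivAt_id x).prodMk hf.hasFDerivAt))).const_add Y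
  rw [h1.fderiv]
  rfl

theorem contDiffAt_sheet {n : ℕ} (Y : Rn1 n) (T : Rn1 n ≃ₗᵢ[ℝ] Rn1 n) {f : Rn n → ℝ} {x : Rn n}
    {k : WithTop ℕ∞} (hf : ContDiffAt ℝ k f x) : ContDiffAt ℝ k (sheet Y T f) x :=
  contDiffAt_const.add ((T.toContinuousLinearEquiv : Rn1 n →L[ℝ] Rn1 n).contDiff.contDiffAt.comp x
    ((ptL (n := n)).contDiff.contDiffAt.comp x (contDiffAt_id.prodMk hf)))

theorem fderiv_graph {n : ℕ} {d : Rn n → ℝ} {x : Rn n} (hd : DifferentiableAt ℝ d x) :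
    fderiv ℝ (fun y => pt y (d y)) x = graphTangent (fderiv ℝ d x) :=
  ((ptL (n := n)).hasFDerivAt.comp x ((hasFDerivAt_id x).prodMk hd.hasFDerivAt)).fderiv

/-- The derivatives of a graph that is reparametrized from a `C²` immersion. -/
theorem second_deriv_graph {n : ℕ} {d : Rn n → ℝ} {φ : Rn n → Rn n} {S : Rn n → Rn1 n} {x : Rn n}
    (hd : ContDiffAt ℝ 2 d x) (hφ : ContDiffAt ℝ 2 φ x) (hS : ContDiffAt ℝ 2 S (φ x))
    (heq : ∀ᶠ y in 𝓝 x, S (φ y) = pt y (d y)) :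
    (fderiv ℝ S (φ x)).comp (fderiv ℝ φ x) = graphTangent (fderiv ℝ d x) ∧
    ∀ v w, fderiv ℝ (fderiv ℝ S) (φ x) (fderiv ℝ φ x v) (fderiv ℝ φ x w) +
      fderiv ℝ S (φ x) (fderiv ℝ (fderiv ℝ φ) x v w) = pt 0 (fderiv ℝ (fderiv ℝ d) x v w) := by
  have two : (2 : WithTop ℕ∞) ≠ 0 := by norm_num
  have hd' : ∀ᶠ y in 𝓝 x, ContDiffAt ℝ 2 d y := hd.eventually (by simp)
  have hφ' : ∀ᶠ y in 𝓝 x, ContDiffAt ℝ 2 φ y := hφ.eventually (by simp)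
  have hS' : ∀ᶠ y in 𝓝 x, ContDiffAt ℝ 2 S (φ y) :=
    hφ.continuousAt.eventually (hS.eventually (by simp))
  -- The first order identity is kept on a neighbourhood, so that it can be differentiated once
  -- more.
  have h1 : ∀ᶠ y in 𝓝 x,
      (fderiv ℝ S (φ y)).comp (fderiv ℝ φ y) = graphTangent (fderiv ℝ d y) := by
    filter_upwards [heq.eventually_nhds, hd', hφ', hS'] with y h1 h2 h3 h4
    rw [← fderiv_graph (h2.differentiableAt two), ← EventuallyEq.fderiv_eq (f₁ := fun y => S (φ y)) h1]
    exact (fderiv_comp y (h4.differentiableAt two) (h3.differentiableAt two)).symm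
  refine ⟨h1.self_of_nhds, fun v w => ?_⟩
  have dS : DifferentiableAt ℝ (fderiv ℝ S) (φ x) :=
    (hS.fderiv_right (m := 1) (by norm_num)).differentiableAt (by simp)
  have dφ : DifferentiableAt ℝ (fderiv ℝ φ) x :=
    (hφ.fderiv_right (m := 1) (by norm_num)).differentiableAt (by simp)
  have dd : DifferentiableAt ℝ (fderiv ℝ d) x :=
    (hd.fderiv_right (m := 1) (by norm_num)).differentiableAt (by simp)
  have e1 : HasFDerivAt (fun y => fderiv ℝ S (φ y) (fderiv ℝ φ y w)) _ x :=
    (dS.hasFDerivAt.comp x (hφ.differentiableAt two).hasFDerivAt).clm_apply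
      (dφ.hasFDerivAt.clm_apply (hasFDerivAt_const w x))
  have e2 : HasFDerivAt (fun y => ptL (w, fderiv ℝ d y w)) _ x :=
    (ptL (n := n)).hasFDerivAt.comp x ((hasFDerivAt_const w x).prodMk
      (dd.hasFDerivAt.clm_apply (hasFDerivAt_const w x)))
  have e3 : (fun y => fderiv ℝ S (φ y) (fderiv ℝ φ y w)) =ᶠ[𝓝 x]
      fun y => ptL (w, fderiv ℝ d y w) := by
    filter_upwards [h1] with y hy
    exact congrArg (fun A : Rn n →L[ℝ] Rn1 n => A w) hy
  have e4 := congrArg (fun A : Rn n →L[ℝ] Rn1 n => A v) ((e1.congr_of_eventuallyEq e3.symm).unique e2)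
  simpa [add_comm] using e4

namespace IsPMCData

variable {n : ℕ} {h : CoordMetric (Rn1 n)} {g : Rn1 n → ℝ} {U : Set (Rn1 n)}

/-- A unit vector orthogonal to a graph is a multiple of the normal `graphNormal`. -/
theorem unitNormal_graph (H : IsPMCData h g U) {θ : Jet n} (hθ : θ ∈ jetsOver n U) {ν : Rn1 n}
    (horth : ∀ v, h (pt θ.1 θ.2.1) (graphTangent θ.2.2 v) ν = 0)
    (hunit : h (pt θ.1 θ.2.1) ν ν = 1) :
    ∃ c : ℝ, ν = c • graphNormal h θ ∧
      c ^ 2 * h (pt θ.1 θ.2.1) (graphNormal h θ) (graphNormal h θ) = 1 ∧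
      ∀ W, h (pt θ.1 θ.2.1) W ν = c * graphConormal θ.2.2 W := by
  set X := pt θ.1 θ.2.1 with hX
  set N := graphNormal h θ with hN
  have hXU : X ∈ U := hθ
  have hNW : ∀ W, h X N W = graphConormal θ.2.2 W := fun W => by rw [hX, hN, H.metric_graphNormal hθ]
  set c := h X (pt 0 1) ν with hc
  have hW : ∀ W, h X W ν = c * graphConormal θ.2.2 W := by
    intro W
    have e : W = graphTangent θ.2.2 (base W) + graphConormal θ.2.2 W • pt 0 1 := by
      refine ext_base_height ?_ ?_ <;> simp
    conv_lhs => rw [e]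
    rw [map_add, add_apply, horth, map_smul, smul_apply, smul_eq_mul, ← hc]
    ring
  have hν : ν = c • N := by
    by_contra hne
    have h1 := H.pos X hXU (ν - c • N) (sub_ne_zero.2 hne)
    have h2 : h X (ν - c • N) (ν - c • N) =
        h X (ν - c • N) ν - c * h X N (ν - c • N) := by
      conv_lhs => rw [map_sub (h X (ν - c • N)), map_smul (h X (ν - c • N)), smul_eq_mul,
        H.symm X hXU (ν - c • N) N]
    rw [h2, hW, hNW, sub_self] at h1
    exact lt_irrefl _ h1
  refine ⟨c, hν, ?_, hW⟩
  rw [hν] at hunit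
  simp only [map_smul, smul_apply, smul_eq_mul] at hunit
  rw [← hunit]
  ring

/-- The mean curvature of a sheet, expressed by a vertical graph over `ℝⁿ` of which it is a
reparametrization. -/
theorem solvesPMC_of_meanCurvature (H : IsPMCData h g U) {d f : Rn n → ℝ} {φ : Rn n → Rn n}
    {x : Rn n} {Y : Rn1 n} {T : Rn1 n ≃ₗᵢ[ℝ] Rn1 n} {ν : Rn1 n} {ε k : ℝ}
    (hd : ContDiffAt ℝ 2 d x) (hφ : ContDiffAt ℝ 2 φ x) (hf : ContDiffAt ℝ 2 f (φ x))
    (heq : ∀ᶠ y in 𝓝 x, sheet Y T f (φ y) = pt y (d y)) (hU : pt x (d x) ∈ U)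
    (hν : IsUpwardUnitNormal h Y T f (φ x) ν) (hε : ε ^ 2 = 1)
    (hσ : 0 < ε * graphConormal (fderiv ℝ d x) (T (pt 0 1)))
    (hmc : meanCurvature h (sheet Y T f) (φ x) ν = ε * k * g (pt x (d x))) :
    SolvesPMC h g k d x := by
  obtain ⟨hT, hD2⟩ := second_deriv_graph hd hφ (contDiffAt_sheet Y T hf) heq
  have hX : sheet Y T f (φ x) = pt x (d x) := heq.self_of_nhds
  obtain ⟨ho, hu1, hup⟩ := hν
  rw [hX] at ho hu1 hup
  set S := sheet Y T f with hS
  set A := fderiv ℝ φ x with hA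
  set p := fderiv ℝ d x with hp
  have hθ : jet d x ∈ jetsOver n U := hU
  have hTv : ∀ v, fderiv ℝ S (φ x) (A v) = graphTangent p v := fun v => by rw [← hT]; rfl
  obtain ⟨c, hνN, hc2, hc⟩ := H.unitNormal_graph hθ (ν := ν)
    (fun v => by change h (pt x (d x)) (graphTangent p v) ν = 0; rw [← hTv]; exact ho _) hu1
  set N := graphNormal h (jet d x) with hN
  change ∀ W, h (pt x (d x)) W ν = c * graphConormal p W at hc
  change c ^ 2 * h (pt x (d x)) N N = 1 at hc2
  set X := pt x (d x) with hXdef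
  have hNN : 0 < h X N N := H.metric_graphNormal_self_pos hθ
  have hc0 : c ≠ 0 := by rintro rfl; simp at hc2
  -- The sign `ε` records whether the frame's axis points above or below the graph; it converts the
  -- sheet's upward normal into that of the graph.
  have hcε : 0 < ε * c := by
    rw [hc] at hup
    have h1 := mul_pos hσ hup
    have h2 : ε * graphConormal p (T (pt 0 1)) * (c * graphConormal p (T (pt 0 1))) =
      ε * c * graphConormal p (T (pt 0 1)) ^ 2 := by ring
    rw [h2] at h1
    exact pos_of_mul_pos_left h1 (sq_nonneg _)
  have hsq : ε * c * Real.sqrt (h X N N) = 1 := by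
    have h1 : (ε * c * Real.sqrt (h X N N)) ^ 2 = 1 := by
      rw [mul_pow, mul_pow, Real.sq_sqrt hNN.le, hε, one_mul, hc2]
    exact (pow_eq_one_iff_of_nonneg (mul_nonneg hcε.le (Real.sqrt_nonneg _)) two_ne_zero).1 h1
  refine ⟨hd, fun ξ hξ => ?_⟩
  let DS := fderiv ℝ S (φ x)
  let γ : Bilin n := (h X).bilinearComp DS DS
  let D2 : Rn n →L[ℝ] Rn n →L[ℝ] Rn1 n := fderiv ℝ (fderiv ℝ S) (φ x)
  let β : Bilin n := ((ContinuousLinearMap.compL ℝ (Rn n) (Rn1 n) ℝ) ((h X).flip ν)).comp D2 +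
    (christoffelForm h X ν).bilinearComp DS DS
  have hγ : IsFrame γ (fun a => A (ξ a)) := fun a b => by
    rw [← hξ a b]
    change h X (fderiv ℝ S (φ x) (A (ξ a))) (fderiv ℝ S (φ x) (A (ξ b))) = _
    rw [hTv, hTv]
    rfl
  have htr := trace_inv_mul_eq_sum_frame γ β hγ
  have hMC : meanCurvature h S (φ x) ν = ∑ a, β (A (ξ a)) (A (ξ a)) := by
    rw [← htr, meanCurvature, firstFundForm, secondFundForm, hX]
    congr 3
    ext i j
    change _ = h X (D2 _ _) ν + christoffelForm h X ν _ _
    rw [christoffelForm_apply]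
    rfl
  have hβ : ∀ v, β (A v) (A v) = c * (fderiv ℝ (fderiv ℝ d) x v v +
      graphChristoffel h (jet d x) v v) := by
    intro v
    have e1 : β (A v) (A v) = h X (D2 (A v) (A v)) ν +
        christoffel h X (graphTangent p v) (graphTangent p v) ν := by
      rw [← christoffelForm_apply, ← hTv]
      rfl
    -- The second derivative of the reparametrization only contributes a tangential vector, which
    -- the pairing with `ν` removes.
    have e2 : D2 (A v) (A v) = pt 0 (fderiv ℝ (fderiv ℝ d) x v v) -
        fderiv ℝ S (φ x) (fderiv ℝ (fderiv ℝ φ) x v v) := eq_sub_of_add_eq (hD2 v v)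
    have e3 : graphChristoffel h (jet d x) v v =
        christoffel h X (graphTangent p v) (graphTangent p v) N := by
      rw [← christoffelForm_apply]
      rfl
    have e4 : christoffel h X (graphTangent p v) (graphTangent p v) (c • N) =
        c * christoffel h X (graphTangent p v) (graphTangent p v) N := by
      simp only [christoffel, map_smul, smul_apply, smul_eq_mul]
      ring
    rw [e1, e2, map_sub, sub_apply, ho, hc, hνN, e4, e3]
    simp
    ring
  change ∑ a, (fderiv ℝ (fderiv ℝ d) x (ξ a) (ξ a) + graphChristoffel h (jet d x) (ξ a) (ξ a)) =
    k * (g X * Real.sqrt (h X N N))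
  rw [hMC, Finset.sum_congr rfl fun a _ => hβ (ξ a), ← Finset.mul_sum] at hmc
  have h5 : c * ∑ a, (fderiv ℝ (fderiv ℝ d) x (ξ a) (ξ a) +
      graphChristoffel h (jet d x) (ξ a) (ξ a)) = c * (k * (g X * Real.sqrt (h X N N))) := by
    rw [hmc]
    linear_combination (-(k * g X * ε)) * hsq + (c * k * g X * Real.sqrt (h X N N)) * hε
  exact mul_left_cancel₀ hc0 h5

end IsPMCData

/-! ### Tilted sheets as vertical graphs -/

section Vertical

variable {n : ℕ} {Y : Rn1 n} {T : Rn1 n ≃ₗᵢ[ℝ] Rn1 n}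

/-- The base coordinate of the point `(x, t)` in the frame `(Y, T)`. -/
noncomputable def frameBase (Y : Rn1 n) (T : Rn1 n ≃ₗᵢ[ℝ] Rn1 n) (P : Rn n × ℝ) : Rn n :=
  base (T.symm (pt P.1 P.2 - Y))

/-- The height of the point `(x, t)` in the frame `(Y, T)`. -/
noncomputable def frameHeight (Y : Rn1 n) (T : Rn1 n ≃ₗᵢ[ℝ] Rn1 n) (P : Rn n × ℝ) : ℝ :=
  height (T.symm (pt P.1 P.2 - Y))

/-- The function whose zero set is the sheet of `f`. -/
noncomputable def sheetFun (Y : Rn1 n) (T : Rn1 n ≃ₗᵢ[ℝ] Rn1 n) (f : Rn n → ℝ) (P : Rn n × ℝ) :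
    ℝ :=
  frameHeight Y T P - f (frameBase Y T P)

theorem pt_eq_frame (P : Rn n × ℝ) :
    pt P.1 P.2 = Y + T (pt (frameBase Y T P) (frameHeight Y T P)) := by
  rw [frameBase, frameHeight, pt_base_height, T.apply_symm_apply, add_sub_cancel]

theorem sheet_of_sheetFun_eq_zero {f : Rn n → ℝ} {P : Rn n × ℝ} (h : sheetFun Y T f P = 0) :
    sheet Y T f (frameBase Y T P) = pt P.1 P.2 := by
  rw [pt_eq_frame (Y := Y) (T := T) P, sheet, sub_eq_zero.1 h]

/-- The linear part of the affine map `frameBase`. -/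
noncomputable def frameBaseL (T : Rn1 n ≃ₗᵢ[ℝ] Rn1 n) : (Rn n × ℝ) →L[ℝ] Rn n :=
  base.comp ((T.symm.toContinuousLinearEquiv : Rn1 n →L[ℝ] Rn1 n).comp ptL)

/-- The linear part of the affine map `frameHeight`. -/
noncomputable def frameHeightL (T : Rn1 n ≃ₗᵢ[ℝ] Rn1 n) : (Rn n × ℝ) →L[ℝ] ℝ :=
  height.comp ((T.symm.toContinuousLinearEquiv : Rn1 n →L[ℝ] Rn1 n).comp ptL)

theorem frameBase_eq (Y : Rn1 n) (T : Rn1 n ≃ₗᵢ[ℝ] Rn1 n) :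
    frameBase Y T = fun P => frameBaseL T P - base (T.symm Y) := by
  funext P
  rw [frameBase, map_sub, map_sub]
  rfl

theorem frameHeight_eq (Y : Rn1 n) (T : Rn1 n ≃ₗᵢ[ℝ] Rn1 n) :
    frameHeight Y T = fun P => frameHeightL T P - height (T.symm Y) := by
  funext P
  rw [frameHeight, map_sub, map_sub]
  rfl

theorem contDiff_frameBase {k : WithTop ℕ∞} : ContDiff ℝ k (frameBase Y T) := by
  rw [frameBase_eq]
  exact (frameBaseL T).contDiff.sub contDiff_const

theorem contDiff_frameHeight {k : WithTop ℕ∞} : ContDiff ℝ k (frameHeight Y T) := by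
  rw [frameHeight_eq]
  exact (frameHeightL T).contDiff.sub contDiff_const

@[simp] theorem frameBase_self (x : Rn n) (z : ℝ) : frameBase (pt x z) T (x, z) = 0 := by
  simp [frameBase]

@[simp] theorem frameHeight_self (x : Rn n) (z : ℝ) : frameHeight (pt x z) T (x, z) = 0 := by
  simp [frameHeight]

theorem contDiffAt_sheetFun {f : Rn n → ℝ} {k : WithTop ℕ∞} {P : Rn n × ℝ}
    (hf : ContDiffAt ℝ k f (frameBase Y T P)) : ContDiffAt ℝ k (sheetFun Y T f) P :=
  contDiff_frameHeight.contDiffAt.sub (hf.comp P contDiff_frameBase.contDiffAt)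

theorem fderiv_sheetFun {f : Rn n → ℝ} {P : Rn n × ℝ}
    (hf : DifferentiableAt ℝ f (frameBase Y T P)) :
    fderiv ℝ (sheetFun Y T f) P =
      frameHeightL T - (fderiv ℝ f (frameBase Y T P)).comp (frameBaseL T) := by
  have h1 : HasFDerivAt (frameBase Y T) (frameBaseL T) P := by
    rw [frameBase_eq]
    exact (frameBaseL T).hasFDerivAt.sub_const _
  have h2 : HasFDerivAt (frameHeight Y T) (frameHeightL T) P := by
    rw [frameHeight_eq]
    exact (frameHeightL T).hasFDerivAt.sub_const _
  exact (h2.sub (hf.hasFDerivAt.comp P h1)).fderiv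

/-- A covector that vanishes on the tangent space of a sheet is a multiple of the differential of
the defining function of the sheet. -/
theorem covector_eq_of_tangent {w : Rn1 n →L[ℝ] ℝ} {a : Rn n →L[ℝ] ℝ}
    (hω : ∀ v, w (T (pt v (a v))) = 0) (P : Rn n × ℝ) :
    w (pt P.1 P.2) = (frameHeightL T P - a (frameBaseL T P)) * w (T (pt 0 1)) := by
  have e : pt P.1 P.2 = T (pt (frameBaseL T P) (a (frameBaseL T P))) +
      (frameHeightL T P - a (frameBaseL T P)) • T (pt 0 1) := by
    rw [← map_smul, ← map_add, ← pt_smul, ← pt_add]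
    simp only [smul_zero, mul_one, add_zero, add_sub_cancel]
    change _ = T (pt (base (T.symm (pt P.1 P.2))) (height (T.symm (pt P.1 P.2))))
    rw [pt_base_height, T.apply_symm_apply]
  conv_lhs => rw [e]
  rw [map_add, hω, map_smul, smul_eq_mul, zero_add]

variable {f : Rn n → ℝ} {x : Rn n} {z : ℝ} {p : Rn n →L[ℝ] ℝ}

/-- The vertical derivative of the sheet's defining function is the inverse of the conormal's value
on the frame's axis. In particular it is not zero, which is what the implicit function theorem asks
for. -/
theorem conormal_vertical_mul
    (hω : ∀ v, graphConormal p (T (pt v (fderiv ℝ f 0 v))) = 0) :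
    (frameHeightL T (0, 1) - fderiv ℝ f 0 (frameBaseL T (0, 1))) *
      graphConormal p (T (pt 0 1)) = 1 := by
  have := covector_eq_of_tangent hω (0, 1)
  simpa using this.symm

theorem conormal_vertical_ne_zero
    (hω : ∀ v, graphConormal p (T (pt v (fderiv ℝ f 0 v))) = 0) :
    graphConormal p (T (pt 0 1)) ≠ 0 :=
  right_ne_zero_of_mul_eq_one (conormal_vertical_mul hω)

/-- A sheet whose tangent space is not vertical is the graph of a function. -/
theorem exists_verticalGraph (hf : ContDiffAt ℝ 2 f 0) (hf0 : f 0 = 0)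
    (hω : ∀ v, graphConormal p (T (pt v (fderiv ℝ f 0 v))) = 0) :
    ∃ d : Rn n → ℝ, ContDiffAt ℝ 2 d x ∧ d x = z ∧ fderiv ℝ d x = p ∧
      ∀ᶠ P in 𝓝 (x, z), sheetFun (pt x z) T f P = 0 ↔ d P.1 = P.2 := by
  have two : (2 : WithTop ℕ∞) ≠ 0 := by norm_num
  have hf' : ContDiffAt ℝ 2 f (frameBase (pt x z) T (x, z)) := by rwa [frameBase_self]
  have hF := contDiffAt_sheetFun (Y := pt x z) (T := T) hf'
  have hF0 : sheetFun (pt x z) T f (x, z) = 0 := by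
    rw [sheetFun, frameBase_self, frameHeight_self, hf0, sub_zero]
  have hDF := fderiv_sheetFun (Y := pt x z) (T := T) (hf'.differentiableAt two)
  rw [frameBase_self] at hDF
  have hmul := conormal_vertical_mul hω
  have hinv : (fderiv ℝ (sheetFun (pt x z) T f) (x, z) ∘L .inr ℝ (Rn n) ℝ).IsInvertible := by
    set a := frameHeightL T (0, 1) - fderiv ℝ f 0 (frameBaseL T (0, 1)) with ha
    refine ⟨ContinuousLinearEquiv.unitsEquivAut ℝ (Units.mk0 a (left_ne_zero_of_mul_eq_one hmul)), ?_⟩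
    ext
    simp [hDF, ha]
  refine ⟨hF.implicitFunction two hinv, hF.contDiffAt_implicitFunction two hinv,
    hF.implicitFunction_apply_self two hinv, ?_, ?_⟩
  · set d := hF.implicitFunction two hinv with hd
    have hdx : d x = z := hF.implicitFunction_apply_self two hinv
    have hdd : DifferentiableAt ℝ d x :=
      (hF.contDiffAt_implicitFunction two hinv).differentiableAt two
    have h0 : (fun y => sheetFun (pt x z) T f (y, d y)) =ᶠ[𝓝 x] fun _ => (0 : ℝ) := by
      filter_upwards [hF.eventually_apply_implicitFunction two hinv] with y hy
      rw [hd, hy, hF0]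
    have hFd : HasFDerivAt (sheetFun (pt x z) T f)
        (frameHeightL T - (fderiv ℝ f 0).comp (frameBaseL T)) ((fun y => (y, d y)) x) := by
      have := (hF.differentiableAt two).hasFDerivAt
      rw [hDF] at this
      simpa only [hdx] using this
    have h1 := hFd.comp x ((hasFDerivAt_id x).prodMk hdd.hasFDerivAt)
    have h2 := h1.unique ((hasFDerivAt_const (0 : ℝ) x).congr_of_eventuallyEq h0)
    ext v
    have h3 := congrArg (fun A : Rn n →L[ℝ] ℝ => A v) h2
    have h4 := covector_eq_of_tangent hω (v, fderiv ℝ d x v)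
    change frameHeightL T (v, fderiv ℝ d x v) - fderiv ℝ f 0 (frameBaseL T (v, fderiv ℝ d x v)) = 0
      at h3
    rw [h3, zero_mul] at h4
    simpa [sub_eq_zero] using h4
  · filter_upwards [hF.eventually_apply_eq_iff_implicitFunction two hinv] with P hP
    rw [← hP, hF0]

/-- The defining function of a sheet is monotone or antitone in the vertical direction. -/
theorem sheetFun_vertical_mono (hf : ContDiffAt ℝ 2 f 0)
    (hω : ∀ v, graphConormal p (T (pt v (fderiv ℝ f 0 v))) = 0) :
    ∀ᶠ Q : (Rn n × ℝ) × (Rn n × ℝ) in 𝓝 ((x, z), (x, z)), Q.1.1 = Q.2.1 →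
      sheetFun (pt x z) T f Q.1 ≤ sheetFun (pt x z) T f Q.2 →
      graphConormal p (T (pt 0 1)) * (Q.1.2 - Q.2.2) ≤ 0 := by
  have two : (2 : WithTop ℕ∞) ≠ 0 := by norm_num
  have hf' : ContDiffAt ℝ 2 f (frameBase (pt x z) T (x, z)) := by rwa [frameBase_self]
  have hF := contDiffAt_sheetFun (Y := pt x z) (T := T) hf'
  have hDF := fderiv_sheetFun (Y := pt x z) (T := T) (hf'.differentiableAt two)
  rw [frameBase_self] at hDF
  have hmul := conormal_vertical_mul hω
  set σ := graphConormal p (T (pt 0 1)) with hσ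
  have hσ0 : σ ≠ 0 := conormal_vertical_ne_zero hω
  set a := frameHeightL T (0, 1) - fderiv ℝ f 0 (frameBaseL T (0, 1)) with ha
  -- The vertical derivative is `1 / σ`; strict differentiability with half of its size as tolerance
  -- fixes the sign of all nearby vertical differences.
  have hs := (hF.hasStrictFDerivAt two).isLittleO.def
    (show 0 < 1 / (2 * |σ|) by have := abs_pos.2 hσ0; positivity)
  filter_upwards [hs] with Q hQ h1 h2
  obtain ⟨⟨x₁, t₁⟩, ⟨x₂, t₂⟩⟩ := Q
  obtain rfl : x₁ = x₂ := h1
  have e : ((x₁, t₁) : Rn n × ℝ) - (x₁, t₂) = (t₁ - t₂) • ((0 : Rn n), (1 : ℝ)) := by simp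
  simp only [e, map_smul, norm_smul, smul_eq_mul] at hQ
  have hL : fderiv ℝ (sheetFun (pt x z) T f) (x, z) (0, 1) = a := by rw [hDF]; rfl
  have hn : ‖((0 : Rn n), (1 : ℝ))‖ = 1 := by simp [Prod.norm_def]
  rw [hL, hn, mul_one, Real.norm_eq_abs, Real.norm_eq_abs] at hQ
  have h3 : (t₁ - t₂) * a ≤ 1 / (2 * |σ|) * |t₁ - t₂| := by
    have := (abs_le.1 hQ).1
    change sheetFun (pt x z) T f (x₁, t₁) ≤ sheetFun (pt x z) T f (x₁, t₂) at h2
    linarith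
  have hσp : 0 < |σ| := abs_pos.2 hσ0
  have h4 : σ * (t₁ - t₂) = σ ^ 2 * ((t₁ - t₂) * a) := by
    linear_combination (-(σ * (t₁ - t₂))) * hmul
  have h5 : σ ^ 2 * ((t₁ - t₂) * a) ≤ σ ^ 2 * (1 / (2 * |σ|) * |t₁ - t₂|) :=
    mul_le_mul_of_nonneg_left h3 (sq_nonneg _)
  have h6 : σ ^ 2 * (1 / (2 * |σ|) * |t₁ - t₂|) = |σ * (t₁ - t₂)| / 2 := by
    rw [abs_mul, ← sq_abs]
    field_simp
  change σ * (t₁ - t₂) ≤ 0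
  by_contra! hpos
  rw [h6, ← h4, abs_of_pos hpos] at h5
  linarith

/-- Ordered sheets are ordered vertical graphs. -/
theorem verticalGraph_order {f₁ f₂ d₁ d₂ : Rn n → ℝ} (hf₂ : ContDiffAt ℝ 2 f₂ 0)
    (hω : ∀ v, graphConormal p (T (pt v (fderiv ℝ f₂ 0 v))) = 0)
    (hle : ∀ᶠ ξ in 𝓝 0, f₁ ξ ≤ f₂ ξ)
    (hd₁ : ContinuousAt d₁ x) (hd₁z : d₁ x = z) (hd₂ : ContinuousAt d₂ x) (hd₂z : d₂ x = z)
    (h₁ : ∀ᶠ P in 𝓝 (x, z), sheetFun (pt x z) T f₁ P = 0 ↔ d₁ P.1 = P.2)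
    (h₂ : ∀ᶠ P in 𝓝 (x, z), sheetFun (pt x z) T f₂ P = 0 ↔ d₂ P.1 = P.2) :
    ∀ᶠ y in 𝓝 x, graphConormal p (T (pt 0 1)) * (d₁ y - d₂ y) ≤ 0 := by
  have c₁ : Tendsto (fun y => (y, d₁ y)) (𝓝 x) (𝓝 (x, z)) := by
    have : ContinuousAt (fun y => (y, d₁ y)) x := continuousAt_id.prodMk hd₁
    rwa [ContinuousAt, hd₁z] at this
  have c₂ : Tendsto (fun y => (y, d₂ y)) (𝓝 x) (𝓝 (x, z)) := by
    have : ContinuousAt (fun y => (y, d₂ y)) x := continuousAt_id.prodMk hd₂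
    rwa [ContinuousAt, hd₂z] at this
  have cb : Tendsto (fun y => frameBase (pt x z) T (y, d₁ y)) (𝓝 x) (𝓝 0) := by
    have h := (contDiff_frameBase (k := 0) (Y := pt x z) (T := T)).continuous.continuousAt
      (x := (x, z))
    rw [ContinuousAt, frameBase_self] at h
    exact h.comp c₁
  filter_upwards [c₁.eventually h₁, c₂.eventually h₂, cb.eventually hle,
    (c₁.prodMk_nhds c₂).eventually (sheetFun_vertical_mono hf₂ hω)] with y e₁ e₂ e₃ e₄
  refine e₄ rfl ?_
  have z₁ := e₁.2 rfl
  have z₂ := e₂.2 rfl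
  change sheetFun (pt x z) T f₂ (y, d₁ y) ≤ sheetFun (pt x z) T f₂ (y, d₂ y)
  rw [z₂]
  rw [sheetFun] at z₁ ⊢
  linarith

/-- A sheet of mean curvature `k g` is a vertical graph of mean curvature `± k g`. -/
theorem verticalGraph_solvesPMC {h : CoordMetric (Rn1 n)} {g : Rn1 n → ℝ} {U : Set (Rn1 n)}
    (H : IsPMCData h g U) {d : Rn n → ℝ} {r ε k : ℝ} (hr : 0 < r)
    (hf : ContDiffOn ℝ 2 f (Metric.ball 0 r))
    (hmc : HasMeanCurvature h (pt x z) T r f fun X => k * g X) (hU : pt x z ∈ U)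
    (hd : ContDiffAt ℝ 2 d x) (hdz : d x = z) (hdp : fderiv ℝ d x = p)
    (hdf : ∀ᶠ P in 𝓝 (x, z), sheetFun (pt x z) T f P = 0 ↔ d P.1 = P.2)
    (hε : ε ^ 2 = 1) (hσ : 0 < ε * graphConormal p (T (pt 0 1))) :
    ∀ᶠ y in 𝓝 x, SolvesPMC h g (ε * k) d y := by
  have c₁ : ContinuousAt (fun y => (y, d y)) x := continuousAt_id.prodMk hd.continuousAt
  have c₁' : Tendsto (fun y => (y, d y)) (𝓝 x) (𝓝 (x, z)) := by rwa [ContinuousAt, hdz] at c₁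
  have cb : Tendsto (fun y => frameBase (pt x z) T (y, d y)) (𝓝 x) (𝓝 0) := by
    have h := (contDiff_frameBase (k := 0) (Y := pt x z) (T := T)).continuous.continuousAt
      (x := (x, z))
    rw [ContinuousAt, frameBase_self] at h
    exact h.comp c₁'
  have e₁ : ∀ᶠ y in 𝓝 x, frameBase (pt x z) T (y, d y) ∈ Metric.ball 0 r :=
    cb.eventually (Metric.ball_mem_nhds 0 hr)
  have e₂ : ∀ᶠ y in 𝓝 x, sheet (pt x z) T f (frameBase (pt x z) T (y, d y)) = pt y (d y) := by
    filter_upwards [c₁'.eventually hdf] with y hy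
    exact sheet_of_sheetFun_eq_zero (hy.2 rfl)
  have e₃ : ∀ᶠ y in 𝓝 x, pt y (d y) ∈ U := by
    have h1 : ContinuousAt (fun y => pt y (d y)) x := continuous_pt.continuousAt.comp c₁
    refine h1.eventually (H.isOpen.mem_nhds ?_)
    simpa only [hdz] using hU
  have e₄ : ∀ᶠ y in 𝓝 x, ContDiffAt ℝ 2 d y := hd.eventually (by simp)
  have e₅ : ∀ᶠ y in 𝓝 x, 0 < ε * graphConormal (fderiv ℝ d y) (T (pt 0 1)) := by
    have h1 : ContinuousAt (fderiv ℝ d) x :=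
      (hd.fderiv_right (m := 0) (by norm_num)).continuousAt
    have h2 : ContinuousAt (fun y => ε * graphConormal (fderiv ℝ d y) (T (pt 0 1))) x :=
      continuousAt_const.mul (continuousAt_const.sub (h1.clm_apply continuousAt_const))
    refine h2.eventually (lt_mem_nhds ?_)
    simpa only [hdp] using hσ
  filter_upwards [e₁, e₂.eventually_nhds, e₃, e₄, e₅] with y h₁ h₂ h₃ h₄ h₅
  obtain ⟨ν, hν, hνk⟩ := hmc _ h₁
  refine H.solvesPMC_of_meanCurvature h₄
    (contDiff_frameBase.contDiffAt.comp y (contDiffAt_id.prodMk h₄))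
    (hf.contDiffAt (Metric.isOpen_ball.mem_nhds h₁)) h₂ h₃ hν hε h₅ ?_
  have h₂' := h₂.self_of_nhds
  change meanCurvature h (sheet (pt x z) T f) (frameBase (pt x z) T (y, d y)) ν = _
  rw [hνk, h₂']
  linear_combination (-(k * g (pt y (d y)))) * hε

end Vertical

/-! ### Labelling monotone families -/

/-- Give the largest index the largest label that is still available, and induct on the remaining
indices. -/
theorem exists_monotone_labels {q : ℕ} (J : Finset (Fin q)) :
    ∀ m : SignType → ℕ, J.card = ∑ k, m k → ∃ κ : Fin q → SignType,
      (∀ k, (J.filter fun j => κ j = k).card = m k) ∧ ∀ i ∈ J, ∀ j ∈ J, i ≤ j → κ i ≤ κ j := by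
  induction J using Finset.induction_on_max with
  | empty =>
    intro m hm
    refine ⟨fun _ => 0, fun k => ?_, by simp⟩
    have := (Finset.sum_eq_zero_iff.1 hm.symm) k (Finset.mem_univ k)
    simp [this]
  | insert a S ha ih =>
    intro m hm
    have haS : a ∉ S := fun h => lt_irrefl _ (ha a h)
    rw [Finset.card_insert_of_notMem haS] at hm
    have hne : (Finset.univ.filter fun k => m k ≠ 0).Nonempty := by
      by_contra! hemp
      rw [Finset.filter_eq_empty_iff] at hemp
      rw [Finset.sum_eq_zero fun k hk => not_not.1 (hemp hk)] at hm
      omega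
    obtain ⟨k₀, hk₀, hmax⟩ := Finset.exists_max_image _ id hne
    have hk0 : m k₀ ≠ 0 := (Finset.mem_filter.1 hk₀).2
    have hsum : S.card = ∑ k, (if k = k₀ then m k - 1 else m k) := by
      have h1 := Finset.add_sum_erase Finset.univ m (Finset.mem_univ k₀)
      have h2 := Finset.add_sum_erase Finset.univ (fun k => if k = k₀ then m k - 1 else m k)
        (Finset.mem_univ k₀)
      have h3 : ∑ k ∈ Finset.univ.erase k₀, (if k = k₀ then m k - 1 else m k) =
          ∑ k ∈ Finset.univ.erase k₀, m k :=
        Finset.sum_congr rfl fun k hk => if_neg (Finset.ne_of_mem_erase hk)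
      simp only [if_true] at h2
      omega
    obtain ⟨κ, hκ, hκm⟩ := ih _ hsum
    have hS : ∀ i ∈ S, κ i ≤ k₀ := by
      intro i hi
      have h1 : 0 < (S.filter fun j => κ j = κ i).card :=
        Finset.card_pos.2 ⟨i, Finset.mem_filter.2 ⟨hi, rfl⟩⟩
      rw [hκ] at h1
      by_cases h : κ i = k₀
      · exact h.le
      · rw [if_neg h] at h1
        exact hmax _ (Finset.mem_filter.2 ⟨Finset.mem_univ _, h1.ne'⟩)
    refine ⟨fun j => if j = a then k₀ else κ j, fun k => ?_, ?_⟩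
    · have e : (S.filter fun j => (if j = a then k₀ else κ j) = k) = S.filter fun j => κ j = k :=
        Finset.filter_congr fun j hj => by rw [if_neg (ha j hj).ne]
      simp only [Finset.filter_insert, if_true]
      rw [e]
      have h4 := hκ k
      split_ifs with h
      · rw [Finset.card_insert_of_notMem fun h' => haS (Finset.mem_filter.1 h').1, h4,
          if_pos h.symm]
        subst h
        omega
      · rw [h4, if_neg (Ne.symm h)]
    · intro i hi j hj hij
      rcases Finset.mem_insert.1 hi with rfl | hi'
      · rcases Finset.mem_insert.1 hj with rfl | hj'
        · exact le_rfl
        · exact absurd hij (not_le.2 (ha j hj'))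
      · rcases Finset.mem_insert.1 hj with rfl | hj'
        · simpa [(ha i hi').ne] using hS i hi'
        · simpa [(ha i hi').ne, (ha j hj').ne] using hκm i hi' j hj' hij

/-- Monotone families with the same multiplicities agree. -/
theorem eq_of_card_fibers_eq {q : ℕ} {β : Type*} [LinearOrder β] (J : Finset (Fin q))
    {w w' : Fin q → β} : (∀ i ∈ J, ∀ j ∈ J, i ≤ j → w i ≤ w j) →
    (∀ i ∈ J, ∀ j ∈ J, i ≤ j → w' i ≤ w' j) →
    (∀ t, (J.filter fun j => w j = t).card = (J.filter fun j => w' j = t).card) →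
    ∀ j ∈ J, w j = w' j := by
  induction J using Finset.induction_on_max with
  | empty => simp
  | insert a S ha ih =>
    intro hw hw' hc
    have haS : a ∉ S := fun h => lt_irrefl _ (ha a h)
    have hle : ∀ j ∈ insert a S, j ≤ a := fun j hj => by
      rcases Finset.mem_insert.1 hj with rfl | hj
      exacts [le_rfl, (ha j hj).le]
    have ha' := Finset.mem_insert_self a S
    -- The last index carries the largest value of either family, and the equality of multiplicities
    -- makes that value occur in the other one.
    have hwa : w a = w' a := by
      refine le_antisymm ?_ ?_
      · have h1 : 0 < ((insert a S).filter fun j => w j = w a).card :=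
          Finset.card_pos.2 ⟨a, Finset.mem_filter.2 ⟨ha', rfl⟩⟩
        rw [hc] at h1
        obtain ⟨j, hj⟩ := Finset.card_pos.1 h1
        obtain ⟨hj, hja⟩ := Finset.mem_filter.1 hj
        exact hja ▸ hw' j hj a ha' (hle j hj)
      · have h1 : 0 < ((insert a S).filter fun j => w' j = w' a).card :=
          Finset.card_pos.2 ⟨a, Finset.mem_filter.2 ⟨ha', rfl⟩⟩
        rw [← hc] at h1
        obtain ⟨j, hj⟩ := Finset.card_pos.1 h1
        obtain ⟨hj, hja⟩ := Finset.mem_filter.1 hj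
        exact hja ▸ hw j hj a ha' (hle j hj)
    intro j hj
    rcases Finset.mem_insert.1 hj with rfl | hj
    · exact hwa
    · refine ih (fun i hi j hj => hw i (Finset.mem_insert_of_mem hi) j (Finset.mem_insert_of_mem hj))
        (fun i hi j hj => hw' i (Finset.mem_insert_of_mem hi) j (Finset.mem_insert_of_mem hj))
        (fun t => ?_) j hj
      have h1 := hc t
      rw [Finset.filter_insert, Finset.filter_insert, ← hwa] at h1
      split_ifs at h1 with h
      · rw [Finset.card_insert_of_notMem fun h' => haS (Finset.mem_filter.1 h').1,
          Finset.card_insert_of_notMem fun h' => haS (Finset.mem_filter.1 h').1] at h1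
        omega
      · exact h1

/-! ### The quasi-embedded structure in terms of signs -/

/-- The function on signs with values `a, b, c` at `-1, 0, 1`. -/
def signCases {α : Type*} (a b c : α) : SignType → α
  | .neg => a
  | .zero => b
  | .pos => c

theorem sum_signType {M : Type*} [AddCommMonoid M] (F : SignType → M) :
    ∑ k, F k = F 0 + (F (-1) + F 1) := by
  have : (Finset.univ : Finset SignType) = {0, -1, 1} := rfl
  rw [this, Finset.sum_insert (by decide), Finset.sum_insert (by decide), Finset.sum_singleton]

theorem forall_signType {P : SignType → Prop} : (∀ k, P k) ↔ P (-1) ∧ P 0 ∧ P 1 :=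
  ⟨fun h => ⟨h _, h _, h _⟩, fun h k => match k with
    | .neg => h.1
    | .zero => h.2.1
    | .pos => h.2.2⟩

/-- The five cases in one format: the label `k` stands for the disk of mean curvature `k * g`. The
disks with `k = ± 1` occur at most once; the minimal disk has even multiplicity `m`, `m - 1` or `m -
2` by the parity of `m`, and multiplicity `0` when it is absent. An absent disk is represented by an
arbitrary one of the functions. -/
theorem HasQuasiEmbeddedPMC.exists_disks {n : ℕ} {O : Set (Rn1 n)} {h : CoordMetric (Rn1 n)}
    {g : Rn1 n → ℝ} {U : Set (Rn1 n)} {V : Varifold n O} {Y : Rn1 n}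
    (H : HasQuasiEmbeddedPMC h g U V Y) :
    ∃ (T : Rn1 n ≃ₗᵢ[ℝ] Rn1 n) (r s : ℝ) (m : SignType → ℕ) (f : SignType → Rn n → ℝ),
      0 < r ∧ 0 < s ∧ box Y T r s ⊆ U ∧ m (-1) ≤ 1 ∧ m 1 ≤ 1 ∧ Even (m 0) ∧
      (∀ k, m k ≠ 0 → IsDisk 2 r s (f k) ∧ HasMeanCurvature h Y T r (f k) fun X => k * g X) ∧
      (∀ k l, k ≤ l → m k ≠ 0 → m l ≠ 0 → ∀ x ∈ Metric.ball (0 : Rn n) r, f k x ≤ f l x) ∧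
      V.measure.restrict (box Y T r s ×ˢ univ) =
        ∑ k, m k • sheetVarifold (Metric.ball 0 r) Y T (f k) := by
  have o1 : ¬ (0 : SignType) ≤ -1 := by decide
  have o2 : ¬ (1 : SignType) ≤ -1 := by decide
  have o3 : ¬ (1 : SignType) ≤ 0 := by decide
  have e1 : ∀ {α : Type} (a b c : α), signCases a b c (-1) = a := fun _ _ _ => rfl
  have e2 : ∀ {α : Type} (a b c : α), signCases a b c 0 = b := fun _ _ _ => rfl
  have e3 : ∀ {α : Type} (a b c : α), signCases a b c 1 = c := fun _ _ _ => rfl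
  obtain ⟨T, r, s, hr, hs, hbox, hcases⟩ := H
  refine ⟨T, r, s, ?_⟩
  rcases hcases with ⟨f, hf, hV, hH⟩ | ⟨f, m, -, hm, hf, hV, hH⟩ |
    ⟨-, f₁, f₂, hf₁, hf₂, hle, -, hV, hH₁, hH₂⟩ |
    ⟨f', f, m, hm, hm3, -, hf', hf, hle, -, hV, hH', hH⟩ |
    ⟨f₁, f', f₂, m, hm, hm4, -, hf₁, hf', hf₂, hle, -, -, hV, hH₁, hH', hH₂⟩
  · refine ⟨signCases 0 0 1, signCases f f f, hr, hs, hbox, ?_⟩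
    simp only [forall_signType, sum_signType, e1, e2, e3]
    simpa [o1, o2, o3, hf] using ⟨hH, hV⟩
  · refine ⟨signCases 0 m 0, signCases f f f, hr, hs, hbox, ?_⟩
    simp only [forall_signType, sum_signType, e1, e2, e3]
    simpa [o1, o2, o3, hm, hf] using ⟨fun _ => hH, hV⟩
  · refine ⟨signCases 1 0 1, signCases f₁ f₁ f₂, hr, hs, hbox, ?_⟩
    simp only [forall_signType, sum_signType, e1, e2, e3]
    simpa [o1, o2, o3, hf₁, hf₂, hH₁, hH₂, hV] using fun x hx => hle x (by simpa using hx)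
  · refine ⟨signCases 0 (m - 1) 1, signCases f' f' f, hr, hs, hbox, ?_⟩
    simp only [forall_signType, sum_signType, e1, e2, e3]
    have he : Even (m - 1) := hm.tsub_odd odd_one
    simpa [o1, o2, o3, hf, hf', hH, hV, he, add_comm] using
      ⟨fun _ => hH', fun _ x hx => hle x (by simpa using hx)⟩
  · refine ⟨signCases 1 (m - 2) 1, signCases f₁ f' f₂, hr, hs, hbox, ?_⟩
    simp only [forall_signType, sum_signType, e1, e2, e3]
    have hH0 : HasMeanCurvature h Y T r f' fun _ => (0 : ℝ) := hH'
    have he : Even (m - 2) := hm.tsub even_two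
    have h13 : ∀ x : Rn n, ‖x‖ < r → f₁ x ≤ f₂ x := fun x hx =>
      (hle x (by simpa using hx)).1.trans (hle x (by simpa using hx)).2
    simpa [o1, o2, o3, hf₁, hf', hf₂, hH₁, hH₂, hV, he, add_comm] using
      (⟨fun _ => hH0, ⟨fun _ x hx => (hle x (by simpa using hx)).1, h13⟩,
        fun _ x hx => (hle x (by simpa using hx)).2⟩ : _ ∧ _ ∧ _)

/-! ### The local structure of ordered sheets -/

section LocalStructure

variable {n q : ℕ} {u : Fin q → Rn n → ℝ} {x : Rn n} {z : ℝ}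

/-- Ordered functions that touch have the same derivative. -/
theorem fderiv_eq_of_touching {v w : Rn n → ℝ} (hle : ∀ᶠ y in 𝓝 x, v y ≤ w y) (heq : v x = w x)
    (hv : DifferentiableAt ℝ v x) (hw : DifferentiableAt ℝ w x) : fderiv ℝ v x = fderiv ℝ w x := by
  have hmin : IsLocalMin (w - v) x := by
    filter_upwards [hle] with y hy
    simp only [Pi.sub_apply, heq, sub_self]
    linarith
  have h := hmin.fderiv_eq_zero
  rw [fderiv_sub hw hv, sub_eq_zero] at h
  exact h.symm

/-- A sheet that is contained in finitely many graphs, with a common tangent space at a point, has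
this tangent space. -/
theorem tangent_of_subset_graphs {T : Rn1 n ≃ₗᵢ[ℝ] Rn1 n} {f : Rn n → ℝ} {p : Rn n →L[ℝ] ℝ}
    (hf : DifferentiableAt ℝ f 0) (hf0 : f 0 = 0) (hu : ∀ j, DifferentiableAt ℝ (u j) x)
    (hp : ∀ j, u j x = z → fderiv ℝ (u j) x = p)
    (hsub : ∀ᶠ ξ in 𝓝 (0 : Rn n), ∃ j,
      u j (base (sheet (pt x z) T f ξ)) = height (sheet (pt x z) T f ξ)) (v : Rn n) :
    graphConormal p (T (pt v (fderiv ℝ f 0 v))) = 0 := by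
  set S := sheet (pt x z) T f with hS
  have hS0 : S 0 = pt x z := by simp [hS, sheet, hf0]
  have dS : DifferentiableAt ℝ S 0 :=
    (contDiffAt_const.differentiableAt one_ne_zero).add
      ((T.toContinuousLinearEquiv : Rn1 n →L[ℝ] Rn1 n).differentiableAt.comp (0 : Rn n)
        ((ptL (n := n)).differentiableAt.comp (0 : Rn n) (differentiableAt_id.prodMk hf)))
  have tb : Tendsto (fun ξ => base (S ξ)) (𝓝 0) (𝓝 x) := by
    have h := base.continuous.continuousAt.comp dS.continuousAt
    rw [ContinuousAt, Function.comp_apply, hS0, base_pt] at h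
    exact h
  have th : Tendsto (fun ξ => height (S ξ)) (𝓝 0) (𝓝 z) := by
    have h := height.continuous.continuousAt.comp dS.continuousAt
    rw [ContinuousAt, Function.comp_apply, hS0, height_pt] at h
    exact h
  have hnear : ∀ᶠ ξ in 𝓝 (0 : Rn n), ∀ j, u j (base (S ξ)) = height (S ξ) → u j x = z := by
    rw [eventually_all]
    intro j
    by_cases hj : u j x = z
    · exact Eventually.of_forall fun _ _ => hj
    · have h1 : Tendsto (fun ξ => u j (base (S ξ)) - height (S ξ)) (𝓝 0) (𝓝 (u j x - z)) :=
        ((hu j).continuousAt.tendsto.comp tb).sub th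
      filter_upwards [h1.eventually_ne (sub_ne_zero.2 hj)] with ξ hξ h
      exact absurd (sub_eq_zero.2 h) hξ
  set J := Finset.univ.filter fun j => u j x = z with hJ
  have hlo : (fun y => ∑ j ∈ J, ‖u j y - u j x - p (y - x)‖) =o[𝓝 x] fun y => y - x := by
    refine Asymptotics.IsLittleO.fun_sum fun j hj => ?_
    have := (hu j).hasFDerivAt.isLittleO
    rw [hp j (Finset.mem_filter.1 hj).2] at this
    exact this.norm_left
  have hO : (fun ξ => base (S ξ) - x) =O[𝓝 0] fun ξ : Rn n => ξ - 0 := by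
    have h := (base.differentiableAt.comp (0 : Rn n) dS).isBigO_sub
    simpa [hS0] using h
  have hlo2 := (hlo.comp_tendsto tb).trans_isBigO hO
  -- Each nearby point of the sheet lies on one of the graphs through `(x, z)`, all of slope `p`.
  -- The sum of their first order errors bounds the conormal along the sheet, so its derivative
  -- vanishes.
  have h0 : HasFDerivAt (fun ξ => graphConormal p (S ξ)) (0 : Rn n →L[ℝ] ℝ) 0 := by
    refine HasFDerivAt.of_isLittleO (Asymptotics.IsBigO.trans_isLittleO ?_ hlo2)
    refine Asymptotics.IsBigO.of_bound 1 ?_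
    filter_upwards [hsub, hnear] with ξ hξ hn
    obtain ⟨j, hj⟩ := hξ
    have hjz := hn j hj
    have hjJ : j ∈ J := Finset.mem_filter.2 ⟨Finset.mem_univ _, hjz⟩
    rw [one_mul]
    have e : graphConormal p (S ξ) - graphConormal p (S 0) - (0 : Rn n →L[ℝ] ℝ) (ξ - 0) =
        u j (base (S ξ)) - u j x - p (base (S ξ) - x) := by
      rw [hS0, hj, hjz]
      simp
      ring
    rw [e]
    refine le_trans ?_ (le_abs_self _)
    exact Finset.single_le_sum (f := fun j => ‖u j (base (S ξ)) - u j x - p (base (S ξ) - x)‖)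
      (fun i _ => norm_nonneg _) hjJ
  have h1 : HasFDerivAt (fun ξ => graphConormal p (S ξ)) ((graphConormal p).comp (fderiv ℝ S 0)) 0 :=
    (graphConormal p).hasFDerivAt.comp 0 dS.hasFDerivAt
  have h2 := congrArg (fun A : Rn n →L[ℝ] ℝ => A v) (h1.unique h0)
  rw [← fderiv_sheet_apply (pt x z) T hf]
  exact h2

/-- Near a point, the sheets through it are vertical graphs labelled by signs. -/
theorem eventually_eq_labelled (m : SignType → ℕ) (d : SignType → Rn n → ℝ)
    (hu : ∀ j, ContinuousAt (u j) x) (hmono : ∀ᶠ y in 𝓝 x, Monotone fun j => u j y)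
    (hd : ∀ k, m k ≠ 0 → ContinuousAt (d k) x ∧ d k x = z)
    (hord : ∀ k l, k ≤ l → m k ≠ 0 → m l ≠ 0 → ∀ᶠ y in 𝓝 x, d k y ≤ d l y)
    (hcount : ∀ᶠ P in 𝓝 (x, z), sheetCount u P.1 P.2 = ∑ k, if d k P.1 = P.2 then m k else 0) :
    ∃ κ : Fin q → SignType,
      (∀ k, ((Finset.univ.filter fun j => u j x = z).filter fun j => κ j = k).card = m k) ∧
      (∀ i j, i ≤ j → u i x = z → u j x = z → κ i ≤ κ j) ∧
      ∀ j, u j x = z → ∀ᶠ y in 𝓝 x, u j y = d (κ j) y := by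
  set J := Finset.univ.filter fun j => u j x = z with hJ
  have hcard : J.card = ∑ k, m k := by
    have h1 := hcount.self_of_nhds
    change J.card = ∑ k, if d k x = z then m k else 0 at h1
    rw [h1]
    refine Finset.sum_congr rfl fun k _ => ?_
    by_cases hk : m k = 0
    · simp [hk]
    · rw [if_pos (hd k hk).2]
  obtain ⟨κ, hκ, hκm⟩ := exists_monotone_labels J m hcard
  have hκ0 : ∀ j ∈ J, m (κ j) ≠ 0 := by
    intro j hj
    rw [← hκ (κ j)]
    exact Finset.card_ne_zero.2 ⟨j, by simp [hj]⟩
  refine ⟨κ, hκ, fun i j hij hi hj => hκm i (by simp [hJ, hi]) j (by simp [hJ, hj]) hij, ?_⟩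
  suffices h : ∀ᶠ y in 𝓝 x, ∀ j ∈ J, u j y = d (κ j) y by
    intro j hj
    filter_upwards [h] with y hy
    exact hy j (by simp [hJ, hj])
  rw [nhds_prod_eq, eventually_prod_iff] at hcount
  obtain ⟨pa, hpa, pb, hpb, hab⟩ := hcount
  -- A band of heights around `z` which, near `x`, only the sheets through `(x, z)` enter. Inside it
  -- the count determines the multiplicities, and outside it neither family takes values.
  obtain ⟨W, hW, hWz, hWu⟩ : ∃ W ∈ 𝓝 z, (∀ t ∈ W, pb t) ∧
      ∀ᶠ y in 𝓝 x, ∀ j, u j y ∈ W → j ∈ J := by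
    have h1 : ∀ᶠ Q : Rn n × ℝ in 𝓝 x ×ˢ 𝓝 z, ∀ j, u j Q.1 = Q.2 → j ∈ J := by
      rw [eventually_all]
      intro j
      by_cases hj : u j x = z
      · exact Eventually.of_forall fun _ _ => by simp [hJ, hj]
      · have h2 : Tendsto (fun Q : Rn n × ℝ => u j Q.1 - Q.2) (𝓝 x ×ˢ 𝓝 z) (𝓝 (u j x - z)) :=
          ((hu j).tendsto.comp tendsto_fst).sub tendsto_snd
        filter_upwards [h2.eventually_ne (sub_ne_zero.2 hj)] with Q hQ h
        exact absurd (sub_eq_zero.2 h) hQ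
    rw [eventually_prod_iff] at h1
    obtain ⟨qa, hqa, qb, hqb, hq⟩ := h1
    refine ⟨{t | pb t ∧ qb t}, hpb.and hqb, fun t ht => ht.1, ?_⟩
    filter_upwards [hqa] with y hy j hj
    exact hq hy hj.2 j rfl
  have hJW : ∀ᶠ y in 𝓝 x, ∀ j, j ∈ J → u j y ∈ W := by
    rw [eventually_all]
    intro j
    by_cases hj : u j x = z
    · have := hu j
      rw [ContinuousAt, hj] at this
      filter_upwards [this hW] with y hy _
      exact hy
    · exact Eventually.of_forall fun _ h => absurd (Finset.mem_filter.1 h).2 hj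
  have hdW : ∀ᶠ y in 𝓝 x, ∀ k, m k ≠ 0 → d k y ∈ W := by
    rw [eventually_all]
    intro k
    by_cases hk : m k = 0
    · exact Eventually.of_forall fun _ h => absurd hk h
    · have := (hd k hk).1
      rw [ContinuousAt, (hd k hk).2] at this
      filter_upwards [this hW] with y hy _
      exact hy
  have hord' : ∀ᶠ y in 𝓝 x, ∀ k l, k ≤ l → m k ≠ 0 → m l ≠ 0 → d k y ≤ d l y := by
    simp only [eventually_all]
    exact hord
  filter_upwards [hpa, hWu, hJW, hdW, hord', hmono] with y h1 h2 h3 h4 h5 h6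
  refine eq_of_card_fibers_eq J (fun i _ j _ hij => h6 hij)
    (fun i hi j hj hij => h5 _ _ (hκm i hi j hj hij) (hκ0 i hi) (hκ0 j hj)) fun t => ?_
  have e1 : (J.filter fun j => d (κ j) y = t).card = ∑ k, if d k y = t then m k else 0 := by
    rw [Finset.card_eq_sum_card_fiberwise (f := κ) (t := Finset.univ) (fun _ _ => Finset.mem_univ _)]
    refine Finset.sum_congr rfl fun k _ => ?_
    rw [← hκ k, Finset.filter_filter]
    split_ifs with h
    · congr 1
      refine Finset.filter_congr fun j _ => ⟨fun hj => hj.2, fun hj => ⟨by rw [hj, h], hj⟩⟩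
    · rw [Finset.card_eq_zero, Finset.filter_eq_empty_iff]
      rintro j _ ⟨hj, rfl⟩
      exact h hj
  rw [e1]
  by_cases ht : t ∈ W
  · rw [← hab h1 (hWz t ht), sheetCount, hJ, Finset.filter_filter]
    congr 1
    refine Finset.filter_congr fun j _ => ⟨fun hj => hj.2, fun hj => ⟨?_, hj⟩⟩
    exact (Finset.mem_filter.1 (h2 j (by rw [show u j y = t from hj]; exact ht))).2
  · rw [Finset.card_eq_zero.2, Finset.sum_eq_zero]
    · intro k _
      split_ifs with h
      · by_contra hk
        exact ht (h ▸ h4 k hk)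
      · rfl
    · rw [Finset.filter_eq_empty_iff]
      intro j hj h
      exact ht (h ▸ h3 j hj)

/-- The structure of the sheets `u` near `x`: each solves the prescribed mean curvature equation,
with a sign `κ j`; the signs of the sheets that meet over `x` are ordered and only minimal sheets,
which are even in number, coincide. -/
structure IsSignedAt (h : CoordMetric (Rn1 n)) (g : Rn1 n → ℝ) (u : Fin q → Rn n → ℝ) (x : Rn n)
    (κ : Fin q → SignType) : Prop where
  solves : ∀ j, ∀ᶠ y in 𝓝 x, SolvesPMC h g (κ j) (u j) y
  mono : ∀ i j, i ≤ j → u i x = u j x → κ i ≤ κ j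
  coincide : ∀ i j, i ≠ j → u i x = u j x → κ i = κ j → κ i = 0 ∧ u i =ᶠ[𝓝 x] u j
  even : ∀ i, Even (Finset.univ.filter fun j => u j x = u i x ∧ κ j = 0).card

/-- Two sheets with the same label share a disk of multiplicity greater than one, which must be the
minimal one, and both then equal it near `x`. -/
theorem exists_signs_of_vertical {h : CoordMetric (Rn1 n)} {g : Rn1 n → ℝ} (m : SignType → ℕ)
    (d : SignType → Rn n → ℝ) (hu : ∀ j, ContinuousAt (u j) x)
    (hmono : ∀ᶠ y in 𝓝 x, Monotone fun j => u j y) (hm₁ : m (-1) ≤ 1) (hm₂ : m 1 ≤ 1)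
    (hm₀ : Even (m 0))
    (hd : ∀ k, m k ≠ 0 → ContinuousAt (d k) x ∧ d k x = z ∧
      ∀ᶠ y in 𝓝 x, SolvesPMC h g k (d k) y)
    (hord : ∀ k l, k ≤ l → m k ≠ 0 → m l ≠ 0 → ∀ᶠ y in 𝓝 x, d k y ≤ d l y)
    (hcount : ∀ᶠ P in 𝓝 (x, z), sheetCount u P.1 P.2 = ∑ k, if d k P.1 = P.2 then m k else 0) :
    ∃ κ : Fin q → SignType, (∀ j, u j x = z → ∀ᶠ y in 𝓝 x, SolvesPMC h g (κ j) (u j) y) ∧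
      (∀ i j, i ≤ j → u i x = z → u j x = z → κ i ≤ κ j) ∧
      (∀ i j, i ≠ j → u i x = z → u j x = z → κ i = κ j → κ i = 0 ∧ u i =ᶠ[𝓝 x] u j) ∧
      Even (Finset.univ.filter fun j => u j x = z ∧ κ j = 0).card := by
  obtain ⟨κ, hκ, hκm, hκd⟩ := eventually_eq_labelled m d hu hmono
    (fun k hk => ⟨(hd k hk).1, (hd k hk).2.1⟩) hord hcount
  have hκ0 : ∀ j, u j x = z → m (κ j) ≠ 0 := by
    intro j hj
    rw [← hκ]
    exact (Finset.card_pos.2 ⟨j, by simp [hj]⟩).ne'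
  refine ⟨κ, fun j hj => ?_, hκm, fun i j hij hi hj hk => ⟨?_, ?_⟩, ?_⟩
  · filter_upwards [(hd _ (hκ0 j hj)).2.2, (hκd j hj).eventually_nhds] with y h1 h2
    have h2' : u j =ᶠ[𝓝 y] d (κ j) := h2
    have e : jet (u j) y = jet (d (κ j)) y := by
      rw [jet, jet, h2'.fderiv_eq, h2'.self_of_nhds]
    refine ⟨h1.1.congr_of_eventuallyEq h2', fun ξ hξ => ?_⟩
    rw [e] at hξ
    rw [e, h2'.fderiv.fderiv_eq]
    exact h1.2 ξ hξ
  · have h1 : 1 < m (κ i) := by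
      rw [← hκ, Finset.one_lt_card]
      exact ⟨i, by simp [hi], j, by simp [hj, hk], hij⟩
    generalize κ i = k at h1
    match k with
    | .neg => exact absurd hm₁ (not_le.2 h1)
    | .zero => rfl
    | .pos => exact absurd hm₂ (not_le.2 h1)
  · filter_upwards [hκd i hi, hκd j hj] with y h1 h2
    rw [h1, h2, hk]
  · rw [← hκ 0, Finset.filter_filter] at hm₀
    exact hm₀

end LocalStructure

/-! ### From the disks of `V` to the signs of the sheets -/

section SignedStructure

variable {n q : ℕ} {V : Varifold n (cylinderOver (unitBall n))} {u : Fin q → Rn n → ℝ}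
  {h : CoordMetric (Rn1 n)} {g : Rn1 n → ℝ} {U : Set (Rn1 n)} {x : Rn n}

/-- The sheets through one point have a common gradient `p`. The disks are contained in the union of
the sheets, hence have the tangent space of slope `p` and are themselves vertical graphs. Matching
multiplicities identifies the sheets with them. -/
theorem exists_cluster_signs (H : IsPMCData h g U) (hu : ∀ j, ContDiffOn ℝ 1 (u j) (unitBall n))
    (hmono : ∀ y ∈ unitBall n, Monotone fun j => u j y)
    (hV : V.measure = ∑ j, graphVarifold (unitBall n) (u j)) (hx : x ∈ unitBall n) (i : Fin q)
    (hQ : HasQuasiEmbeddedPMC h g U V (pt x (u i x))) :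
    ∃ κ : Fin q → SignType, (∀ j, u j x = u i x → ∀ᶠ y in 𝓝 x, SolvesPMC h g (κ j) (u j) y) ∧
      (∀ j k, j ≤ k → u j x = u i x → u k x = u i x → κ j ≤ κ k) ∧
      (∀ j k, j ≠ k → u j x = u i x → u k x = u i x → κ j = κ k → κ j = 0 ∧ u j =ᶠ[𝓝 x] u k) ∧
      Even (Finset.univ.filter fun j => u j x = u i x ∧ κ j = 0).card := by
  set z := u i x with hz
  have two : (2 : WithTop ℕ∞) ≠ 0 := by norm_num
  have hxB : unitBall n ∈ 𝓝 x := (isOpen_unitBall n).mem_nhds hx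
  obtain ⟨T, r, s, m, f, hr, hs, hbox, hm₁, hm₂, hm₀, hf, hord, hVY⟩ := hQ.exists_disks
  have hf0 : ∀ k, m k ≠ 0 → ContDiffAt ℝ 2 (f k) 0 := fun k hk =>
    (hf k hk).1.1.contDiffAt (Metric.ball_mem_nhds 0 hr)
  have hdu : ∀ j, DifferentiableAt ℝ (u j) x := fun j =>
    ((hu j).contDiffAt hxB).differentiableAt one_ne_zero
  have hmono' : ∀ᶠ y in 𝓝 x, Monotone fun j => u j y := by
    filter_upwards [hxB] with y hy using hmono y hy
  set p := fderiv ℝ (u i) x with hp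
  have hpj : ∀ j, u j x = z → fderiv ℝ (u j) x = p := by
    intro j hj
    rcases le_total j i with hji | hji
    · exact fderiv_eq_of_touching (hmono'.mono fun y hy => hy hji) hj (hdu j) (hdu i)
    · exact (fderiv_eq_of_touching (hmono'.mono fun y hy => hy hji) hj.symm (hdu i) (hdu j)).symm
  have hcount : ∀ (y : Rn n) (t : ℝ) (ξ : Rn n) (τ : ℝ), y ∈ unitBall n → ‖ξ‖ < r → |τ| < s →
      pt y t = pt x z + T (pt ξ τ) → sheetCount u y t = ∑ k, if f k ξ = τ then m k else 0 :=
    fun y t ξ τ hy hξ hτ hX => sheetCount_eq_sum hu hV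
      (fun k hk => (hf k hk).1.1.of_le (by norm_num)) hVY hy hξ hτ hX
  have hω : ∀ k, m k ≠ 0 → ∀ v, graphConormal p (T (pt v (fderiv ℝ (f k) 0 v))) = 0 := by
    intro k hk
    refine tangent_of_subset_graphs ((hf0 k hk).differentiableAt two) (hf k hk).1.2.1 hdu hpj ?_
    have hc : ContinuousAt (fun ξ => base (sheet (pt x z) T (f k) ξ)) 0 :=
      base.continuous.continuousAt.comp (contDiffAt_sheet (pt x z) T (hf0 k hk)).continuousAt
    have hc0 : base (sheet (pt x z) T (f k) 0) = x := by simp [sheet, (hf k hk).1.2.1]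
    have hB : ∀ᶠ ξ in 𝓝 (0 : Rn n), base (sheet (pt x z) T (f k) ξ) ∈ unitBall n :=
      hc (by simpa only [hc0] using hxB)
    filter_upwards [hB, Metric.ball_mem_nhds (0 : Rn n) hr] with ξ h1 h2
    have h3 := hcount _ (height (sheet (pt x z) T (f k) ξ)) ξ (f k ξ) h1
      (mem_ball_zero_iff.1 h2) ((hf k hk).1.2.2 ξ h2) (by rw [pt_base_height, sheet])
    have h4 : 0 < sheetCount u (base (sheet (pt x z) T (f k) ξ))
        (height (sheet (pt x z) T (f k) ξ)) := by
      rw [h3]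
      refine Finset.sum_pos' (fun _ _ => Nat.zero_le _) ⟨k, Finset.mem_univ k, ?_⟩
      rw [if_pos rfl]
      exact Nat.pos_of_ne_zero hk
    obtain ⟨j, hj⟩ := Finset.card_pos.1 h4
    exact ⟨j, (Finset.mem_filter.1 hj).2⟩
  have hd : ∀ k, ∃ d : Rn n → ℝ, m k ≠ 0 → ContDiffAt ℝ 2 d x ∧ d x = z ∧ fderiv ℝ d x = p ∧
      ∀ᶠ P in 𝓝 (x, z), sheetFun (pt x z) T (f k) P = 0 ↔ d P.1 = P.2 := by
    intro k
    by_cases hk : m k = 0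
    · exact ⟨0, fun h => absurd hk h⟩
    · obtain ⟨d, hd⟩ := exists_verticalGraph (x := x) (z := z) (hf0 k hk) (hf k hk).1.2.1 (hω k hk)
      exact ⟨d, fun _ => hd⟩
  choose d hd using hd
  have hcount' : ∀ᶠ P in 𝓝 (x, z),
      sheetCount u P.1 P.2 = ∑ k, if d k P.1 = P.2 then m k else 0 := by
    have e1 : ∀ᶠ P in 𝓝 (x, z), ∀ k, m k ≠ 0 →
        (sheetFun (pt x z) T (f k) P = 0 ↔ d k P.1 = P.2) := by
      rw [eventually_all]
      intro k
      by_cases hk : m k = 0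
      · exact Eventually.of_forall fun _ h => absurd hk h
      · filter_upwards [(hd k hk).2.2.2] with P hP _ using hP
    have e2 : ∀ᶠ P : Rn n × ℝ in 𝓝 (x, z), P.1 ∈ unitBall n :=
      continuous_fst.continuousAt.eventually hxB
    have e3 : ∀ᶠ P in 𝓝 (x, z), ‖frameBase (pt x z) T P‖ < r := by
      have hc := (contDiff_frameBase (k := 0) (Y := pt x z) (T := T)).continuous.norm
      exact hc.continuousAt.eventually (gt_mem_nhds (by simpa using hr))
    have e4 : ∀ᶠ P in 𝓝 (x, z), |frameHeight (pt x z) T P| < s := by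
      have hc := (contDiff_frameHeight (k := 0) (Y := pt x z) (T := T)).continuous.abs
      exact hc.continuousAt.eventually (gt_mem_nhds (by simpa using hs))
    filter_upwards [e1, e2, e3, e4] with P h1 h2 h3 h4
    rw [hcount P.1 P.2 _ _ h2 h3 h4 (pt_eq_frame P)]
    refine Finset.sum_congr rfl fun k _ => ?_
    by_cases hk : m k = 0
    · simp [hk]
    · have : f k (frameBase (pt x z) T P) = frameHeight (pt x z) T P ↔ d k P.1 = P.2 := by
        rw [← h1 k hk, sheetFun, sub_eq_zero, eq_comm]
      simp only [this]
  have hU : pt x z ∈ U := hbox ⟨0, 0, by simpa using hr, by simpa using hs, by simp⟩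
  set σ := graphConormal p (T (pt 0 1)) with hσ
  have hvert : ∀ k l, k ≤ l → m k ≠ 0 → m l ≠ 0 → ∀ᶠ y in 𝓝 x, σ * (d k y - d l y) ≤ 0 := by
    intro k l hkl hk hl
    refine verticalGraph_order (hf0 l hl) (hω l hl) ?_ (hd k hk).1.continuousAt (hd k hk).2.1
      (hd l hl).1.continuousAt (hd l hl).2.1 (hd k hk).2.2.2 (hd l hl).2.2.2
    filter_upwards [Metric.ball_mem_nhds (0 : Rn n) hr] with ξ hξ using hord k l hkl hk hl ξ hξ
  have hsolve : ∀ k, m k ≠ 0 → ∀ ε : ℝ, ε ^ 2 = 1 → 0 < ε * σ →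
      ∀ᶠ y in 𝓝 x, SolvesPMC h g (ε * k) (d k) y := fun k hk ε hε hεσ =>
    verticalGraph_solvesPMC H hr (hf k hk).1.1 (hf k hk).2 hU (hd k hk).1 (hd k hk).2.1
      (hd k hk).2.2.1 (hd k hk).2.2.2 hε hεσ
  have huc : ∀ j, ContinuousAt (u j) x := fun j => (hdu j).continuousAt
  have hσ0 : σ ≠ 0 := by
    have h1 := hcount'.self_of_nhds
    have h2 : 0 < sheetCount u x z := Finset.card_pos.2 ⟨i, by simp [hz]⟩
    change sheetCount u x z = ∑ k, if d k x = z then m k else 0 at h1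
    obtain ⟨k, -, hk⟩ := Finset.exists_ne_zero_of_sum_ne_zero (h1 ▸ h2).ne'
    exact conormal_vertical_ne_zero (hω k fun h0 => hk (by simp [h0]))
  -- When the frame's axis points below the graphs, passing to the upward normal reverses both the
  -- order of the disks and the signs of their curvatures, so the labels are negated.
  rcases hσ0.lt_or_gt with hneg | hpos
  · refine exists_signs_of_vertical (fun k => m (-k)) (fun k => d (-k)) huc hmono' (by simpa using hm₂)
      hm₁ hm₀ (fun k hk => ⟨(hd _ hk).1.continuousAt, (hd _ hk).2.1, ?_⟩) ?_ ?_
    · have h1 := hsolve (-k) hk (-1) (by norm_num) (by linarith)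
      have e : (-1 : ℝ) * ((-k : SignType) : ℝ) = k := by
        have : ∀ k : SignType, (-1 : ℝ) * ((-k : SignType) : ℝ) = k :=
          forall_signType.2 ⟨by simp, by simp, by simp⟩
        exact this k
      rwa [e] at h1
    · intro k l hkl hk hl
      have h1 := hvert (-l) (-k) ((by decide : ∀ k l : SignType, k ≤ l → -l ≤ -k) k l hkl) hl hk
      filter_upwards [h1] with y hy
      by_contra! hlt
      nlinarith [mul_pos_of_neg_of_neg hneg (sub_neg.2 hlt)]
    · filter_upwards [hcount'] with P hP
      rw [hP]
      exact (Equiv.sum_comp (Equiv.neg SignType) fun k => if d k P.1 = P.2 then m k else 0).symm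
  · refine exists_signs_of_vertical m d huc hmono' hm₁ hm₂ hm₀
      (fun k hk => ⟨(hd _ hk).1.continuousAt, (hd _ hk).2.1, ?_⟩) ?_ hcount'
    · simpa using hsolve k hk 1 (by norm_num) (by linarith)
    · intro k l hkl hk hl
      filter_upwards [hvert k l hkl hk hl] with y hy
      by_contra! hlt
      exact absurd hy (not_le.2 (mul_pos hpos (sub_pos.2 hlt)))

/-- The clusters over `x` are indexed by the heights of the sheets, and each sheet takes its label
from its own cluster. -/
theorem exists_isSignedAt (H : IsPMCData h g U) (hu : ∀ j, ContDiffOn ℝ 1 (u j) (unitBall n))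
    (hmono : ∀ y ∈ unitBall n, Monotone fun j => u j y)
    (hV : V.measure = ∑ j, graphVarifold (unitBall n) (u j)) (hx : x ∈ unitBall n)
    (hQ : ∀ i, HasQuasiEmbeddedPMC h g U V (pt x (u i x))) : ∃ κ, IsSignedAt h g u x κ := by
  have h1 : ∀ z : range fun i => u i x, ∃ κ : Fin q → SignType,
      (∀ j, u j x = z → ∀ᶠ y in 𝓝 x, SolvesPMC h g (κ j) (u j) y) ∧
      (∀ j k, j ≤ k → u j x = z → u k x = z → κ j ≤ κ k) ∧
      (∀ j k, j ≠ k → u j x = z → u k x = z → κ j = κ k → κ j = 0 ∧ u j =ᶠ[𝓝 x] u k) ∧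
      Even (Finset.univ.filter fun j => u j x = z ∧ κ j = 0).card := by
    rintro ⟨_, i, rfl⟩
    exact exists_cluster_signs H hu hmono hV hx i (hQ i)
  choose κ h1 h2 h3 h4 using h1
  refine ⟨fun j => κ ⟨u j x, mem_range_self j⟩ j, fun j => h1 _ j rfl, ?_, ?_, fun i => ?_⟩
  · intro i j hij he
    have := h2 ⟨u i x, mem_range_self i⟩ i j hij rfl he.symm
    simpa only [he] using this
  · intro i j hij he hk
    refine h3 ⟨u i x, mem_range_self i⟩ i j hij rfl he.symm ?_
    simpa only [he] using hk
  · convert h4 ⟨u i x, mem_range_self i⟩ using 3 with j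
    refine and_congr_right fun hj => ?_
    simp only [hj]

end SignedStructure

/-! ### Propagation of coincidence -/

theorem IsPreconnected.forall_of_locally {E : Type*} [TopologicalSpace E] {S : Set E}
    (hS : IsPreconnected S) {P : E → Prop} (h1 : ∀ y ∈ S, P y → ∀ᶠ z in 𝓝 y, P z)
    (h2 : ∀ y ∈ S, ¬ P y → ∀ᶠ z in 𝓝 y, ¬ P z) {x : E} (hx : x ∈ S) (hPx : P x) :
    ∀ y ∈ S, P y := by
  have hsub : S ⊆ interior {y | P y} :=
    hS.subset_left_of_subset_union isOpen_interior isOpen_interior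
      (disjoint_left.2 fun y hy hy' => (interior_subset hy' : ¬ P y) (interior_subset hy))
      (fun y hy => by
        by_cases h : P y
        · exact Or.inl (mem_interior_iff_mem_nhds.2 (h1 y hy h))
        · exact Or.inr (mem_interior_iff_mem_nhds.2 (h2 y hy h)))
      ⟨x, hx, mem_interior_iff_mem_nhds.2 (h1 x hx hPx)⟩
  exact fun y hy => interior_subset (hsub hy)

/-- A point outside of a relatively closed set `K` of a convex open set is connected, outside of
`K`, with a ball that touches `K`. -/
theorem exists_connected_touching_ball {E : Type*} [NormedAddCommGroup E] [NormedSpace ℝ E]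
    [ProperSpace E] {B K : Set E} (hB : Convex ℝ B) (hBo : IsOpen B) (hKB : K ⊆ B)
    (hK : IsOpen (B \ K)) (hne : K.Nonempty) {x : E} (hx : x ∈ B \ K) :
    ∃ (S : Set E) (x₀ N : E) (R : ℝ), IsPreconnected S ∧ S ⊆ B \ K ∧ x ∈ S ∧ x₀ ∈ K ∧ ‖N‖ = 1 ∧
      0 < R ∧ Metric.ball (x₀ + R • N) R ⊆ S := by
  obtain ⟨k, hk⟩ := hne
  set γ : ℝ → E := fun t => AffineMap.lineMap (k := ℝ) x k t with hγ
  have hγc : Continuous γ := AffineMap.lineMap_continuous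
  have hγB : ∀ t ∈ Icc (0 : ℝ) 1, γ t ∈ B := fun t ht =>
    hB.lineMap_mem hx.1 (hKB hk) ht
  have hmem : ∀ y ∈ B, y ∈ (B \ K)ᶜ → y ∈ K := fun y hy hy' => by
    by_contra h
    exact hy' ⟨hy, h⟩
  have hZ : IsCompact (Icc (0 : ℝ) 1 ∩ γ ⁻¹' (B \ K)ᶜ) :=
    isCompact_Icc.inter_right (hK.isClosed_compl.preimage hγc)
  -- The first point of `K` on the segment from `x` to `k`.
  obtain ⟨t₀, ht₀, hmin⟩ := hZ.exists_isMinOn (f := id)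
    ⟨1, ⟨zero_le_one, le_rfl⟩, fun h => h.2 (by simpa [hγ] using hk)⟩ continuous_id.continuousOn
  have hx₀K : γ t₀ ∈ K := hmem _ (hγB t₀ ht₀.1) ht₀.2
  have ht₀pos : 0 < t₀ := by
    refine lt_of_le_of_ne ht₀.1.1 fun h => hx.2 ?_
    rw [← h] at hx₀K
    simpa [hγ] using hx₀K
  have hbefore : ∀ t, 0 ≤ t → t < t₀ → γ t ∈ B \ K := fun t h0 ht => by
    by_contra hnot
    exact absurd (hmin ⟨⟨h0, ht.le.trans ht₀.1.2⟩, hnot⟩) (not_le.2 ht)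
  obtain ⟨η, hη, hηB⟩ := Metric.isOpen_iff.1 hBo _ (hKB hx₀K)
  obtain ⟨t, ht0, htt, hdist⟩ : ∃ t, 0 ≤ t ∧ t < t₀ ∧ dist (γ t) (γ t₀) < η / 2 := by
    have h1 : ∀ᶠ t in 𝓝[<] t₀, dist (γ t) (γ t₀) < η / 2 :=
      nhdsWithin_le_nhds (hγc.continuousAt (Metric.ball_mem_nhds _ (by positivity)))
    have h2 : ∀ᶠ t in 𝓝[<] t₀, t ∈ Ioo 0 t₀ := Ioo_mem_nhdsLT ht₀pos
    obtain ⟨t, h1, h2⟩ := (h1.and h2).exists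
    exact ⟨t, h2.1.le, h2.2, h1⟩
  set a := γ t with ha
  have hcB : Metric.closedBall a (η / 2) ⊆ B := fun y hy => hηB (by
    rw [Metric.mem_ball]
    calc dist y (γ t₀) ≤ dist y a + dist a (γ t₀) := dist_triangle _ _ _
      _ < η / 2 + η / 2 := add_lt_add_of_le_of_lt hy hdist
      _ = η := by ring)
  have hC : IsCompact (Metric.closedBall a (η / 2) ∩ (B \ K)ᶜ) :=
    (isCompact_closedBall a (η / 2)).inter_right hK.isClosed_compl
  -- The center `a` is taken on the segment just before `K`, so near that its closest point of `K`
  -- is attained inside `B`; the ball of this radius touches `K` from outside.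
  obtain ⟨x₀, hx₀, hnear⟩ := hC.exists_isMinOn (f := fun y => dist y a)
    ⟨γ t₀, by rw [Metric.mem_closedBall, dist_comm]; exact hdist.le, fun h => h.2 hx₀K⟩
    (continuous_id.dist continuous_const).continuousOn
  have hx₀K' : x₀ ∈ K := hmem _ (hcB hx₀.1) hx₀.2
  have haBK : a ∈ B \ K := hbefore t ht0 htt
  have hR : 0 < dist x₀ a := dist_pos.2 fun h => haBK.2 (h ▸ hx₀K')
  have hRη : dist x₀ a ≤ η / 2 := hx₀.1
  have hball : Metric.ball a (dist x₀ a) ⊆ B \ K := by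
    intro y hy
    have hy' : y ∈ Metric.closedBall a (η / 2) := (Metric.mem_ball.1 hy).le.trans hRη
    by_contra hnot
    exact absurd (show dist x₀ a ≤ dist y a from hnear ⟨hy', hnot⟩) (not_le.2 hy)
  have hcenter : x₀ + dist x₀ a • ((dist x₀ a)⁻¹ • (a - x₀)) = a := by
    rw [smul_smul, mul_inv_cancel₀ hR.ne', one_smul, add_sub_cancel]
  have hseg : IsPreconnected (γ '' Icc 0 t) := isPreconnected_Icc.image _ hγc.continuousOn
  refine ⟨γ '' Icc 0 t ∪ Metric.ball a (dist x₀ a), x₀, (dist x₀ a)⁻¹ • (a - x₀), dist x₀ a,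
    hseg.union a ⟨t, ⟨ht0, le_rfl⟩, rfl⟩ (Metric.mem_ball_self hR)
      (convex_ball a _).isPreconnected, ?_, Or.inl ⟨0, ⟨le_rfl, ht0⟩, by simp [hγ]⟩, hx₀K', ?_, hR,
    ?_⟩
  · rintro y (⟨τ, hτ, rfl⟩ | hy)
    · exact hbefore τ hτ.1 (hτ.2.trans_lt htt)
    · exact hball hy
  · rw [norm_smul, norm_inv, Real.norm_of_nonneg dist_nonneg, dist_comm, dist_eq_norm,
      inv_mul_cancel₀]
    rw [← dist_eq_norm, dist_comm]
    exact hR.ne'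
  · rw [hcenter]
    exact subset_union_right

section Propagation

variable {n q : ℕ} {u : Fin q → Rn n → ℝ} {h : CoordMetric (Rn1 n)} {g : Rn1 n → ℝ}
  {U : Set (Rn1 n)} {B K : Set (Rn n)}

/-- The right hand side is `k` times a positive quantity because `g > 0`, so the left hand side
determines `k`. -/
theorem SolvesPMC.unique (H : IsPMCData h g U) {v : Rn n → ℝ} {x : Rn n} {k l : ℝ}
    (hU : pt x (v x) ∈ U) (hk : SolvesPMC h g k v x) (hl : SolvesPMC h g l v x) : k = l := by
  have hθ : jet v x ∈ IsPMCData.jetsOver n U := hU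
  have hsymm : ∀ a b, graphForm h (jet v x) a b = graphForm h (jet v x) b a := fun a b =>
    H.symm _ hU _ _
  obtain ⟨ξ, -, hξ, -⟩ := exists_isFrame_diag (graphForm h (jet v x)) (graphForm h (jet v x))
    hsymm (fun a ha => H.graphForm_pos hθ ha) hsymm
  exact mul_right_cancel₀ (H.graphRhs_pos hθ).ne' ((hk.2 ξ hξ).symm.trans (hl.2 ξ hξ))

theorem signType_coe_injective {k l : SignType} (h : (k : ℝ) = l) : k = l := by
  have : ∀ k : SignType, SignType.sign (k : ℝ) = k := forall_signType.2 ⟨by simp, by simp, by simp⟩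
  rw [← this k, h, this]

/-- The signs are locally constant. -/
theorem IsSignedAt.eventually_eq (H : IsPMCData h g U) {κ : Rn n → Fin q → SignType} {x : Rn n}
    (hBK : ∀ᶠ y in 𝓝 x, IsSignedAt h g u y (κ y)) (hU : ∀ᶠ y in 𝓝 x, ∀ j, pt y (u j y) ∈ U) :
    ∀ᶠ y in 𝓝 x, κ y = κ x := by
  have h1 : ∀ᶠ y in 𝓝 x, ∀ j, SolvesPMC h g (κ x j) (u j) y :=
    eventually_all.2 hBK.self_of_nhds.solves
  filter_upwards [h1, hBK, hU] with y h1 h2 h3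
  funext j
  exact signType_coe_injective (SolvesPMC.unique H (h3 j) (h2.solves j).self_of_nhds (h1 j))

/-- If the sheets differed, they would be strictly ordered with curvatures in the wrong order in a
ball touching `K`, and tangent at the contact point, against the Hopf lemma. -/
theorem coincide_of_sign_le (H : IsPMCData h g U) {α : ℝ} (hα : 0 < α)
    (hB : Convex ℝ B) (hBo : IsOpen B) (hKB : K ⊆ B) (hK : IsOpen (B \ K)) (hne : K.Nonempty)
    (hu : ∀ j, IsC1Alpha α B (u j)) (hmono : ∀ x ∈ B, Monotone fun j => u j x)
    (hU : ∀ x ∈ B, ∀ j, pt x (u j x) ∈ U) (hKu : ∀ x ∈ K, ∀ i j, u i x = u j x)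
    {κ : Rn n → Fin q → SignType} (hκ : ∀ x ∈ B \ K, IsSignedAt h g u x (κ x))
    {x : Rn n} (hx : x ∈ B \ K) {i j : Fin q} (hij : i < j) (hji : κ x j ≤ κ x i) :
    u i x = u j x := by
  obtain ⟨S, x₀, N, R, hS, hSBK, hxS, hx₀, hN, hR, hball⟩ :=
    exists_connected_touching_ball hB hBo hKB hK hne hx
  have hcont : ∀ j, ∀ y ∈ B, ContinuousAt (u j) y := fun j y hy =>
    ((hu j).1.contDiffAt (hBo.mem_nhds hy)).continuousAt
  have hloc : ∀ y ∈ S, ∀ᶠ z in 𝓝 y, κ z = κ y := fun y hy => by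
    have h1 : ∀ᶠ z in 𝓝 y, z ∈ B \ K := hK.mem_nhds (hSBK hy)
    exact IsSignedAt.eventually_eq H (h1.mono hκ) (h1.mono fun z hz => hU z hz.1)
  have hconst : ∀ y ∈ S, κ y = κ x :=
    hS.forall_of_locally (fun y hy hP => (hloc y hy).mono fun z hz => hz.trans hP)
      (fun y hy hP => (hloc y hy).mono fun z hz => by rwa [hz]) hxS rfl
  by_contra hneq
  -- Difference is an open condition by continuity. Coincidence is open too: at a meeting point the
  -- signs are ordered both ways, hence equal, and sheets of equal sign that meet agree nearby.
  have hneS : ∀ y ∈ S, ¬ u i y = u j y := by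
    refine hS.forall_of_locally (fun y hy hP => ?_) (fun y hy hP => ?_) hxS hneq
    · have hc := (hcont i y (hSBK hy).1).sub (hcont j y (hSBK hy).1)
      filter_upwards [hc.eventually_ne (sub_ne_zero.2 hP)] with z hz hzij
      exact hz (sub_eq_zero.2 hzij)
    · rw [not_not] at hP
      have hs := hκ y (hSBK hy)
      have hk : κ y i = κ y j :=
        le_antisymm (hs.mono i j hij.le hP) (by rw [hconst y hy]; exact hji)
      exact (hs.coincide i j hij.ne hP hk).2.mono fun z hz => not_not.2 hz
  have hx₀B := hKB hx₀
  obtain ⟨η, hη, hηB⟩ := Metric.nhds_basis_closedBall.mem_iff.1 (hBo.mem_nhds hx₀B)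
  have hHol : ∀ j, ∃ C, ∀ᶠ y in 𝓝 x₀, DifferentiableAt ℝ (u j) y ∧
      ‖fderiv ℝ (u j) y - fderiv ℝ (u j) x₀‖ ≤ C * ‖y - x₀‖ ^ α := by
    intro j
    obtain ⟨C, hC⟩ := (hu j).2 _ hηB (isCompact_closedBall x₀ η)
    refine ⟨C, ?_⟩
    filter_upwards [Metric.closedBall_mem_nhds x₀ hη] with y hy
    exact ⟨((hu j).1.contDiffAt (hBo.mem_nhds (hηB hy))).differentiableAt one_ne_zero,
      hC y hy x₀ (Metric.mem_closedBall_self hη.le)⟩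
  choose C hC using hHol
  have hC' : ∀ l, C l ≤ max (C i) (C j) → ∀ᶠ y in 𝓝 x₀, DifferentiableAt ℝ (u l) y ∧
      ‖fderiv ℝ (u l) y - fderiv ℝ (u l) x₀‖ ≤ max (C i) (C j) * ‖y - x₀‖ ^ α := fun l hl => by
    filter_upwards [hC l] with y hy
    exact ⟨hy.1, hy.2.trans (mul_le_mul_of_nonneg_right hl (by positivity))⟩
  obtain ⟨L, μ, b, δ, hreg⟩ := H.exists_regularCoeffs (θ₀ := jet (u i) x₀) (hU x₀ hx₀B i)
  have hcast : ((κ x j : SignType) : ℝ) ≤ κ x i := by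
    have : ∀ k l : SignType, k ≤ l → (k : ℝ) ≤ l := by
      refine forall_signType.2 ⟨forall_signType.2 ?_, forall_signType.2 ?_, forall_signType.2 ?_⟩
      all_goals
        refine ⟨fun h => ?_, fun h => ?_, fun h => ?_⟩ <;>
          first | exact absurd h (by decide) | norm_num
    exact this _ _ hji
  refine hopf_touching hreg hcast hN hR hα (hC' i (le_max_left _ _)) (hC' j (le_max_right _ _))
    ?_ (hKu x₀ hx₀ i j) (fun y hy => ?_) (fun y hy => ?_)
  · filter_upwards [hBo.mem_nhds hx₀B] with y hy using hmono y hy hij.le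
  · exact lt_of_le_of_ne (hmono y (hSBK (hball hy)).1 hij.le) (hneS y (hball hy))
  · have hs := hκ y (hSBK (hball hy))
    rw [hconst y (hball hy)] at hs
    exact ⟨(hs.solves i).self_of_nhds, (hs.solves j).self_of_nhds⟩

end Propagation

/-! ### At most three sheets -/

section Signs

variable {q : ℕ} {κ : Fin q → SignType} {w : Fin q → ℝ}

/-- The relation between the signs and the heights of ordered sheets: the signs increase strictly,
except along sheets of sign `0`, which coincide. -/
def IsSignSequence (κ : Fin q → SignType) (w : Fin q → ℝ) : Prop :=
  ∀ i j, i < j → κ i < κ j ∨ κ i = 0 ∧ κ j = 0 ∧ w i = w j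

theorem IsSignSequence.monotone (H : IsSignSequence κ w) : Monotone κ := by
  intro i j hij
  rcases hij.eq_or_lt with rfl | hij
  · exact le_rfl
  · rcases H i j hij with h | ⟨h1, h2, -⟩
    · exact h.le
    · rw [h1, h2]

theorem IsSignSequence.eq_of_zero (H : IsSignSequence κ w) {i j : Fin q} (hi : κ i = 0)
    (hj : κ j = 0) : w i = w j := by
  rcases lt_trichotomy i j with h | rfl | h
  · rcases H i j h with h' | h'
    · rw [hi, hj] at h'; exact absurd h' (lt_irrefl _)
    · exact h'.2.2
  · rfl
  · rcases H j i h with h' | h'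
    · rw [hi, hj] at h'; exact absurd h' (lt_irrefl _)
    · exact h'.2.2.symm

theorem IsSignSequence.eq_of_ne_zero (H : IsSignSequence κ w) {i j : Fin q} (hi : κ i ≠ 0)
    (hij : κ i = κ j) : i = j := by
  rcases lt_trichotomy i j with h | h | h
  · rcases H i j h with h' | h'
    · rw [hij] at h'; exact absurd h' (lt_irrefl _)
    · exact absurd h'.1 hi
  · exact h
  · rcases H j i h with h' | h'
    · rw [hij] at h'; exact absurd h' (lt_irrefl _)
    · exact absurd h'.2.1 hi

theorem card_eq_sum_signs (κ : Fin q → SignType) :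
    q = (Finset.univ.filter fun j => κ j = 0).card +
      ((Finset.univ.filter fun j => κ j = -1).card + (Finset.univ.filter fun j => κ j = 1).card) := by
  have h := Finset.card_eq_sum_card_fiberwise (f := κ) (s := Finset.univ) (t := Finset.univ)
    (fun _ _ => Finset.mem_univ _)
  rw [sum_signType, Finset.card_univ, Fintype.card_fin] at h
  exact h

theorem IsSignSequence.card_fiber_le_one (H : IsSignSequence κ w) {k : SignType} (hk : k ≠ 0) :
    (Finset.univ.filter fun j => κ j = k).card ≤ 1 := by
  refine Finset.card_le_one.2 fun i hi j hj => ?_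
  have hi := (Finset.mem_filter.1 hi).2
  have hj := (Finset.mem_filter.1 hj).2
  exact H.eq_of_ne_zero (hi ▸ hk) (hi.trans hj.symm)

theorem signType_cases (k : SignType) : k = 0 ∨ k = -1 ∨ k = 1 := by
  revert k; decide

/-- An even number of sheets that do not all coincide: the lowest has sign `-1`, the highest has
sign `1`, and the others have sign `0`. -/
theorem IsSignSequence.of_even (H : IsSignSequence κ w)
    (h0 : Even (Finset.univ.filter fun j => κ j = 0).card) (hq : Even q) {a b : Fin q}
    (ha : ∀ j, a ≤ j) (hb : ∀ j, j ≤ b) (hne : ∃ i j, w i ≠ w j) :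
    κ a = -1 ∧ κ b = 1 ∧ ∀ j, j ≠ a → j ≠ b → κ j = 0 := by
  have hsum := card_eq_sum_signs κ
  have hn := H.card_fiber_le_one (k := -1) (by decide)
  have hp := H.card_fiber_le_one (k := 1) (by decide)
  set cn := (Finset.univ.filter fun j => κ j = -1).card with hcn
  set cp := (Finset.univ.filter fun j => κ j = 1).card with hcp
  -- Both counts are at most one and their sum is even.
  have hpar : cn = cp := by
    obtain ⟨e, he⟩ := h0
    obtain ⟨e', he'⟩ := hq
    omega
  have hcn1 : cn = 1 := by
    by_contra h
    have h1 : cn = 0 := by omega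
    have h2 : cp = 0 := by omega
    rw [hcn, Finset.card_eq_zero, Finset.filter_eq_empty_iff] at h1
    rw [hcp, Finset.card_eq_zero, Finset.filter_eq_empty_iff] at h2
    have hz : ∀ j, κ j = 0 := fun j => by
      rcases signType_cases (κ j) with h | h | h
      · exact h
      · exact absurd h (h1 (Finset.mem_univ j))
      · exact absurd h (h2 (Finset.mem_univ j))
    obtain ⟨i, j, hij⟩ := hne
    exact hij (H.eq_of_zero (hz i) (hz j))
  obtain ⟨i, hi⟩ := Finset.card_pos.1 (show 0 < cn by omega)
  obtain ⟨j, hj⟩ := Finset.card_pos.1 (show 0 < cp by omega)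
  have hi := (Finset.mem_filter.1 hi).2
  have hj := (Finset.mem_filter.1 hj).2
  have hka : κ a = -1 := by
    have h1 := H.monotone (ha i)
    rw [hi] at h1
    revert h1; generalize κ a = k; revert k; decide
  have hkb : κ b = 1 := by
    have h1 := H.monotone (hb j)
    rw [hj] at h1
    revert h1; generalize κ b = k; revert k; decide
  refine ⟨hka, hkb, fun l hla hlb => ?_⟩
  rcases signType_cases (κ l) with h | h | h
  · exact h
  · exact absurd (H.eq_of_ne_zero (by rw [h]; decide) (h.trans hka.symm)) hla
  · exact absurd (H.eq_of_ne_zero (by rw [h]; decide) (h.trans hkb.symm)) hlb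

/-- An odd number of sheets consists of the lowest and the highest one. -/
theorem IsSignSequence.of_odd (H : IsSignSequence κ w)
    (h0 : Even (Finset.univ.filter fun j => κ j = 0).card) (hq : Odd q) {a b : Fin q}
    (ha : ∀ j, a ≤ j) (hb : ∀ j, j ≤ b) (j : Fin q) : w j = w a ∨ w j = w b := by
  have hsum := card_eq_sum_signs κ
  have hn := H.card_fiber_le_one (k := -1) (by decide)
  have hp := H.card_fiber_le_one (k := 1) (by decide)
  set cn := (Finset.univ.filter fun j => κ j = -1).card with hcn
  set cp := (Finset.univ.filter fun j => κ j = 1).card with hcp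
  -- If both nonzero signs occurred, `q` would be two more than an even number.
  have hab : κ a ≠ -1 ∨ κ b ≠ 1 := by
    by_contra! h
    have h1 : 0 < cn := Finset.card_pos.2 ⟨a, by simp [h.1]⟩
    have h2 : 0 < cp := Finset.card_pos.2 ⟨b, by simp [h.2]⟩
    obtain ⟨e, he⟩ := h0
    obtain ⟨e', he'⟩ := hq
    omega
  have hja := H.monotone (ha j)
  have hjb := H.monotone (hb j)
  rcases signType_cases (κ j) with h | h | h
  · rcases hab with hk | hk
    · left
      refine H.eq_of_zero h ?_
      rw [h] at hja
      revert hja hk; generalize κ a = k; revert k; decide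
    · right
      refine H.eq_of_zero h ?_
      rw [h] at hjb
      revert hjb hk; generalize κ b = k; revert k; decide
  · left
    have : κ j = κ a := by
      rw [h] at hja ⊢
      revert hja; generalize κ a = k; revert k; decide
    rw [H.eq_of_ne_zero (by rw [h]; decide) this]
  · right
    have : κ j = κ b := by
      rw [h] at hjb ⊢
      revert hjb; generalize κ b = k; revert k; decide
    rw [H.eq_of_ne_zero (by rw [h]; decide) this]

end Signs

/-- Finitely many graphs that are pairwise disjoint over an open set form an embedded
hypersurface. -/
theorem isEmbeddedHypersurface_graphs {n m : ℕ} {v : Fin m → Rn n → ℝ} {Ω : Set (Rn n)}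
    (hΩ : IsOpen Ω) (hv : ∀ j, ContDiffOn ℝ 1 (v j) Ω)
    (hlt : ∀ x ∈ Ω, StrictMono fun j => v j x) :
    IsEmbeddedHypersurface (⋃ j, graphOver Ω (v j)) := by
  intro Y hY
  obtain ⟨i, x, hx, rfl⟩ := mem_iUnion.1 hY
  have hcont : ∀ j, ContinuousAt (v j) x := fun j =>
    ((hv j).contDiffAt (hΩ.mem_nhds hx)).continuousAt
  -- With gaps of `2 * δ` over `x` and oscillations below `δ`, no other sheet enters the box of
  -- height `δ` around this one.
  obtain ⟨δ, hδ, hgap⟩ : ∃ δ > 0, ∀ j, j ≠ i → 2 * δ ≤ |v j x - v i x| := by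
    have h1 : ∀ j, ∃ δ > 0, j ≠ i → 2 * δ ≤ |v j x - v i x| := by
      intro j
      by_cases hj : j = i
      · exact ⟨1, one_pos, fun h => absurd hj h⟩
      · have : 0 < |v j x - v i x| :=
          abs_pos.2 (sub_ne_zero.2 fun h => hj ((hlt x hx).injective h))
        exact ⟨|v j x - v i x| / 2, by positivity, fun _ => by linarith⟩
    choose δ hδ hgap using h1
    have hne : (Finset.univ : Finset (Fin m)).Nonempty := ⟨i, Finset.mem_univ i⟩
    obtain ⟨j₀, -, hj₀⟩ := Finset.exists_min_image Finset.univ δ hne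
    exact ⟨δ j₀, hδ j₀, fun j hj =>
      (mul_le_mul_of_nonneg_left (hj₀ j (Finset.mem_univ j)) zero_le_two).trans (hgap j hj)⟩
  obtain ⟨r, hr, hball⟩ : ∃ r > 0, ∀ y ∈ Metric.ball x r, y ∈ Ω ∧ ∀ j, |v j y - v j x| < δ := by
    have h1 : ∀ᶠ y in 𝓝 x, y ∈ Ω := hΩ.mem_nhds hx
    have h2 : ∀ᶠ y in 𝓝 x, ∀ j, |v j y - v j x| < δ :=
      eventually_all.2 fun j => (hcont j).eventually (Metric.ball_mem_nhds (v j x) hδ)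
    exact Metric.eventually_nhds_iff_ball.1 (h1.and h2)
  have hadd : ∀ ξ ∈ Metric.ball (0 : Rn n) r, x + ξ ∈ Metric.ball x r := fun ξ hξ => by
    simpa using hξ
  refine ⟨LinearIsometryEquiv.refl ℝ (Rn1 n), r, δ, fun ξ => v i (x + ξ) - v i x, hr, hδ,
    ⟨?_, by simp, fun ξ hξ => (hball _ (hadd ξ hξ)).2 i⟩, ?_⟩
  · exact ((hv i).comp (contDiff_const.add contDiff_id).contDiffOn
      fun ξ hξ => (hball _ (hadd ξ hξ)).1).sub contDiffOn_const
  · have hsheet : ∀ ξ, sheet (pt x (v i x)) (LinearIsometryEquiv.refl ℝ (Rn1 n))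
        (fun ξ => v i (x + ξ) - v i x) ξ = pt (x + ξ) (v i (x + ξ)) := fun ξ => by
      rw [sheet, LinearIsometryEquiv.coe_refl, id_eq, ← pt_add, add_sub_cancel]
    ext X
    constructor
    · rintro ⟨hX, hbox⟩
      obtain ⟨j, y, hy, rfl⟩ := mem_iUnion.1 hX
      rw [mem_box_iff] at hbox
      change ‖base (pt y (v j y) - pt x (v i x))‖ < r ∧ |height (pt y (v j y) - pt x (v i x))| < δ
        at hbox
      simp only [map_sub, base_pt, height_pt] at hbox
      obtain rfl : j = i := by
        by_contra hj
        have h1 := hgap j hj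
        have h2 := (hball y (mem_ball_iff_norm.2 hbox.1)).2 j
        have h3 : |v j x - v i x| ≤ |v j y - v j x| + |v j y - v i x| := by
          rw [abs_sub_comm (v j y) (v j x)]
          exact abs_sub_le _ _ _
        linarith [hbox.2]
      refine ⟨y - x, by simpa using hbox.1, ?_⟩
      rw [hsheet, add_sub_cancel]
    · rintro ⟨ξ, hξ, rfl⟩
      refine ⟨mem_iUnion.2 ⟨i, x + ξ, (hball _ (hadd ξ hξ)).1, (hsheet ξ).symm⟩, ?_⟩
      exact ⟨ξ, _, mem_ball_zero_iff.1 hξ, (hball _ (hadd ξ hξ)).2 i, rfl⟩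

/-! ### The sheeting theorem in coordinates -/

section Sheets

variable {n q : ℕ} {V : Varifold n (cylinderOver (unitBall n))} {u : Fin q → Rn n → ℝ} {α : ℝ}

theorem graphOver_inter_cylinderOver {Ω Ω' : Set (Rn n)} (h : Ω ⊆ Ω') (f : Rn n → ℝ) :
    graphOver Ω' f ∩ cylinderOver Ω = graphOver Ω f := by
  ext X
  constructor
  · rintro ⟨⟨x, -, rfl⟩, y, hy, t, hyt⟩
    obtain rfl : x = y := by simpa using congrArg base hyt
    exact ⟨x, hy, rfl⟩
  · rintro ⟨x, hx, rfl⟩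
    exact ⟨⟨x, h hx, rfl⟩, x, hx, _, rfl⟩

/-- The conclusion of the sheeting theorem, for sheets selected from the given ones. -/
theorem sheeting_of_selection (hu : ∀ j, IsC1Alpha α (unitBall n) (u j))
    (hmono : ∀ x ∈ unitBall n, Monotone fun j => u j x)
    (hV : V.measure = ∑ j, graphVarifold (unitBall n) (u j)) {m : ℕ} (hm1 : 1 ≤ m) (hm3 : m ≤ 3)
    (hmq : m ≤ q) (ι : Fin m → Fin q) (hι : Monotone ι)
    (hcover : ∀ x ∈ unitBall n, ∀ j, ∃ i, u j x = u (ι i) x) {Ω : Set (Rn n)}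
    (hΩ : Ω ⊆ unitBall n) (hΩo : IsOpen Ω) (hΩn : Ω.Nonempty)
    (hlt : ∀ x ∈ Ω, StrictMono fun i => u (ι i) x) :
    ∃ (m : ℕ) (v : Fin m → Rn n → ℝ), 1 ≤ m ∧ m ≤ 3 ∧ m ≤ q ∧
      (∀ j, IsC1Alpha α (unitBall n) (v j)) ∧
      ((∀ j, HolderGradOn α (unitBall n) (u j)) → ∀ j, HolderGradOn α (unitBall n) (v j)) ∧
      V.spt = ⋃ j, graphOver (unitBall n) (v j) ∧
      (∀ x ∈ unitBall n, Monotone fun j => v j x) ∧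
      ∃ Ω ⊆ unitBall n, IsOpen Ω ∧ Ω.Nonempty ∧
        (∀ x ∈ Ω, StrictMono fun j => v j x) ∧
        IsEmbeddedHypersurface (V.spt ∩ cylinderOver Ω) := by
  have hspt : V.spt = ⋃ i, graphOver (unitBall n) (u (ι i)) := by
    ext X
    rw [mem_spt_iff (fun j => (hu j).1) hV, mem_iUnion]
    constructor
    · rintro ⟨x, hx, j, rfl⟩
      obtain ⟨i, hi⟩ := hcover x hx j
      exact ⟨i, x, hx, by simp only [hi]⟩
    · rintro ⟨i, x, hx, rfl⟩
      exact ⟨x, hx, ι i, rfl⟩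
  refine ⟨m, fun i => u (ι i), hm1, hm3, hmq, fun i => hu _, fun H i => H _, hspt,
    fun x hx => (hmono x hx).comp hι, Ω, hΩ, hΩo, hΩn, hlt, ?_⟩
  rw [hspt, iUnion_inter]
  simp only [graphOver_inter_cylinderOver hΩ]
  exact isEmbeddedHypersurface_graphs hΩo (fun i => (hu (ι i)).1.mono hΩ) hlt

/-- The new sheets are picked among the old ones, so their regularity is inherited; the whole
question is which indices suffice simultaneously over all points of the ball. -/
theorem sheeting {h : CoordMetric (Rn1 n)} {g : Rn1 n → ℝ} {U : Set (Rn1 n)}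
    (H : IsPMCData h g U) (hα : 0 < α) (hu : ∀ j, IsC1Alpha α (unitBall n) (u j))
    (hmono : ∀ x ∈ unitBall n, Monotone fun j => u j x)
    (huU : ∀ j, graphOver (unitBall n) (u j) ⊆ U)
    (hV : V.measure = ∑ j, graphVarifold (unitBall n) (u j))
    (hdens : ∃ Y ∈ V.spt, V.HasDensity Y q)
    (hreg : ∀ X ∈ V.spt, ∀ θ : ℝ≥0∞, V.HasDensity X θ → θ + 1 ≤ q →
      HasQuasiEmbeddedPMC h g U V X) :
    ∃ (m : ℕ) (v : Fin m → Rn n → ℝ), 1 ≤ m ∧ m ≤ 3 ∧ m ≤ q ∧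
      (∀ j, IsC1Alpha α (unitBall n) (v j)) ∧
      ((∀ j, HolderGradOn α (unitBall n) (u j)) → ∀ j, HolderGradOn α (unitBall n) (v j)) ∧
      V.spt = ⋃ j, graphOver (unitBall n) (v j) ∧
      (∀ x ∈ unitBall n, Monotone fun j => v j x) ∧
      ∃ Ω ⊆ unitBall n, IsOpen Ω ∧ Ω.Nonempty ∧
        (∀ x ∈ Ω, StrictMono fun j => v j x) ∧
        IsEmbeddedHypersurface (V.spt ∩ cylinderOver Ω) := by
  have hu1 : ∀ j, ContDiffOn ℝ 1 (u j) (unitBall n) := fun j => (hu j).1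
  have hB := isOpen_unitBall n
  have hcont : ∀ j, ContinuousOn (u j) (unitBall n) := fun j => (hu1 j).continuousOn
  set K : Set (Rn n) := {x ∈ unitBall n | ∀ i j, u i x = u j x} with hK
  have hKne : K.Nonempty := by
    obtain ⟨Y, hY, hd⟩ := hdens
    obtain ⟨x, hx, j, rfl⟩ := (mem_spt_iff hu1 hV Y).1 hY
    have h1 : (sheetCount u x (u j x) : ℝ≥0∞) = q :=
      hasDensity_unique (hasDensity_sheetCount hu1 hV hx (u j x)) hd
    have h2 : (Finset.univ.filter fun i => u i x = u j x).card = q := by exact_mod_cast h1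
    have h3 : (Finset.univ.filter fun i => u i x = u j x) = Finset.univ := by
      rw [← Finset.card_eq_iff_eq_univ, h2, Fintype.card_fin]
    have h4 : ∀ i, u i x = u j x := fun i => by
      have h5 := Finset.mem_univ i
      rw [← h3] at h5
      simpa using h5
    exact ⟨x, hx, fun i k => (h4 i).trans (h4 k).symm⟩
  have hq : 0 < q := by
    obtain ⟨Y, hY, -⟩ := hdens
    obtain ⟨x, hx, j, rfl⟩ := (mem_spt_iff hu1 hV Y).1 hY
    exact j.pos
  have hlto : ∀ i j, IsOpen {x ∈ unitBall n | u i x < u j x} := fun i j => by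
    have h1 := (((hcont j).sub (hcont i)).isOpen_inter_preimage hB (isOpen_Ioi (a := (0 : ℝ))))
    convert h1 using 1
    ext x
    simp
  have hBK : IsOpen (unitBall n \ K) := by
    have : unitBall n \ K = ⋃ i, ⋃ j, {x ∈ unitBall n | u i x < u j x} := by
      ext x
      simp only [mem_iUnion, hK]
      constructor
      · rintro ⟨hx, hne⟩
        by_contra! hall
        exact hne ⟨hx, fun i j => le_antisymm
          (not_lt.1 fun h => hall j i ⟨hx, h⟩) (not_lt.1 fun h => hall i j ⟨hx, h⟩)⟩
      · rintro ⟨i, j, hx, hij⟩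
        exact ⟨hx, fun h => hij.ne (h.2 i j)⟩
    rw [this]
    exact isOpen_iUnion fun i => isOpen_iUnion fun j => hlto i j
  have hU : ∀ x ∈ unitBall n, ∀ j, pt x (u j x) ∈ U := fun x hx j => huU j ⟨x, hx, rfl⟩
  let a : Fin q := ⟨0, hq⟩
  let b : Fin q := ⟨q - 1, by omega⟩
  have ha : ∀ j, a ≤ j := fun j => Fin.le_def.2 (Nat.zero_le _)
  have hb : ∀ j, j ≤ b := fun j => Fin.le_def.2 (by have := j.2; change j.1 ≤ q - 1; omega)
  have hab : ∀ x ∈ unitBall n \ K, u a x < u b x := by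
    intro x hx
    refine lt_of_le_of_ne (hmono x hx.1 (ha b)) fun h => hx.2 ⟨hx.1, ?_⟩
    have h1 : ∀ j, u j x = u a x := fun j =>
      le_antisymm ((hmono x hx.1 (hb j)).trans h.ge) (hmono x hx.1 (ha j))
    exact fun i j => (h1 i).trans (h1 j).symm
  have hsigned : ∀ x, ∃ κ, x ∈ unitBall n \ K → IsSignedAt h g u x κ := by
    intro x
    by_cases hx : x ∈ unitBall n \ K
    · obtain ⟨κ, hκ⟩ := exists_isSignedAt H hu1 hmono hV hx.1 fun i => by
        refine hreg _ ((mem_spt_iff hu1 hV _).2 ⟨x, hx.1, i, rfl⟩) _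
          (hasDensity_sheetCount hu1 hV hx.1 (u i x)) ?_
        have h1 : sheetCount u x (u i x) < q := by
          rw [sheetCount]
          conv_rhs => rw [← Fintype.card_fin q, ← Finset.card_univ]
          refine Finset.card_lt_card (Finset.ssubset_univ_iff.2 fun h3 => hx.2 ⟨hx.1, ?_⟩)
          have h4 : ∀ j, u j x = u i x := fun j => by
            have h5 := Finset.mem_univ j
            rw [← h3] at h5
            simpa using h5
          exact fun j k => (h4 j).trans (h4 k).symm
        exact_mod_cast h1
      exact ⟨κ, fun _ => hκ⟩
    · exact ⟨0, fun h => absurd h hx⟩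
  choose κ hκ using hsigned
  -- Two indices whose signs do not increase must coincide by the Hopf argument; then their signs
  -- agree, and equal signs at a meeting point are `0`.
  have hseq : ∀ x ∈ unitBall n \ K, IsSignSequence (κ x) fun j => u j x := by
    intro x hx i j hij
    by_contra! hnot
    obtain ⟨h1, h2⟩ := hnot
    have h3 : u i x = u j x := coincide_of_sign_le H hα (convex_ball _ _) hB (fun _ h => h.1) hBK
      hKne hu hmono hU (fun _ h => h.2) hκ hx hij h1
    have h4 := (hκ x hx).mono i j hij.le h3
    have h5 := ((hκ x hx).coincide i j hij.ne h3 (le_antisymm h4 h1)).1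
    exact h2 h5 ((le_antisymm h4 h1) ▸ h5) h3
  -- Evenness is known cluster by cluster, but all the sheets of sign `0` coincide and so lie in a
  -- single cluster.
  have heven : ∀ x ∈ unitBall n \ K, Even (Finset.univ.filter fun j => κ x j = 0).card := by
    intro x hx
    rcases (Finset.univ.filter fun j => κ x j = 0).eq_empty_or_nonempty with h0 | ⟨i, hi⟩
    · rw [h0]; exact Even.zero
    · have hi := (Finset.mem_filter.1 hi).2
      convert (hκ x hx).even i using 3 with j
      exact ⟨fun hj => ⟨(hseq x hx).eq_of_zero hj hi, hj⟩, fun hj => hj.2⟩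
  have hconst : ∀ x ∈ K, ∀ i j, u i x = u j x := fun x hx => hx.2
  rcases (unitBall n \ K).eq_empty_or_nonempty with hempty | hBKne
  · have hall : ∀ x ∈ unitBall n, x ∈ K := sdiff_eq_empty.1 hempty
    refine sheeting_of_selection hu hmono hV le_rfl (by norm_num) hq (fun _ => a)
      (fun _ _ _ => le_rfl) (fun x hx j => ⟨0, hconst x (hall x hx) j a⟩) subset_rfl hB
      ⟨0, Metric.mem_ball_self one_pos⟩ fun x _ i j hij => ?_
    exact absurd hij (by rw [Subsingleton.elim i j]; exact lt_irrefl _)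
  by_cases hcase : ∀ x ∈ unitBall n \ K, ∀ j, u j x = u a x ∨ u j x = u b x
  · have hq2 : 2 ≤ q := by
      obtain ⟨x, hx⟩ := hBKne
      by_contra h
      have e : a = b := Fin.ext (by change 0 = q - 1; omega)
      exact absurd (hab x hx) (by rw [e]; exact lt_irrefl _)
    refine sheeting_of_selection hu hmono hV (m := 2) (by norm_num) (by norm_num) hq2 ![a, b]
      ?_ (fun x hx j => ?_) sdiff_subset hBK hBKne fun x hx => ?_
    · rw [Fin.monotone_iff_le_succ]
      intro i
      fin_cases i
      exact ha b
    · by_cases hxK : x ∈ K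
      · exact ⟨0, hconst x hxK j a⟩
      · rcases hcase x ⟨hx, hxK⟩ j with h1 | h1
        exacts [⟨0, h1⟩, ⟨1, h1⟩]
    · rw [Fin.strictMono_iff_lt_succ]
      intro i
      fin_cases i
      exact hab x hx
  · push Not at hcase
    obtain ⟨x₁, hx₁, l, hla, hlb⟩ := hcase
    -- A third height over a single point forces `q` to be even. Then the signs are the same over
    -- all points outside `K`, and the one intermediate index `l` serves everywhere.
    have hqe : Even q := by
      by_contra hodd
      rcases (hseq x₁ hx₁).of_odd (heven x₁ hx₁) (Nat.not_even_iff_odd.1 hodd) ha hb l with h1 | h1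
      exacts [hla h1, hlb h1]
    have hla' : l ≠ a := fun h => hla (by rw [h])
    have hlb' : l ≠ b := fun h => hlb (by rw [h])
    have hsigns : ∀ x ∈ unitBall n \ K,
        κ x a = -1 ∧ κ x b = 1 ∧ ∀ j, j ≠ a → j ≠ b → κ x j = 0 := fun x hx =>
      (hseq x hx).of_even (heven x hx) hqe ha hb ⟨a, b, (hab x hx).ne⟩
    have hq3 : 3 ≤ q := by
      have h1 : (l : ℕ) ≠ 0 := fun h => hla' (Fin.ext h)
      have h2 : (l : ℕ) ≠ q - 1 := fun h => hlb' (Fin.ext h)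
      have := l.2
      omega
    refine sheeting_of_selection hu hmono hV (m := 3) (by norm_num) (by norm_num) hq3 ![a, l, b]
      ?_ (fun x hx j => ?_) (Ω := {x ∈ unitBall n | u a x < u l x} ∩ {x ∈ unitBall n | u l x < u b x})
      (fun x hx => hx.1.1) ((hlto a l).inter (hlto l b))
      ⟨x₁, ⟨hx₁.1, lt_of_le_of_ne (hmono x₁ hx₁.1 (ha l)) (Ne.symm hla)⟩,
        hx₁.1, lt_of_le_of_ne (hmono x₁ hx₁.1 (hb l)) hlb⟩ fun x hx => ?_
    · rw [Fin.monotone_iff_le_succ]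
      intro i
      fin_cases i
      exacts [ha l, hb l]
    · by_cases hxK : x ∈ K
      · exact ⟨0, hconst x hxK j a⟩
      · have hs := hsigns x ⟨hx, hxK⟩
        by_cases hja : j = a
        · exact ⟨0, by rw [hja]; rfl⟩
        by_cases hjb : j = b
        · exact ⟨2, by rw [hjb]; rfl⟩
        exact ⟨1, (hseq x ⟨hx, hxK⟩).eq_of_zero (hs.2.2 j hja hjb) (hs.2.2 l hla' hlb')⟩
    · rw [Fin.strictMono_iff_lt_succ]
      intro i
      fin_cases i
      exacts [hx.1.2, hx.2.2]

end Sheets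

/-! ### The pulled back metric -/

theorem cylinderOver_eq {n : ℕ} (Ω : Set (Rn n)) : cylinderOver Ω = base ⁻¹' Ω := by
  ext X
  constructor
  · rintro ⟨x, hx, t, rfl⟩
    simpa using hx
  · exact fun hX => ⟨base X, hX, height X, (pt_base_height X).symm⟩

theorem contDiff_rescale {n : ℕ} (z : Rn1 n) (ρ : ℝ) {k : WithTop ℕ∞} :
    ContDiff ℝ k fun X : Rn1 n => z + ρ • X :=
  contDiff_const.add (contDiff_id.const_smul ρ)

theorem hasFDerivAt_rescale {n : ℕ} (z : Rn1 n) (ρ : ℝ) (X : Rn1 n) :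
    HasFDerivAt (fun X : Rn1 n => z + ρ • X) (ρ • ContinuousLinearMap.id ℝ (Rn1 n)) X :=
  ((hasFDerivAt_id X).const_smul ρ).const_add z

theorem isOpen_rescaled_cylinder {n : ℕ} (z : Rn1 n) (ρ R : ℝ) :
    IsOpen {X ∈ cylinderOver (unitBall n) | z + ρ • X ∈ Metric.ball (0 : Rn1 n) R} := by
  have hc : Continuous fun X : Rn1 n => z + ρ • X := (contDiff_rescale z ρ (k := 0)).continuous
  have h1 : IsOpen ((fun X : Rn1 n => z + ρ • X) ⁻¹' Metric.ball (0 : Rn1 n) R) :=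
    Metric.isOpen_ball.preimage hc
  have h2 : IsOpen (base ⁻¹' unitBall n : Set (Rn1 n)) := (isOpen_unitBall n).preimage base.continuous
  rw [cylinderOver_eq]
  exact h2.inter h1

theorem natCast_le_infty (k : ℕ) : (k : WithTop ℕ∞) ≤ ((⊤ : ℕ∞) : WithTop ℕ∞) :=
  WithTop.coe_le_coe.2 le_top

section Pullback

variable {n : ℕ} {N : Type*} [TopologicalSpace N] [ChartedSpace (Rn (n + 1)) N]
  [IsManifold (𝓡 (n + 1)) ∞ N] {F : Type*} [NormedAddCommGroup F] [NormedSpace ℝ F]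

theorem pullbackMetric_symm (G : SmoothMetric n N) (ψ : F → N) (x v w : F) :
    pullbackMetric G ψ x v w = pullbackMetric G ψ x w v :=
  G.symm (ψ x) (mfderiv 𝓘(ℝ, F) (𝓡 (n + 1)) ψ x v) (mfderiv 𝓘(ℝ, F) (𝓡 (n + 1)) ψ x w)

theorem pullbackMetric_pos (G : SmoothMetric n N) {ψ : F → N} {x v : F}
    (hv : mfderiv 𝓘(ℝ, F) (𝓡 (n + 1)) ψ x v ≠ 0) : 0 < pullbackMetric G ψ x v v :=
  G.pos (ψ x) _ hv

theorem contMDiffAt_mfderiv_const_apply {ψ : F → N} {x : F}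
    (hψ : ContMDiffAt 𝓘(ℝ, F) (𝓡 (n + 1)) ∞ ψ x) (v : F) :
    ContMDiffAt 𝓘(ℝ, F) ((𝓡 (n + 1)).prod 𝓘(ℝ, Rn (n + 1))) 2
      (fun y => (⟨ψ y, mfderiv 𝓘(ℝ, F) (𝓡 (n + 1)) ψ y v⟩ : TangentBundle (𝓡 (n + 1)) N)) x := by
  have : IsManifold (𝓡 (n + 1)) 1 N := IsManifold.of_le (n := ∞) (by exact_mod_cast natCast_le_infty 1)
  have : IsManifold (𝓡 (n + 1)) (2 + 1) N :=
    IsManifold.of_le (n := ∞) (by exact_mod_cast natCast_le_infty 3)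
  have h1 := hψ.mfderiv_const (m := 2) (by exact_mod_cast natCast_le_infty 3)
  have hv : ContMDiffAt 𝓘(ℝ, F) (𝓘(ℝ, F).prod 𝓘(ℝ, F)) 2
      (fun y : F => (⟨y, v⟩ : TangentBundle 𝓘(ℝ, F) F)) x :=
    contMDiffAt_vectorSpace_iff_contDiffAt.2 contDiffAt_const
  exact ContMDiffAt.clm_apply_of_inCoordinates (b₁ := id) (b₂ := ψ) h1 hv
    (hψ.of_le (by exact_mod_cast natCast_le_infty 2))

/-- The coefficients of the pulled back metric in fixed directions are a smooth bundle form applied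
to the sections `y ↦ dψ v`; two derivatives are what the mean curvature coefficients require. -/
theorem contDiffOn_pullbackMetric [FiniteDimensional ℝ F] (G : SmoothMetric n N) {ψ : F → N}
    {U : Set F} (hU : IsOpen U) (hψ : ContMDiffOn 𝓘(ℝ, F) (𝓡 (n + 1)) ∞ ψ U) :
    ContDiffOn ℝ 2 (pullbackMetric G ψ) U := by
  have : IsManifold (𝓡 (n + 1)) 1 N := IsManifold.of_le (n := ∞) (by exact_mod_cast natCast_le_infty 1)
  rw [contDiffOn_clm_apply]
  intro v
  rw [contDiffOn_clm_apply]
  intro w x hx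
  have hx' := hψ.contMDiffAt (hU.mem_nhds hx)
  refine ContDiffAt.contDiffWithinAt ?_
  have hb : ContMDiffAt 𝓘(ℝ, F) (𝓡 (n + 1)) 2 ψ x := hx'.of_le (by exact_mod_cast natCast_le_infty 2)
  have hG := (G.contMDiff.of_le (natCast_le_infty 2)).contMDiffAt
    (x := ψ x)
  have := ContMDiffAt.clm_bundle_apply₂ (F₁ := Rn (n + 1)) (F₂ := Rn (n + 1)) (F₃ := ℝ)
    (E₁ := fun y : N => TangentSpace (𝓡 (n + 1)) y) (E₂ := fun y : N => TangentSpace (𝓡 (n + 1)) y)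
    (E₃ := Bundle.Trivial N ℝ)
    (b := ψ) (ψ := fun y => G.inner (ψ y)) (hG.comp x hb)
    (contMDiffAt_mfderiv_const_apply hx' v) (contMDiffAt_mfderiv_const_apply hx' w)
  rw [Bundle.contMDiffAt_totalSpace] at this
  exact this.2.contDiffAt

theorem contDiffOn_comp_of_isC11 {g : N → ℝ} (hg : IsC11 n g) {ψ : F → N} {U : Set F}
    (hU : IsOpen U) (hψ : ContMDiffOn 𝓘(ℝ, F) (𝓡 (n + 1)) ∞ ψ U) : ContDiffOn ℝ 1 (g ∘ ψ) U := by
  have : IsManifold (𝓡 (n + 1)) 1 N := IsManifold.of_le (n := ∞) (by exact_mod_cast natCast_le_infty 1)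
  intro x hx
  have hx' : ContMDiffAt 𝓘(ℝ, F) (𝓡 (n + 1)) 1 ψ x :=
    (hψ.contMDiffAt (hU.mem_nhds hx)).of_le (by exact_mod_cast natCast_le_infty 1)
  set e := chartAt (Rn (n + 1)) (ψ x) with he
  have hmem : ψ x ∈ e.source := mem_chart_source _ _
  have h1 : ContDiffAt ℝ 1 (e ∘ ψ) x :=
    ((contMDiffOn_chart (x := ψ x)).contMDiffAt (e.open_source.mem_nhds hmem) |>.comp x
      hx').contDiffAt
  have h2 : ContDiffAt ℝ 1 (g ∘ e.symm) ((e ∘ ψ) x) :=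
    (hg e (chart_mem_atlas _ _)).1.contDiffAt (e.open_target.mem_nhds (e.map_source hmem))
  refine ContDiffAt.contDiffWithinAt ((h2.comp x h1).congr_of_eventuallyEq ?_)
  filter_upwards [hx'.continuousAt (e.open_source.mem_nhds hmem)] with y hy
  simp only [Function.comp_apply]
  rw [e.left_inv hy]

end Pullback

theorem mfderiv_rescale_apply {n : ℕ} {N : Type*} [TopologicalSpace N]
    [ChartedSpace (Rn (n + 1)) N] {p : Rn1 n → N} {z : Rn1 n} {ρ : ℝ} {X : Rn1 n}
    (hp : MDifferentiableAt 𝓘(ℝ, Rn1 n) (𝓡 (n + 1)) p (z + ρ • X)) (v : Rn1 n) :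
    mfderiv 𝓘(ℝ, Rn1 n) (𝓡 (n + 1)) (fun X => p (z + ρ • X)) X v =
      mfderiv 𝓘(ℝ, Rn1 n) (𝓡 (n + 1)) p (z + ρ • X) (ρ • v : Rn1 n) := by
  have h := (HasMFDerivAt.comp (f := fun X : Rn1 n => z + ρ • X) X hp.hasMFDerivAt
    (hasFDerivAt_rescale z ρ X).hasMFDerivAt).mfderiv
  exact congrArg (fun A : Rn1 n →L[ℝ] Rn (n + 1) => A v) h

/-- Normal coordinates are an immersion and `ρ ≠ 0`, so the pulled back metric stays positive
definite on `U`. -/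
theorem isPMCData_pullback {n : ℕ} {N : Type*} [TopologicalSpace N] [ChartedSpace (Rn (n + 1)) N]
    [IsManifold (𝓡 (n + 1)) ∞ N] (G : SmoothMetric n N) {g : N → ℝ} (hg : IsC11 n g)
    (hgpos : ∀ x, 0 < g x) {y : N} {R : ℝ} {p : Rn1 n → N} (hp : IsExponentialMap G y R p)
    {z : Rn1 n} {ρ : ℝ} (hρ : 0 < ρ) {ψ : Rn1 n → N} (hψ : ∀ X, ψ X = p (z + ρ • X))
    {U : Set (Rn1 n)} (hUo : IsOpen U) (hU : ∀ X ∈ U, z + ρ • X ∈ Metric.ball 0 R) :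
    IsPMCData (pullbackMetric G ψ) (g ∘ ψ) U := by
  obtain rfl : ψ = fun X => p (z + ρ • X) := funext hψ
  have haff := contDiff_rescale z ρ (k := ∞)
  have hsm : ContMDiffOn 𝓘(ℝ, Rn1 n) (𝓡 (n + 1)) ∞ (fun X => p (z + ρ • X)) U :=
    hp.smooth.comp haff.contMDiff.contMDiffOn hU
  refine ⟨hUo, contDiffOn_pullbackMetric G hUo hsm, fun X _ => pullbackMetric_symm G _ X,
    fun X hX v hv => pullbackMetric_pos G fun h0 => ?_, contDiffOn_comp_of_isC11 hg hUo hsm,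
    fun X _ => hgpos _⟩
  have h1 : MDifferentiableAt 𝓘(ℝ, Rn1 n) (𝓡 (n + 1)) p (z + ρ • X) :=
    (hp.smooth.contMDiffAt (Metric.isOpen_ball.mem_nhds (hU X hX))).mdifferentiableAt (by simp)
  have h2 : mfderiv 𝓘(ℝ, Rn1 n) (𝓡 (n + 1)) p (z + ρ • X) (ρ • v : Rn1 n) = 0 :=
    (mfderiv_rescale_apply h1 v).symm.trans h0
  have h3 : ρ • v = 0 := hp.immersion _ (hU X hX) (h2.trans (map_zero _).symm)
  exact hv ((smul_eq_zero.1 h3).resolve_left hρ.ne')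

/-! ### The theorem, by pulling back to the cylinder -/

theorem mainTheorem10 {n : ℕ} (hn : 2 ≤ n)
    {N : Type*} [TopologicalSpace N] [T2Space N] [SecondCountableTopology N]
    [ChartedSpace (Rn (n + 1)) N] [IsManifold (𝓡 (n + 1)) ∞ N]
    (G : SmoothMetric n N) (g : N → ℝ) (hg : IsC11 n g) (hgpos : ∀ x, 0 < g x)
    (W : ℝ → ℝ) (hW : IsDoubleWell W)
    -- normal coordinates `p` at `y`, followed by a rescaling
    (y : N) (R : ℝ) (hR : 0 < R) (p : Rn1 n → N) (hp : IsExponentialMap G y R p)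
    (z : Rn1 n) (ρ : ℝ) (hρ : 0 < ρ) (ψ : Rn1 n → N) (hψ : ∀ X, ψ X = p (z + ρ • X))
    (U : Set (Rn1 n)) (hU : U = {X ∈ cylinderOver (unitBall n) | z + ρ • X ∈ Metric.ball 0 R})
    -- the varifold
    (V : Varifold n (cylinderOver (unitBall n))) (hV : IsPullbackOfLimitVarifold G W g ψ U V)
    (q : ℕ) (α : ℝ) (hα : 0 < α ∧ α < 1) (u : Fin q → Rn n → ℝ)
    (hu : ∀ j, IsC1Alpha α (unitBall n) (u j))
    (hmono : ∀ x ∈ unitBall n, Monotone fun j => u j x)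
    (huU : ∀ j, graphOver (unitBall n) (u j) ⊆ U)
    (hVu : V.measure = ∑ j, graphVarifold (unitBall n) (u j))
    (hdens : ∃ Y ∈ V.spt, V.HasDensity Y q)
    (hreg : ∀ X ∈ V.spt, ∀ θ : ℝ≥0∞, V.HasDensity X θ → θ + 1 ≤ q →
      HasQuasiEmbeddedPMC (pullbackMetric G ψ) (g ∘ ψ) U V X) :
    ∃ (m : ℕ) (v : Fin m → Rn n → ℝ), 1 ≤ m ∧ m ≤ 3 ∧ m ≤ q ∧
      (∀ j, IsC1Alpha α (unitBall n) (v j)) ∧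
      ((∀ j, HolderGradOn α (unitBall n) (u j)) → ∀ j, HolderGradOn α (unitBall n) (v j)) ∧
      V.spt = ⋃ j, graphOver (unitBall n) (v j) ∧
      (∀ x ∈ unitBall n, Monotone fun j => v j x) ∧
      ∃ Ω ⊆ unitBall n, IsOpen Ω ∧ Ω.Nonempty ∧
        (∀ x ∈ Ω, StrictMono fun j => v j x) ∧
        IsEmbeddedHypersurface (V.spt ∩ cylinderOver Ω) := by
  have hUo : IsOpen U := hU ▸ isOpen_rescaled_cylinder z ρ R
  have hUR : ∀ X ∈ U, z + ρ • X ∈ Metric.ball 0 R := fun X hX => by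
    rw [hU] at hX
    exact hX.2
  have H : IsPMCData (pullbackMetric G ψ) (g ∘ ψ) U :=
    isPMCData_pullback G hg hgpos hp hρ hψ hUo hUR
  exact sheeting H hα.1 hu hmono huU hVu hdens hreg
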